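/- **Lemma 4.7 (geometric Poincaré inequality).** Let $\mathbb{T}^3=\mathbb{R}^3/\mathbb{Z}^3$ be the flat torus. For a set $E\subset\mathbb{T}^3$ with smooth boundary let $\nu_E$ be the outer unit normal, $D_\tau$ the tangential gradient on $\partial E$, $H_{\partial E}=\operatorname{div}_\tau\nu_E$ the mean curvature (the sum of the principal curvatures), $|B_{\partial E}|^2$ the sum of the squares of the principal curvatures, and $\overline H_{\partial E}$ the average of $H_{\partial E}$ over $\partial E$ with respect to the surface measure $\mathcal{H}^2$. A smooth set $F\subset\mathbb{T}^3$ is called a *strictly stable critical set* (for the area functional) if $H_{\partial F}$ is constant on $\partial F$ and $$\int_{\partial F}|D_\tau\varphi|^2\,d\mathcal{H}^2-\int_{\partial F}|B_{\partial F}|^2\varphi^2\,d\mathcal{H}^2>0$$ for every $\varphi\in H^1(\partial F)\setminus\{0\}$ with $\int_{\partial F}\varphi\,d\mathcal{H}^2=0$ and $\int_{\partial F}\varphi\,(\eta\cdot\nu_F)\,d\mathcal{H}^2=0$ for all $\eta\in\mathbb{R}^3$. Let $p>2$ and let $F\subset\mathbb{T}^3$ be a smooth strictly stable critical set. Then there exist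 $\delta_1>0$ and $C>0$, depending only on $p$ and $F$, such that $$\int_{\partial E}|H_{\partial E}-\overline H_{\partial E}|^2\,d\mathcal{H}^2\le C\int_{\partial E}|D_\tau H_{\partial E}|^2\,d\mathcal{H}^2$$ for every smooth set $E\subset\mathbb{T}^3$ with $$\partial E=\{x+\psi(x)\nu_F(x):x\in\partial F\}\quad\text{for some smooth }\psi:\partial F\to\mathbb{R}\text{ with }\|\psi\|_{W^{2,p}(\partial F)}\le\delta_1 .$$ The boundaries $\partial F$ and $\partial E$ need not be connected. -/

import Mathlib

open MeasureTheory Filter Topology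
open scoped ContDiff Gradient ENNReal

noncomputable section

namespace TorusSurface

/-- Euclidean three-space. Subsets of the flat torus `ℝ³ / ℤ³` are identified with their
one-periodic extensions to `ℝ³`. -/
abbrev E3 : Type := EuclideanSpace ℝ (Fin 3)

/-- The lattice vector with integer coordinates `k`. -/
def latticeVec (k : Fin 3 → ℤ) : E3 := WithLp.toLp 2 (fun i => (k i : ℝ))

/-- `E` is one-periodic in all coordinate directions, i.e. it is (the periodic extension of) a
subset of the torus. -/
def IsPeriodicSet (E : Set E3) : Prop :=
  ∀ (k : Fin 3 → ℤ) (x : E3), x + latticeVec k ∈ E ↔ x ∈ E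

/-- The half-open unit cube, which contains exactly one representative of each point of the
torus. -/
def unitCell : Set E3 := {x | ∀ i, x i ∈ Set.Ico (0 : ℝ) 1}

/-- `ρ` is a smooth function without critical points on the open set `U`, and in `U` the set `E`
is the sublevel set `{ρ < 0}`, up to points of `{ρ = 0}`. -/
structure IsLocalDefFun (E U : Set E3) (ρ : E3 → ℝ) : Prop where
  isOpen : IsOpen U
  contDiffOn : ContDiffOn ℝ ∞ ρ U
  gradient_ne_zero : ∀ y ∈ U, ∇ ρ y ≠ 0
  mem_of_neg : ∀ y ∈ U, ρ y < 0 → y ∈ E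
  notMem_of_pos : ∀ y ∈ U, 0 < ρ y → y ∉ E

/-- Sets with smooth boundary: near each boundary point `E` lies on one side of a smooth
hypersurface. -/
def IsSmoothSet (E : Set E3) : Prop :=
  ∀ x ∈ frontier E, ∃ (U : Set E3) (ρ : E3 → ℝ), IsLocalDefFun E U ρ ∧ x ∈ U

/-- `n` is the outer unit normal of `E` at the point `x` of its boundary, read off from some local
defining function. -/
def IsOuterNormal (E : Set E3) (x n : E3) : Prop :=
  ∃ (U : Set E3) (ρ : E3 → ℝ), IsLocalDefFun E U ρ ∧ x ∈ U ∧ ρ x = 0 ∧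
    n = ‖∇ ρ x‖⁻¹ • ∇ ρ x

/-- The outer unit normal does not depend on the choice of the local defining function. -/
theorem IsOuterNormal.unique {E : Set E3} {x n m : E3} (hn : IsOuterNormal E x n)
    (hm : IsOuterNormal E x m) : n = m := by
  -- along a line through `x`, a function vanishing at `x` has the sign of its derivative
  have key : ∀ (U : Set E3) (ρ : E3 → ℝ), IsLocalDefFun E U ρ → x ∈ U → ρ x = 0 →
      ∀ v : E3, 0 < inner ℝ (∇ ρ x) v →
        ∀ᶠ t : ℝ in 𝓝[>] 0, x + t • v ∉ E ∧ x - t • v ∈ E := by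
    intro U ρ h hxU hρ v hv
    have hd : DifferentiableAt ℝ ρ x :=
      (h.contDiffOn.contDiffAt (h.isOpen.mem_nhds hxU)).differentiableAt (by simp)
    have hlin : ∀ w : E3, HasDerivAt (fun t : ℝ => x + t • w) w 0 := fun w => by
      simpa using ((hasDerivAt_id (0 : ℝ)).smul_const w).const_add x
    have hder : ∀ w : E3, HasDerivAt (fun t : ℝ => ρ (x + t • w)) (inner ℝ (∇ ρ x) w) 0 := by
      intro w
      have h1 : HasFDerivAt ρ (fderiv ℝ ρ x) (x + (0 : ℝ) • w) := by
        simpa using hd.hasFDerivAt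
      have h2 := h1.comp_hasDerivAt (0 : ℝ) (hlin w)
      have h3 : inner ℝ (∇ ρ x) w = fderiv ℝ ρ x w := by
        simp [gradient]
      rw [h3]
      exact h2
    have hU : ∀ w : E3, ∀ᶠ t : ℝ in 𝓝[>] 0, x + t • w ∈ U := fun w => by
      have hc : Tendsto (fun t : ℝ => x + t • w) (𝓝 0) (𝓝 x) := by
        simpa using (hlin w).continuousAt.tendsto
      exact (hc.eventually (h.isOpen.mem_nhds hxU)).filter_mono nhdsWithin_le_nhds
    have hpos : ∀ g : ℝ → ℝ, ∀ c : ℝ, 0 < c → HasDerivAt g c 0 → g 0 = 0 →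
        ∀ᶠ t : ℝ in 𝓝[>] 0, 0 < g t := by
      intro g c hc hg h0
      have hs := (hasDerivAt_iff_tendsto_slope.1 hg).mono_left
        (nhdsWithin_mono (0 : ℝ) (fun t (ht : 0 < t) => ht.ne'))
      filter_upwards [hs.eventually (lt_mem_nhds hc), self_mem_nhdsWithin] with t ht ht0
      have ht0' : (0 : ℝ) < t := ht0
      have : 0 < t⁻¹ * g t := by simpa [slope, h0] using ht
      exact (pos_iff_pos_of_mul_pos this).1 (inv_pos.2 ht0')
    have hA := hpos _ _ hv (hder v) (by simpa using hρ)
    have hB := hpos (fun t => -ρ (x + t • (-v))) (inner ℝ (∇ ρ x) v) hv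
      (by
        have hn := (hder (-v)).neg
        rw [inner_neg_right, neg_neg] at hn
        exact hn) (by simpa using hρ)
    filter_upwards [hA, hB, hU v, hU (-v)] with t h1 h2 h3 h4
    have h5 : x - t • v = x + t • (-v) := by simp [sub_eq_add_neg]
    exact ⟨h.notMem_of_pos _ h3 h1, h5 ▸ h.mem_of_neg _ h4 (by linarith)⟩
  obtain ⟨U, ρ, h, hxU, hρ, rfl⟩ := hn
  obtain ⟨V, σ, h', hxV, hσ, rfl⟩ := hm
  set a := ∇ ρ x with ha
  set b := ∇ σ x with hb
  have ha0 : 0 < ‖a‖ := norm_pos_iff.2 (h.gradient_ne_zero x hxU)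
  have hb0 : 0 < ‖b‖ := norm_pos_iff.2 (h'.gradient_ne_zero x hxV)
  set α := ‖a‖⁻¹ • a with hα
  set β := ‖b‖⁻¹ • b with hβ
  have hα1 : ‖α‖ = 1 := by simp [hα, norm_smul, ha0.ne']
  have hβ1 : ‖β‖ = 1 := by simp [hβ, norm_smul, hb0.ne']
  by_contra hne
  -- otherwise `v = α - β` points out of `E` for `ρ` and into `E` for `σ`
  have hlt : inner ℝ α β < 1 := (inner_lt_one_iff_real_of_norm_eq_one hα1 hβ1).2 hne
  have haα : a = ‖a‖ • α := by rw [hα, smul_smul, mul_inv_cancel₀ ha0.ne', one_smul]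
  have hbβ : b = ‖b‖ • β := by rw [hβ, smul_smul, mul_inv_cancel₀ hb0.ne', one_smul]
  have h1 : 0 < inner ℝ a (α - β) := by
    rw [haα, real_inner_smul_left, inner_sub_right, real_inner_self_eq_norm_sq, hα1]
    exact mul_pos ha0 (by linarith)
  have h2 : 0 < inner ℝ b (β - α) := by
    rw [hbβ, real_inner_smul_left, inner_sub_right, real_inner_self_eq_norm_sq, hβ1,
      real_inner_comm]
    exact mul_pos hb0 (by linarith)
  obtain ⟨t, ht1, ht2⟩ := ((key U ρ h hxU hρ _ h1).and (key V σ h' hxV hσ _ h2)).exists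
  apply ht1.1
  have h3 : x + t • (α - β) = x - t • (β - α) := by
    module
  rw [h3]
  exact ht2.2

open scoped Classical in
/-- The outer unit normal `ν_E` (zero where there is none). It does not depend on the local
defining function, see `IsOuterNormal.unique`. -/
def outerNormal (E : Set E3) (x : E3) : E3 :=
  if h : ∃ n, IsOuterNormal E x n then h.choose else 0

/-- The surface measure on `∂E` as a subset of the torus: the two-dimensional Hausdorff measure
(normalized so that it is the area on planes) on the part of `∂E` in the unit cell. -/
def surfMeasure (E : Set E3) : Measure E3 :=
  (μHE[2] : Measure E3).restrict (frontier E ∩ unitCell)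

/-- The tangential gradient `D_τ f` on `∂E` of a function `f` on `∂E`: the tangential part
`Df - (Df ⬝ ν) ν` of a gradient of `f` along the set `∂E`. It depends only on the values of `f`
on `∂E`. -/
def tangGrad (E : Set E3) (f : E3 → ℝ) (x : E3) : E3 :=
  gradientWithin f (frontier E) x -
    (inner ℝ (gradientWithin f (frontier E) x) (outerNormal E x)) • outerNormal E x

/-- The mean curvature `H = div_τ ν = ∑ i, δ_i ν_i`, which is the sum of the principal curvatures
(positive for balls). -/
def meanCurv (E : Set E3) (x : E3) : ℝ :=
  ∑ i : Fin 3, tangGrad E (fun y => outerNormal E y i) x i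

/-- The square `|B|² = |D_τ ν|² = ∑ i, |D_τ ν_i|²` of the Euclidean norm of the second fundamental
form, which is the sum of the squares of the principal curvatures. -/
def secondFormSq (E : Set E3) (x : E3) : ℝ :=
  ∑ i : Fin 3, ‖tangGrad E (fun y => outerNormal E y i) x‖ ^ 2

/-- `u` (more precisely its restriction to `∂E`) is a smooth function on `∂E`, where `∂E` is
regarded as a subset of the torus. -/
def IsSmoothOnBdry (E : Set E3) (u : E3 → ℝ) : Prop :=
  ContDiffOn ℝ ∞ u (frontier E) ∧
    ∀ (k : Fin 3 → ℤ), ∀ x ∈ frontier E, u (x + latticeVec k) = u x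

/-- The norm of the matrix `D_τ² f = (δ_i δ_j f)_{ij}`, with `δ_j f = D_τ f ⬝ e_j`. -/
def tangHessNorm (E : Set E3) (f : E3 → ℝ) (x : E3) : ℝ :=
  Real.sqrt (∑ j : Fin 3, ‖tangGrad E (fun y => tangGrad E f y j) x‖ ^ 2)

/-- The norm of `W^{2,p}(∂E)`, for smooth functions on `∂E`. -/
def sobolevNorm2 (E : Set E3) (p : ℝ) (f : E3 → ℝ) : ℝ≥0∞ :=
  eLpNorm f (ENNReal.ofReal p) (surfMeasure E) +
    eLpNorm (tangGrad E f) (ENNReal.ofReal p) (surfMeasure E) +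
    eLpNorm (tangHessNorm E f) (ENNReal.ofReal p) (surfMeasure E)

/-- `φ` is in `H¹(∂E)` and has the tangential gradient `G`: the space `H¹(∂E)` is the completion
of the smooth functions on `∂E`, i.e. `(φ, G)` is a limit of pairs `(u, D_τ u)` in `L²`. -/
def HasH1Gradient (E : Set E3) (φ : E3 → ℝ) (G : E3 → E3) : Prop :=
  MemLp φ 2 (surfMeasure E) ∧ MemLp G 2 (surfMeasure E) ∧
    ∃ u : ℕ → E3 → ℝ, (∀ n, IsSmoothOnBdry E (u n)) ∧
      Tendsto (fun n => eLpNorm (u n - φ) 2 (surfMeasure E)) atTop (𝓝 0) ∧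
      Tendsto (fun n => eLpNorm (tangGrad E (u n) - G) 2 (surfMeasure E)) atTop (𝓝 0)

/-- Critical sets of the area functional: the mean curvature is constant on the boundary. -/
def IsCriticalSet (F : Set E3) : Prop :=
  ∃ c : ℝ, ∀ x ∈ frontier F, meanCurv F x = c

/-- The quadratic form `∂²J(F)[φ] = ∫ |D_τ φ|² - ∫ |B|² φ²` of the second variation of the area,
where `G = D_τ φ`. -/
def secondVariation (F : Set E3) (φ : E3 → ℝ) (G : E3 → E3) : ℝ :=
  (∫ x, ‖G x‖ ^ 2 ∂(surfMeasure F)) - ∫ x, secondFormSq F x * φ x ^ 2 ∂(surfMeasure F)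

/-- Smooth strictly stable critical sets of the torus, for the area functional: the second
variation is positive on each nonzero `φ` in `H¹(∂F)` that has zero average and is
`L²`-orthogonal to the infinitesimal translations `η ⬝ ν_F`. -/
structure IsStrictlyStable (F : Set E3) : Prop where
  periodic : IsPeriodicSet F
  smooth : IsSmoothSet F
  critical : IsCriticalSet F
  pos : ∀ (φ : E3 → ℝ) (G : E3 → E3), HasH1Gradient F φ G →
    ∫ x, φ x ∂(surfMeasure F) = 0 →
    (∀ η : E3, ∫ x, φ x * inner ℝ η (outerNormal F x) ∂(surfMeasure F) = 0) →
    ¬ (φ =ᵐ[surfMeasure F] 0) →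
    0 < secondVariation F φ G

/-- `∂E = {x + ψ(x) ν_F(x) : x ∈ ∂F}` for a smooth function `ψ` on `∂F` whose norm in
`W^{2,p}(∂F)` is at most `δ`. -/
def IsSobolevClose (F : Set E3) (p δ : ℝ) (E : Set E3) : Prop :=
  ∃ ψ : E3 → ℝ, IsSmoothOnBdry F ψ ∧ sobolevNorm2 F p ψ ≤ ENNReal.ofReal δ ∧
    frontier E = (fun x => x + ψ x • outerNormal F x) '' frontier F

end TorusSurface

end

open TorusSurface

open MeasureTheory Filter Topology
open scoped ContDiff Gradient ENNReal

noncomputable section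

namespace TorusSurface

/-! Strict stability is only tested on locally constant functions. Let `S` be a relatively open and
closed, periodic piece of `∂F` on which a Poincaré inequality holds (in effect a component). Suppose
that the integral of `ν_F` over `S` vanishes and that `S` is not all of `∂F`. Take `φ` with one
constant value on `S` and another off `S`, of zero average. Since `ν_F` has zero average over the
whole boundary, `φ` is orthogonal to all `η ⬝ ν_F`. Its gradient is zero, so the second variation is
`-∫ |B|² φ² ≤ 0`, a contradiction (`IsStrictlyStable.frontier_subset`). Hence either one such piece
is the whole of `∂F`, or every piece has a nonzero integral of the normal.

In the first case the Poincaré inequality on `∂F`, transported to `∂E`, bounds the deviation of `H`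
from some constant. In the second case `H` could a priori be close to different constants `c` on
different pieces. The tangential divergence theorem gives `∫ H ν = 0` over each piece `S'` of `∂E`,
so `c ∫ ν = -∫ (H - c) ν` there. The left integral stays away from zero when `E` is near `F`, so
`|c|` is bounded by the `L²` norm of `H - c`, hence by that of `D_τ H`
(`IsComponent.exists_lintegral_meanCurv_le`). Thus the single constant `0` serves all pieces. In
both cases the average may replace the constant, being the best one in `L²`.

The transport is quantitative. As surfaces are two-dimensional and `p > 2`, Morrey's inequality
turns smallness in `W^{2,p}` into smallness `t` in `C¹` (`Atlas.exists_c1_bound`). Then `x ↦ x + ψ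
ν_F` is injective on `∂F`, changes area by a factor at most `(1 + 2t)²` and gradients by a factor at
most `2`, and the normal of `E` is within `2t` of `± ν_F`. The sign is needed because `E` may lie on
either side of a piece; it is constant on each piece.

The analysis on surfaces rests on graph charts and an area formula for graphs. The divergence
theorems are proved for test functions of small support and summed over the torus by a periodic
partition of unity (`integral_unitCell_eq_zero`). The Poincaré inequality on a piece is obtained by
chaining inequalities on discs through overlapping patches (`Atlas.exists_isComponent`). -/

/-! ### Local structure of sets with smooth boundary -/

/-- The tangential part of `a` with respect to the unit vector `n`. -/
def tangPart (n a : E3) : E3 := a - (inner ℝ a n) • n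

theorem inner_gradient {f : E3 → ℝ} {x : E3} (v : E3) :
    inner ℝ (∇ f x) v = fderiv ℝ f x v := by
  simp [gradient]

namespace IsLocalDefFun

variable {E U : Set E3} {ρ : E3 → ℝ} {x : E3}

theorem contDiffAt (h : IsLocalDefFun E U ρ) (hx : x ∈ U) : ContDiffAt ℝ ∞ ρ x :=
  h.contDiffOn.contDiffAt (h.isOpen.mem_nhds hx)

theorem differentiableAt (h : IsLocalDefFun E U ρ) (hx : x ∈ U) : DifferentiableAt ℝ ρ x :=
  (h.contDiffAt hx).differentiableAt (by simp)

/-- Near a zero of a local defining function there are points of either sign. -/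
theorem frequently_sign (h : IsLocalDefFun E U ρ) (hx : x ∈ U) (h0 : ρ x = 0) :
    (∃ᶠ y in 𝓝 x, ρ y < 0) ∧ ∃ᶠ y in 𝓝 x, 0 < ρ y := by
  have hd := h.differentiableAt hx
  constructor
  · intro hc
    refine h.gradient_ne_zero x hx ?_
    -- If no negative values occurred nearby, the zero at `x` would be a local minimum and the
    -- gradient would vanish.
    have : IsLocalMin ρ x := by
      filter_upwards [hc] with y hy
      rw [h0]; exact not_lt.1 hy
    simp [gradient, this.fderiv_eq_zero]
  · intro hc
    refine h.gradient_ne_zero x hx ?_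
    have : IsLocalMax ρ x := by
      filter_upwards [hc] with y hy
      rw [h0]; exact not_lt.1 hy
    simp [gradient, this.fderiv_eq_zero]

theorem eventually_mem (h : IsLocalDefFun E U ρ) (hx : x ∈ U) : ∀ᶠ y in 𝓝 x, y ∈ U :=
  h.isOpen.mem_nhds hx

theorem mem_interior_of_neg (h : IsLocalDefFun E U ρ) (hx : x ∈ U) (h0 : ρ x < 0) :
    x ∈ interior E := by
  rw [mem_interior_iff_mem_nhds]
  filter_upwards [h.eventually_mem hx,
    (h.differentiableAt hx).continuousAt.eventually (gt_mem_nhds h0)] with y hy hy'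
  exact h.mem_of_neg y hy hy'

theorem notMem_closure_of_pos (h : IsLocalDefFun E U ρ) (hx : x ∈ U) (h0 : 0 < ρ x) :
    x ∉ closure E := by
  rw [mem_closure_iff_frequently, not_frequently]
  filter_upwards [h.eventually_mem hx,
    (h.differentiableAt hx).continuousAt.eventually (lt_mem_nhds h0)] with y hy hy'
  exact h.notMem_of_pos y hy hy'

/-- A defining function leaves membership undecided on its zero set. Both signs occur near each
zero, which forces the zero set to be exactly the boundary. -/
theorem mem_frontier_iff (h : IsLocalDefFun E U ρ) (hx : x ∈ U) : x ∈ frontier E ↔ ρ x = 0 := by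
  constructor
  · intro hf
    rcases lt_trichotomy (ρ x) 0 with h0 | h0 | h0
    · exact absurd (h.mem_interior_of_neg hx h0) hf.2
    · exact h0
    · exact absurd hf.1 (h.notMem_closure_of_pos hx h0)
  · intro h0
    obtain ⟨h1, h2⟩ := h.frequently_sign hx h0
    constructor
    · rw [mem_closure_iff_frequently]
      exact (h1.and_eventually (h.eventually_mem hx)).mono fun y hy => h.mem_of_neg y hy.2 hy.1
    · rw [mem_interior_iff_mem_nhds]
      intro hc
      obtain ⟨y, ⟨hy, hyU⟩, hyE⟩ :=
        ((h2.and_eventually (h.eventually_mem hx)).and_eventually hc).exists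
      exact h.notMem_of_pos y hyU hy hyE

theorem mem_interior_iff (h : IsLocalDefFun E U ρ) (hx : x ∈ U) : x ∈ interior E ↔ ρ x < 0 := by
  refine ⟨fun hi => ?_, h.mem_interior_of_neg hx⟩
  rcases lt_trichotomy (ρ x) 0 with h0 | h0 | h0
  · exact h0
  · exact absurd hi ((h.mem_frontier_iff hx).2 h0).2
  · exact absurd (subset_closure (interior_subset hi)) (h.notMem_closure_of_pos hx h0)

theorem outerNormal_eq (h : IsLocalDefFun E U ρ) (hx : x ∈ U) (h0 : ρ x = 0) :
    outerNormal E x = ‖∇ ρ x‖⁻¹ • ∇ ρ x := by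
  have hn : IsOuterNormal E x (‖∇ ρ x‖⁻¹ • ∇ ρ x) := ⟨U, ρ, h, hx, h0, rfl⟩
  have hex : ∃ n, IsOuterNormal E x n := ⟨_, hn⟩
  rw [outerNormal, dif_pos hex]
  exact hex.choose_spec.unique hn

/-- A local defining function of a translated periodic set. -/
theorem translate (h : IsLocalDefFun E U ρ) (hE : IsPeriodicSet E) (k : Fin 3 → ℤ) :
    IsLocalDefFun E ((fun y => y - latticeVec k) ⁻¹' U) (fun y => ρ (y - latticeVec k)) := by
  have hm : ∀ y, y ∈ E ↔ y - latticeVec k ∈ E := fun y => by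
    rw [← hE k (y - latticeVec k), sub_add_cancel]
  refine ⟨h.isOpen.preimage (by fun_prop), ?_, ?_, ?_, ?_⟩
  · exact h.contDiffOn.comp (by fun_prop) (fun y hy => hy)
  · intro y hy
    have := h.gradient_ne_zero _ hy
    simpa [gradient, fderiv_comp_sub] using this
  · intro y hy hn
    exact (hm y).2 (h.mem_of_neg _ hy hn)
  · intro y hy hn hyE
    exact h.notMem_of_pos _ hy hn ((hm y).1 hyE)

end IsLocalDefFun

section Normal

variable {E : Set E3} {x : E3}

theorem IsSmoothSet.exists_localDefFun (hE : IsSmoothSet E) (hx : x ∈ frontier E) :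
    ∃ U ρ, IsLocalDefFun E U ρ ∧ x ∈ U ∧ ρ x = 0 := by
  obtain ⟨U, ρ, h, hxU⟩ := hE x hx
  exact ⟨U, ρ, h, hxU, (h.mem_frontier_iff hxU).1 hx⟩

/-- The normal extends to a smooth unit vector field near each boundary point. -/
theorem IsSmoothSet.exists_normalField (hE : IsSmoothSet E) (hx : x ∈ frontier E) :
    ∃ (U : Set E3) (N : E3 → E3), IsOpen U ∧ x ∈ U ∧ ContDiffOn ℝ ∞ N U ∧ (∀ y ∈ U, ‖N y‖ = 1) ∧
      ∀ y ∈ U, y ∈ frontier E → outerNormal E y = N y := by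
  obtain ⟨U, ρ, h, hxU, -⟩ := hE.exists_localDefFun hx
  refine ⟨U, fun y => ‖∇ ρ y‖⁻¹ • ∇ ρ y, h.isOpen, hxU, ?_, ?_, ?_⟩
  · have hg : ContDiffOn ℝ ∞ (fun y => ∇ ρ y) U := by
      have h1 : ContDiffOn ℝ ∞ (fderiv ℝ ρ) U := h.contDiffOn.fderiv_of_isOpen h.isOpen (by simp)
      exact (InnerProductSpace.toDual ℝ E3).symm.contDiff.comp_contDiffOn h1
    refine ContDiffOn.smul (ContDiffOn.inv (hg.norm ℝ h.gradient_ne_zero) ?_) hg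
    intro y hy
    exact norm_ne_zero_iff.2 (h.gradient_ne_zero y hy)
  · intro y hy
    have := norm_ne_zero_iff.2 (h.gradient_ne_zero y hy)
    simp [norm_smul, this]
  · intro y hy hyf
    exact h.outerNormal_eq hy ((h.mem_frontier_iff hy).1 hyf)

theorem IsSmoothSet.norm_outerNormal (hE : IsSmoothSet E) (hx : x ∈ frontier E) :
    ‖outerNormal E x‖ = 1 := by
  obtain ⟨U, N, -, hxU, -, h1, h2⟩ := hE.exists_normalField hx
  rw [h2 x hxU hx, h1 x hxU]

theorem latticeVec_neg (k : Fin 3 → ℤ) : latticeVec (-k) = -latticeVec k := by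
  ext i; simp [latticeVec]

theorem latticeVec_add (k l : Fin 3 → ℤ) : latticeVec (k + l) = latticeVec k + latticeVec l := by
  ext i; simp [latticeVec]

theorem latticeVec_zero : latticeVec 0 = 0 := by
  ext i; simp [latticeVec]

@[simp] theorem latticeVec_apply (k : Fin 3 → ℤ) (i : Fin 3) : latticeVec k i = k i := rfl

theorem IsPeriodicSet.preimage_eq (hE : IsPeriodicSet E) (k : Fin 3 → ℤ) :
    (fun y => y + latticeVec k) ⁻¹' E = E := by
  ext y; exact hE k y

theorem IsPeriodicSet.frontier (hE : IsPeriodicSet E) : IsPeriodicSet (frontier E) := by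
  intro k x
  have h := (Homeomorph.addRight (latticeVec k)).preimage_frontier E
  have h2 : (Homeomorph.addRight (latticeVec k)) ⁻¹' E = E := hE.preimage_eq k
  rw [h2] at h
  exact Set.ext_iff.1 h x

theorem IsPeriodicSet.interior (hE : IsPeriodicSet E) : IsPeriodicSet (interior E) := by
  intro k x
  have h := (Homeomorph.addRight (latticeVec k)).preimage_interior E
  have h2 : (Homeomorph.addRight (latticeVec k)) ⁻¹' E = E := hE.preimage_eq k
  rw [h2] at h
  exact Set.ext_iff.1 h x

theorem IsSmoothSet.outerNormal_add (hE : IsSmoothSet E) (hp : IsPeriodicSet E)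
    (hx : x ∈ _root_.frontier E) (k : Fin 3 → ℤ) :
    outerNormal E (x + latticeVec k) = outerNormal E x := by
  obtain ⟨U, ρ, h, hxU, h0⟩ := hE.exists_localDefFun hx
  rw [h.outerNormal_eq hxU h0, (h.translate hp k).outerNormal_eq (by simpa using hxU) (by simpa using h0)]
  simp [gradient, fderiv_comp_sub]

end Normal

/-! ### Orthonormal frames and graph charts -/

/-- The Euclidean plane. -/
abbrev E2 : Type := EuclideanSpace ℝ (Fin 2)

/-- A splitting of `ℝ³` into an oriented axis and the plane orthogonal to it. -/
abbrev Frame : Type := WithLp 2 (E2 × ℝ) ≃ₗᵢ[ℝ] E3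

namespace Frame

variable (T : Frame)

/-- The point with planar part `a` and height `z`. -/
def pt (a : E2) (z : ℝ) : E3 := T (WithLp.toLp 2 (a, z))

/-- The planar part. -/
def proj : E3 →L[ℝ] E2 :=
  (WithLp.fstL 2 ℝ E2 ℝ).comp (T.symm.toContinuousLinearEquiv : E3 →L[ℝ] WithLp 2 (E2 × ℝ))

/-- The height. -/
def height : E3 →L[ℝ] ℝ :=
  (WithLp.sndL 2 ℝ E2 ℝ).comp (T.symm.toContinuousLinearEquiv : E3 →L[ℝ] WithLp 2 (E2 × ℝ))

/-- The unit vector of the axis. -/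
def axis : E3 := T.pt 0 1

@[simp] theorem proj_pt (a : E2) (z : ℝ) : T.proj (T.pt a z) = a := by
  simp [proj, pt]

@[simp] theorem height_pt (a : E2) (z : ℝ) : T.height (T.pt a z) = z := by
  simp [height, pt]

@[simp] theorem pt_proj_height (y : E3) : T.pt (T.proj y) (T.height y) = y := by
  have : WithLp.toLp 2 ((T.symm y).fst, (T.symm y).snd) = T.symm y := rfl
  simp [height, pt, proj, this]

theorem pt_add (a b : E2) (z w : ℝ) : T.pt (a + b) (z + w) = T.pt a z + T.pt b w := by
  simp only [pt, ← map_add]; rfl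

theorem pt_smul (c : ℝ) (a : E2) (z : ℝ) : T.pt (c • a) (c * z) = c • T.pt a z := by
  simp only [pt, ← map_smul]; rfl

theorem inner_pt (a b : E2) (z w : ℝ) :
    inner ℝ (T.pt a z) (T.pt b w) = inner ℝ a b + z * w := by
  simp [pt, WithLp.prod_inner_apply, mul_comm]

theorem inner_axis (y : E3) : inner ℝ T.axis y = T.height y := by
  conv_lhs => rw [← T.pt_proj_height y]
  rw [axis, inner_pt]; simp

theorem pt_eq (a : E2) (z : ℝ) : T.pt a z = T.pt a 0 + z • T.axis := by
  rw [axis, ← pt_smul, ← pt_add]; simp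

theorem norm_sq_eq (y : E3) : ‖y‖ ^ 2 = ‖T.proj y‖ ^ 2 + T.height y ^ 2 := by
  rw [← real_inner_self_eq_norm_sq, ← T.pt_proj_height y, inner_pt, real_inner_self_eq_norm_sq]
  simp [sq]

theorem norm_axis : ‖T.axis‖ = 1 := by
  have := T.norm_sq_eq T.axis
  simp only [axis, proj_pt, height_pt, norm_zero] at this
  rw [axis]
  nlinarith [norm_nonneg (T.pt 0 1)]

theorem norm_proj_le (y : E3) : ‖T.proj y‖ ≤ ‖y‖ := by
  have := T.norm_sq_eq y
  nlinarith [norm_nonneg y, norm_nonneg (T.proj y), sq_nonneg (T.height y)]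

theorem norm_pt_zero (a : E2) : ‖T.pt a 0‖ = ‖a‖ := by
  have := T.norm_sq_eq (T.pt a 0)
  simp only [proj_pt, height_pt] at this
  nlinarith [norm_nonneg (T.pt a 0), norm_nonneg a]

theorem norm_pt_le (a : E2) (z : ℝ) : ‖T.pt a z‖ ≤ ‖a‖ + |z| := by
  rw [pt_eq]
  refine (norm_add_le _ _).trans ?_
  rw [norm_pt_zero, norm_smul, norm_axis, mul_one, Real.norm_eq_abs]

/-- `Frame.pt` as a continuous linear map. -/
def ptL : E2 × ℝ →L[ℝ] E3 :=
  LinearMap.toContinuousLinearMap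
    { toFun := fun q => T.pt q.1 q.2
      map_add' := fun _ _ => T.pt_add _ _ _ _
      map_smul' := fun _ _ => T.pt_smul _ _ _ }

theorem contDiff_pt : ContDiff ℝ ∞ (fun q : E2 × ℝ => T.pt q.1 q.2) := T.ptL.contDiff

theorem continuous_pt : Continuous (fun q : E2 × ℝ => T.pt q.1 q.2) := T.ptL.continuous

theorem measurePreserving_pt : MeasurePreserving (fun q : E2 × ℝ => T.pt q.1 q.2) :=
  T.measurePreserving.comp (WithLp.volume_preserving_toLp E2 ℝ)

theorem measurableEmbedding_pt : MeasurableEmbedding (fun q : E2 × ℝ => T.pt q.1 q.2) :=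
  (T.toHomeomorph.measurableEmbedding).comp
    (MeasurableEquiv.toLp 2 (E2 × ℝ)).measurableEmbedding

/-- Any isometry has some unit axis; the reflection in the hyperplane orthogonal to the difference
of the two unit vectors carries that axis to `v`. -/
theorem exists_axis_eq (v : E3) (hv : ‖v‖ = 1) : ∃ T : Frame, T.axis = v := by
  have hd : Module.finrank ℝ (WithLp 2 (E2 × ℝ)) = Module.finrank ℝ E3 := by
    have : Module.finrank ℝ (WithLp 2 (E2 × ℝ)) = Module.finrank ℝ (E2 × ℝ) :=
      LinearEquiv.finrank_eq (WithLp.linearEquiv 2 ℝ (E2 × ℝ))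
    rw [this]; simp
  let T₀ : Frame := (stdOrthonormalBasis ℝ (WithLp 2 (E2 × ℝ))).equiv
    (stdOrthonormalBasis ℝ E3) (finCongr hd)
  refine ⟨T₀.trans (Submodule.reflection (ℝ ∙ (T₀.axis - v))ᗮ), ?_⟩
  have := Submodule.reflection_sub (v := T₀.axis) (w := v) (by rw [hv, norm_axis])
  exact this

end Frame

/-- Near `x`, in the coordinates given by `T`, the set `E` is the subgraph of the smooth function
`g`. -/
structure IsGraphChart (E : Set E3) (T : Frame) (x : E3) (r s : ℝ) (g : E2 → ℝ) : Prop where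
  r_pos : 0 < r
  s_pos : 0 < s
  contDiffOn : ContDiffOn ℝ ∞ g (Metric.ball (T.proj x) r)
  height_lt : ∀ a ∈ Metric.ball (T.proj x) r, |g a - T.height x| < s
  frontier_iff : ∀ a ∈ Metric.ball (T.proj x) r, ∀ z, |z - T.height x| < s →
    (T.pt a z ∈ frontier E ↔ z = g a)
  interior_iff : ∀ a ∈ Metric.ball (T.proj x) r, ∀ z, |z - T.height x| < s →
    (T.pt a z ∈ interior E ↔ z < g a)
  normal_pos : ∀ a ∈ Metric.ball (T.proj x) r,
    0 < inner ℝ T.axis (outerNormal E (T.pt a (g a)))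

theorem hasDerivAt_height {T : Frame} {ρ : E3 → ℝ} {a : E2} {z : ℝ}
    (h : DifferentiableAt ℝ ρ (T.pt a z)) :
    HasDerivAt (fun z => ρ (T.pt a z)) (inner ℝ (∇ ρ (T.pt a z)) T.axis) z := by
  have h1 : HasDerivAt (fun z => T.pt a z) T.axis z := by
    have : (fun z => T.pt a z) = fun z => T.pt a 0 + z • T.axis := by
      funext z; exact T.pt_eq a z
    rw [this]
    simpa using ((hasDerivAt_id z).smul_const T.axis).const_add (T.pt a 0)
  rw [inner_gradient]
  exact h.hasFDerivAt.comp_hasDerivAt z h1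

/-- The axis may be any direction at an acute angle with the normal, since the flux argument uses
several axes at one point. The height is found on the whole disc at once by monotonicity of `ρ`
along vertical lines and the intermediate value theorem. The implicit function theorem then only
supplies its smoothness. -/
theorem IsSmoothSet.exists_graphChart {E : Set E3} (hE : IsSmoothSet E) {x : E3}
    (hx : x ∈ frontier E) (T : Frame) (hT : 0 < inner ℝ T.axis (outerNormal E x))
    {W : Set E3} (hW : W ∈ 𝓝 x) :
    ∃ r s g, IsGraphChart E T x r s g ∧
      ∀ a ∈ Metric.ball (T.proj x) r, ∀ z, |z - T.height x| < s → T.pt a z ∈ W := by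
  obtain ⟨U, ρ, h, hxU, h0⟩ := hE.exists_localDefFun hx
  set a₀ := T.proj x with ha₀
  set z₀ := T.height x with hz₀
  have hx' : T.pt a₀ z₀ = x := T.pt_proj_height x
  -- the vertical derivative of `ρ` is positive near `x`
  have hgc : ContinuousAt (fun y => inner ℝ (∇ ρ y) T.axis) x := by
    have h1 : ContDiffOn ℝ ∞ (fderiv ℝ ρ) U := h.contDiffOn.fderiv_of_isOpen h.isOpen (by simp)
    have h2 := (h1.continuousOn.continuousAt (h.isOpen.mem_nhds hxU))
    simp_rw [inner_gradient]
    exact h2.clm_apply continuousAt_const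
  have hpos : 0 < inner ℝ (∇ ρ x) T.axis := by
    rw [h.outerNormal_eq hxU h0, real_inner_smul_right, real_inner_comm] at hT
    exact (pos_iff_pos_of_mul_pos hT).1 (inv_pos.2 (norm_pos_iff.2 (h.gradient_ne_zero x hxU)))
  have hev : ∀ᶠ y in 𝓝 x, y ∈ U ∧ y ∈ W ∧ 0 < inner ℝ (∇ ρ y) T.axis :=
    (h.eventually_mem hxU).and (Filter.Eventually.and hW (hgc.eventually (lt_mem_nhds hpos)))
  have hev' : ∀ᶠ q : E2 × ℝ in 𝓝 (a₀, z₀), T.pt q.1 q.2 ∈ U ∧ T.pt q.1 q.2 ∈ W ∧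
      0 < inner ℝ (∇ ρ (T.pt q.1 q.2)) T.axis := by
    have : Tendsto (fun q : E2 × ℝ => T.pt q.1 q.2) (𝓝 (a₀, z₀)) (𝓝 x) := by
      rw [← hx']; exact T.continuous_pt.tendsto (a₀, z₀)
    exact this.eventually hev
  obtain ⟨e, he, hbox⟩ := Metric.eventually_nhds_iff.1 hev'
  have hbox' : ∀ a, dist a a₀ < e → ∀ z, |z - z₀| < e → T.pt a z ∈ U ∧ T.pt a z ∈ W ∧
      0 < inner ℝ (∇ ρ (T.pt a z)) T.axis := fun a ha z hz =>
    hbox (y := (a, z)) (by rw [Prod.dist_eq]; exact max_lt ha hz)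
  -- Halving keeps the closed vertical intervals inside the open box where the vertical derivative
  -- is positive.
  set s := e / 2 with hs
  have hs0 : 0 < s := by positivity
  have hmono : ∀ a, dist a a₀ < e →
      StrictMonoOn (fun z => ρ (T.pt a z)) (Set.Icc (z₀ - s) (z₀ + s)) := by
    intro a ha
    have hz : ∀ z ∈ Set.Icc (z₀ - s) (z₀ + s), |z - z₀| < e := fun z hz => by
      rw [abs_lt]; constructor <;> linarith [hz.1, hz.2]
    have hd : ∀ z ∈ Set.Icc (z₀ - s) (z₀ + s), HasDerivAt (fun z => ρ (T.pt a z))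
        (inner ℝ (∇ ρ (T.pt a z)) T.axis) z := fun z hz' =>
      hasDerivAt_height (h.differentiableAt (hbox' a ha z (hz z hz')).1)
    refine strictMonoOn_of_deriv_pos (convex_Icc _ _)
      (fun z hz' => (hd z hz').continuousAt.continuousWithinAt) fun z hz' => ?_
    rw [interior_Icc] at hz'
    rw [(hd z (Set.Ioo_subset_Icc_self hz')).deriv]
    exact (hbox' a ha z (hz z (Set.Ioo_subset_Icc_self hz'))).2.2
  have hcont : ∀ z, |z - z₀| < e → ContinuousAt (fun a => ρ (T.pt a z)) a₀ := by
    intro z hz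
    have h1 : ContinuousAt ρ (T.pt a₀ z) :=
      (h.differentiableAt (hbox' a₀ (by simpa using he) z hz).1).continuousAt
    have h2 : Continuous fun a => T.pt a z := T.continuous_pt.comp (by fun_prop : Continuous fun a : E2 => (a, z))
    exact ContinuousAt.comp (f := fun a => T.pt a z) h1 h2.continuousAt
  have hlo : ρ (T.pt a₀ (z₀ - s)) < 0 := by
    have := hmono a₀ (by simpa using he)
      (show z₀ - s ∈ Set.Icc (z₀ - s) (z₀ + s) from ⟨le_rfl, by linarith⟩)
      (show z₀ ∈ Set.Icc (z₀ - s) (z₀ + s) from ⟨by linarith, by linarith⟩) (by linarith)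
    simpa [hx', h0] using this
  have hhi : 0 < ρ (T.pt a₀ (z₀ + s)) := by
    have := hmono a₀ (by simpa using he)
      (show z₀ ∈ Set.Icc (z₀ - s) (z₀ + s) from ⟨by linarith, by linarith⟩)
      (show z₀ + s ∈ Set.Icc (z₀ - s) (z₀ + s) from ⟨by linarith, le_rfl⟩) (by linarith)
    simpa [hx', h0] using this
  have hev2 := ((hcont (z₀ - s) (by rw [abs_lt]; constructor <;> linarith)).eventually
    (gt_mem_nhds hlo)).and ((hcont (z₀ + s) (by rw [abs_lt]; constructor <;> linarith)).eventually
    (lt_mem_nhds hhi))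
  obtain ⟨r₁, hr₁, hr₁'⟩ := Metric.eventually_nhds_iff.1 hev2
  set r := min r₁ e with hr
  have hr0 : 0 < r := lt_min hr₁ he
  have hra : ∀ a ∈ Metric.ball a₀ r, dist a a₀ < e := fun a ha =>
    (Metric.mem_ball.1 ha).trans_le (min_le_right _ _)
  have hsol : ∀ a : E2, ∃ z : ℝ, a ∈ Metric.ball a₀ r →
      z ∈ Set.Ioo (z₀ - s) (z₀ + s) ∧ ρ (T.pt a z) = 0 := by
    intro a
    by_cases ha : a ∈ Metric.ball a₀ r
    · have h1 := hr₁' ((Metric.mem_ball.1 ha).trans_le (min_le_left _ _))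
      have hc : ContinuousOn (fun z => ρ (T.pt a z)) (Set.Icc (z₀ - s) (z₀ + s)) := fun z hz =>
        (hasDerivAt_height (h.differentiableAt (hbox' a (hra a ha) z
          (by rw [abs_lt]; constructor <;> linarith [hz.1, hz.2])).1)).continuousAt.continuousWithinAt
      obtain ⟨z, hz, hz0⟩ := intermediate_value_Ioo (by linarith) hc
        (show (0 : ℝ) ∈ Set.Ioo _ _ from ⟨h1.1, h1.2⟩)
      exact ⟨z, fun _ => ⟨hz, hz0⟩⟩
    · exact ⟨0, fun h => absurd h ha⟩
  choose g hg using hsol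
  have hIoo : ∀ z, |z - z₀| < s ↔ z ∈ Set.Ioo (z₀ - s) (z₀ + s) := fun z => by
    rw [abs_lt, Set.mem_Ioo]; constructor <;> rintro ⟨h1, h2⟩ <;> constructor <;> linarith
  have hlt : ∀ a ∈ Metric.ball a₀ r, ∀ z ∈ Set.Ioo (z₀ - s) (z₀ + s),
      (ρ (T.pt a z) < 0 ↔ z < g a) := by
    intro a ha z hz
    have := (hmono a (hra a ha)).lt_iff_lt (a := z) (b := g a) (Set.Ioo_subset_Icc_self hz)
      (Set.Ioo_subset_Icc_self (hg a ha).1)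
    simpa [(hg a ha).2] using this
  have heq : ∀ a ∈ Metric.ball a₀ r, ∀ z ∈ Set.Ioo (z₀ - s) (z₀ + s),
      (ρ (T.pt a z) = 0 ↔ z = g a) := by
    intro a ha z hz
    have := (hmono a (hra a ha)).injOn.eq_iff (x := z) (y := g a) (Set.Ioo_subset_Icc_self hz)
      (Set.Ioo_subset_Icc_self (hg a ha).1)
    simpa [(hg a ha).2] using this
  have hUb : ∀ a ∈ Metric.ball a₀ r, ∀ z ∈ Set.Ioo (z₀ - s) (z₀ + s), T.pt a z ∈ U ∧ T.pt a z ∈ W ∧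
      0 < inner ℝ (∇ ρ (T.pt a z)) T.axis := fun a ha z hz =>
    hbox' a (hra a ha) z (by rw [abs_lt]; constructor <;> linarith [hz.1, hz.2])
  refine ⟨r, s, g, ⟨hr0, hs0, ?_, ?_, ?_, ?_, ?_⟩, fun a ha z hz => (hUb a ha z ((hIoo z).1 hz)).2.1⟩
  · intro a ha
    refine ContDiffAt.contDiffWithinAt ?_
    set f : E2 × ℝ → ℝ := fun q => ρ (T.pt q.1 q.2) with hf
    have hU := hUb a ha (g a) (hg a ha).1
    have hfc : ContDiffAt ℝ ∞ f (a, g a) :=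
      ContDiffAt.comp (a, g a) (h.contDiffAt hU.1) T.contDiff_pt.contDiffAt
    -- The partial derivative in the vertical variable is multiplication by a positive number.
    have hinv : (fderiv ℝ f (a, g a) ∘L .inr ℝ E2 ℝ).IsInvertible := by
      refine ⟨ContinuousLinearEquiv.unitsEquivAut ℝ (Units.mk0 _ hU.2.2.ne'), ?_⟩
      ext
      have h1 : HasDerivAt (fun z => f (a, z)) (fderiv ℝ f (a, g a) (0, 1)) (g a) := by
        have h2 : HasDerivAt (fun z : ℝ => (a, z)) ((0 : E2), (1 : ℝ)) (g a) :=
          (hasDerivAt_const _ _).prodMk (hasDerivAt_id _)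
        exact (hfc.differentiableAt (by simp)).hasFDerivAt.comp_hasDerivAt (g a) h2
      have h3 := h1.unique (hasDerivAt_height (h.differentiableAt hU.1))
      simpa using h3.symm
    have hψ := hfc.contDiffAt_implicitFunction (by simp) hinv
    refine hψ.congr_of_eventuallyEq ?_
    -- Near `a` the implicit function takes values in the vertical interval, where the zero of `ρ`
    -- is unique, so it coincides with `g`.
    have h1 : ∀ᶠ b in 𝓝 a, f (b, hfc.implicitFunction (by simp) hinv b) = f (a, g a) :=
      hfc.eventually_apply_implicitFunction (by simp) hinv
    have h2 : ∀ᶠ b in 𝓝 a, hfc.implicitFunction (by simp) hinv b ∈ Set.Ioo (z₀ - s) (z₀ + s) := by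
      refine hψ.continuousAt.eventually ?_
      rw [hfc.implicitFunction_apply_self (by simp) hinv]
      exact isOpen_Ioo.mem_nhds (hg a ha).1
    filter_upwards [h1, h2, Metric.isOpen_ball.mem_nhds ha] with b hb1 hb2 hb3
    refine ((heq b hb3 _ hb2).1 ?_).symm
    exact hb1.trans (hg a ha).2
  · intro a ha
    exact (hIoo _).2 (hg a ha).1
  · intro a ha z hz
    rw [h.mem_frontier_iff (hUb a ha z ((hIoo z).1 hz)).1]
    exact heq a ha z ((hIoo z).1 hz)
  · intro a ha z hz
    rw [h.mem_interior_iff (hUb a ha z ((hIoo z).1 hz)).1]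
    exact hlt a ha z ((hIoo z).1 hz)
  · intro a ha
    have hU := hUb a ha (g a) (hg a ha).1
    rw [h.outerNormal_eq hU.1 (hg a ha).2, real_inner_smul_right, real_inner_comm]
    exact mul_pos (inv_pos.2 (norm_pos_iff.2 (h.gradient_ne_zero _ hU.1))) hU.2.2

/-! ### Tangential calculus -/

/-- The parametrization of a graph. -/
def graphMap (T : Frame) (g : E2 → ℝ) (a : E2) : E3 := T.pt a (g a)

@[simp] theorem proj_graphMap (T : Frame) (g : E2 → ℝ) (a : E2) : T.proj (graphMap T g a) = a :=
  T.proj_pt _ _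

@[simp] theorem height_graphMap (T : Frame) (g : E2 → ℝ) (a : E2) :
    T.height (graphMap T g a) = g a :=
  T.height_pt _ _

namespace IsGraphChart

variable {E : Set E3} {T : Frame} {x : E3} {r s : ℝ} {g : E2 → ℝ}

theorem contDiffOn_graphMap (h : IsGraphChart E T x r s g) :
    ContDiffOn ℝ ∞ (graphMap T g) (Metric.ball (T.proj x) r) :=
  T.contDiff_pt.comp_contDiffOn (contDiffOn_id.prodMk h.contDiffOn)

theorem contDiffAt_graphMap (h : IsGraphChart E T x r s g) {a : E2}
    (ha : a ∈ Metric.ball (T.proj x) r) : ContDiffAt ℝ ∞ (graphMap T g) a :=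
  h.contDiffOn_graphMap.contDiffAt (Metric.isOpen_ball.mem_nhds ha)

theorem graphMap_mem (h : IsGraphChart E T x r s g) {a : E2}
    (ha : a ∈ Metric.ball (T.proj x) r) : graphMap T g a ∈ frontier E :=
  (h.frontier_iff a ha _ (h.height_lt a ha)).2 rfl

theorem graphMap_proj (h : IsGraphChart E T x r s g) {y : E3} (hy : y ∈ frontier E)
    (hp : T.proj y ∈ Metric.ball (T.proj x) r) (hh : |T.height y - T.height x| < s) :
    graphMap T g (T.proj y) = y := by
  have h1 := (h.frontier_iff _ hp _ hh).1 (by rwa [T.pt_proj_height])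
  rw [graphMap, ← h1, T.pt_proj_height]

theorem graphMap_proj_self (h : IsGraphChart E T x r s g) (hx : x ∈ frontier E) :
    graphMap T g (T.proj x) = x :=
  h.graphMap_proj hx (Metric.mem_ball_self h.r_pos) (by simpa using h.s_pos)

/-- The open region in which the chart describes `E`. -/
theorem isOpen_box (T : Frame) (x : E3) (r s : ℝ) :
    IsOpen {y : E3 | T.proj y ∈ Metric.ball (T.proj x) r ∧ |T.height y - T.height x| < s} := by
  refine (Metric.isOpen_ball.preimage T.proj.continuous).inter ?_
  exact isOpen_lt ((T.height.continuous.sub continuous_const).abs) continuous_const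

theorem eventually_eq (h : IsGraphChart E T x r s g) {a : E2}
    (ha : a ∈ Metric.ball (T.proj x) r) :
    ∀ᶠ y in 𝓝[frontier E] (graphMap T g a), graphMap T g (T.proj y) = y := by
  have h1 := (isOpen_box T x r s).mem_nhds (x := graphMap T g a)
    (by simpa using ⟨Metric.mem_ball.1 ha, h.height_lt a ha⟩)
  filter_upwards [nhdsWithin_le_nhds h1, self_mem_nhdsWithin] with y hy hyE
  exact h.graphMap_proj hyE hy.1 hy.2

theorem mono (h : IsGraphChart E T x r s g) {r' : ℝ} (h0 : 0 < r') (hr : r' ≤ r) :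
    IsGraphChart E T x r' s g := by
  have hsub := Metric.ball_subset_ball (x := T.proj x) hr
  exact ⟨h0, h.s_pos, h.contDiffOn.mono hsub, fun a ha => h.height_lt a (hsub ha),
    fun a ha => h.frontier_iff a (hsub ha), fun a ha => h.interior_iff a (hsub ha),
    fun a ha => h.normal_pos a (hsub ha)⟩

end IsGraphChart

section Tangent

variable {E : Set E3}

/-- Maps into the boundary have derivatives orthogonal to the normal. -/
theorem IsSmoothSet.inner_outerNormal_fderiv (hE : IsSmoothSet E) {V : Type*}
    [NormedAddCommGroup V] [NormedSpace ℝ V] {γ : V → E3} {γ' : V →L[ℝ] E3} {a : V}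
    (hγ : HasFDerivAt γ γ' a) (hm : ∀ᶠ b in 𝓝 a, γ b ∈ frontier E) (w : V) :
    inner ℝ (outerNormal E (γ a)) (γ' w) = 0 := by
  obtain ⟨U, ρ, h, hxU, h0⟩ := hE.exists_localDefFun hm.self_of_nhds
  have h1 : HasFDerivAt (fun b => ρ (γ b)) ((fderiv ℝ ρ (γ a)).comp γ') a :=
    (h.differentiableAt hxU).hasFDerivAt.comp a hγ
  have h2 : (fun b => ρ (γ b)) =ᶠ[𝓝 a] fun _ => (0 : ℝ) := by
    filter_upwards [hm, hγ.continuousAt.eventually (h.eventually_mem hxU)] with b hb hb'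
    exact (h.mem_frontier_iff hb').1 hb
  have h3 := h1.unique ((hasFDerivAt_const (0 : ℝ) a).congr_of_eventuallyEq h2)
  rw [h.outerNormal_eq hxU h0, real_inner_smul_left, inner_gradient]
  have := DFunLike.congr_fun h3 w
  simp only [ContinuousLinearMap.comp_apply, zero_apply] at this
  rw [this, mul_zero]

/-- Every vector orthogonal to the normal is the velocity of a curve in the boundary. -/
theorem IsSmoothSet.exists_curve (hE : IsSmoothSet E) {x : E3} (hx : x ∈ frontier E) {v : E3}
    (hv : inner ℝ (outerNormal E x) v = 0) :
    ∃ γ : ℝ → E3, HasDerivAt γ v 0 ∧ γ 0 = x ∧ ∀ᶠ t in 𝓝 0, γ t ∈ frontier E := by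
  obtain ⟨T, hT⟩ := Frame.exists_axis_eq _ (hE.norm_outerNormal hx)
  obtain ⟨r, s, g, h, -⟩ := hE.exists_graphChart hx T
    (by rw [hT, real_inner_self_eq_norm_sq, hE.norm_outerNormal hx]; norm_num) univ_mem
  set c : ℝ → E2 := fun t => T.proj x + t • T.proj v with hc
  have hc0 : c 0 = T.proj x := by simp [hc]
  have hcd : HasDerivAt c (T.proj v) 0 := by
    have := ((hasDerivAt_id (0 : ℝ)).smul_const (T.proj v)).const_add (T.proj x)
    rw [one_smul] at this
    exact this
  have hx0 : T.proj x ∈ Metric.ball (T.proj x) r := Metric.mem_ball_self h.r_pos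
  have hG : HasFDerivAt (graphMap T g) (fderiv ℝ (graphMap T g) (T.proj x)) (c 0) := by
    rw [hc0]; exact ((h.contDiffAt_graphMap hx0).differentiableAt (by simp)).hasFDerivAt
  have hγ := hG.comp_hasDerivAt 0 hcd
  set w := fderiv ℝ (graphMap T g) (T.proj x) (T.proj v) with hw
  have hmem : ∀ᶠ t in 𝓝 0, graphMap T g (c t) ∈ frontier E := by
    have : ∀ᶠ t in 𝓝 0, c t ∈ Metric.ball (T.proj x) r :=
      hcd.continuousAt.eventually (Metric.isOpen_ball.mem_nhds (by rw [hc0]; exact hx0))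
    filter_upwards [this] with t ht
    exact h.graphMap_mem ht
  have h0 : graphMap T g (c 0) = x := by rw [hc0, h.graphMap_proj_self hx]
  -- Planar parts agree because the projection of the curve is a straight line. The axis is the
  -- normal at `x`, so both heights are zero: that of `v` by hypothesis, that of `w` because the
  -- curve stays in the boundary.
  have hwv : w = v := by
    have h1 : T.proj w = T.proj v := by
      have h2 : HasDerivAt (fun t => T.proj (graphMap T g (c t))) (T.proj w) 0 :=
        T.proj.hasFDerivAt.comp_hasDerivAt 0 hγ
      simp only [proj_graphMap] at h2
      exact h2.unique hcd
    have h2 : T.height w = T.height v := by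
      rw [← T.inner_axis, ← T.inner_axis, hT, hv]
      have := hE.inner_outerNormal_fderiv hγ.hasFDerivAt hmem 1
      simp only [Function.comp_apply, h0] at this
      simpa using this
    rw [← T.pt_proj_height w, h1, h2, T.pt_proj_height]
  refine ⟨fun t => graphMap T g (c t), ?_, h0, hmem⟩
  rw [← hwv]
  exact hγ

theorem inner_tangPart_self {n a : E3} (hn : ‖n‖ = 1) : inner ℝ n (tangPart n a) = 0 := by
  rw [tangPart, inner_sub_right, real_inner_smul_right, real_inner_self_eq_norm_sq, hn,
    real_inner_comm]
  ring

theorem inner_tangPart_of_orthogonal {n a w : E3} (h : inner ℝ n w = 0) :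
    inner ℝ (tangPart n a) w = inner ℝ a w := by
  rw [tangPart, inner_sub_left, real_inner_smul_left, h]
  ring

theorem eq_of_inner_tangent {n a b : E3} (hn : ‖n‖ = 1)
    (h : ∀ w, inner ℝ n w = 0 → inner ℝ a w = inner ℝ b w) : tangPart n a = tangPart n b := by
  have h1 : inner ℝ n (tangPart n a - tangPart n b) = 0 := by
    rw [inner_sub_right, inner_tangPart_self hn, inner_tangPart_self hn, sub_zero]
  have h2 := h _ h1
  rw [← inner_tangPart_of_orthogonal (a := a) h1, ← inner_tangPart_of_orthogonal (a := b) h1,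
    ← sub_eq_zero, ← inner_sub_left, inner_self_eq_zero, sub_eq_zero] at h2
  exact h2

/-- The tangential gradient is computed from any differentiable local extension. -/
theorem IsSmoothSet.tangGrad_eq (hE : IsSmoothSet E) {x : E3} (hx : x ∈ frontier E)
    {f g : E3 → ℝ} (hfg : f =ᶠ[𝓝[frontier E] x] g) (hg : DifferentiableAt ℝ g x) :
    tangGrad E f x = tangPart (outerNormal E x) (∇ g x) := by
  have hfx : f x = g x := hfg.self_of_nhdsWithin hx
  have h1 : HasFDerivWithinAt f (fderiv ℝ g x) (frontier E) x :=
    hg.hasFDerivAt.hasFDerivWithinAt.congr_of_eventuallyEq hfg hfx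
  have h2 := h1.differentiableWithinAt.hasGradientWithinAt
  refine eq_of_inner_tangent (hE.norm_outerNormal hx) fun w hw => ?_
  obtain ⟨γ, hγ, hγ0, hγm⟩ := hE.exists_curve hx hw
  -- Derivatives within a surface are not unique, but any two agree on velocities of curves in the
  -- surface. These fill the tangent plane, so the tangential parts agree.
  have key : ∀ L : E3 →L[ℝ] ℝ, HasFDerivWithinAt f L (frontier E) x →
      HasDerivAt (fun t => f (γ t)) (L w) 0 := by
    intro L hL
    have hL' : HasFDerivWithinAt f L (frontier E) (γ 0) := by rwa [hγ0]
    have h3 := hL'.comp_hasDerivWithinAt (s := {t | γ t ∈ frontier E}) (0 : ℝ)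
      hγ.hasDerivWithinAt (fun t ht => ht)
    exact h3.hasDerivAt hγm
  have e1 := key _ h1
  have e2 := key _ h2.hasFDerivWithinAt
  have := e2.unique e1
  rw [inner_gradient]
  simpa using this

/-- `f` agrees on `∂E` locally with smooth functions. -/
def IsLocallySmooth (E : Set E3) (f : E3 → ℝ) : Prop :=
  ∀ x ∈ frontier E, ∃ g : E3 → ℝ, ContDiffAt ℝ ∞ g x ∧ f =ᶠ[𝓝[frontier E] x] g

theorem eventually_differentiableAt {g : E3 → ℝ} {x : E3} (hg : ContDiffAt ℝ ∞ g x) :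
    ∀ᶠ y in 𝓝 x, DifferentiableAt ℝ g y := by
  have h1 : ContDiffAt ℝ 1 g x := hg.of_le (by exact_mod_cast le_top)
  exact (h1.eventually (by simp)).mono fun y hy => hy.differentiableAt (by simp)

/-- Composition with the projection onto the graph extends `f` to a full neighbourhood, constant
along the axis of the chart. -/
theorem IsSmoothSet.isLocallySmooth_of_contDiffOn (hE : IsSmoothSet E) {f : E3 → ℝ}
    (hf : ContDiffOn ℝ ∞ f (frontier E)) : IsLocallySmooth E f := by
  intro x hx
  obtain ⟨T, hT⟩ := Frame.exists_axis_eq _ (hE.norm_outerNormal hx)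
  obtain ⟨r, s, g, h, -⟩ := hE.exists_graphChart hx T
    (by rw [hT, real_inner_self_eq_norm_sq, hE.norm_outerNormal hx]; norm_num) univ_mem
  have hx0 : T.proj x ∈ Metric.ball (T.proj x) r := Metric.mem_ball_self h.r_pos
  refine ⟨fun y => f (graphMap T g (T.proj y)), ?_, ?_⟩
  · have h1 : ContDiffOn ℝ ∞ (fun a => f (graphMap T g a)) (Metric.ball (T.proj x) r) :=
      hf.comp h.contDiffOn_graphMap fun a ha => h.graphMap_mem ha
    have h2 := h1.contDiffAt (Metric.isOpen_ball.mem_nhds hx0)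
    exact ContDiffAt.comp (g := fun a => f (graphMap T g a)) x h2 T.proj.contDiff.contDiffAt
  · have := h.eventually_eq hx0
    rw [h.graphMap_proj_self hx] at this
    filter_upwards [this] with y hy
    rw [hy]

theorem IsSmoothSet.isLocallySmooth_outerNormal (hE : IsSmoothSet E) (i : Fin 3) :
    IsLocallySmooth E (fun y => outerNormal E y i) := by
  intro x hx
  obtain ⟨U, N, hU, hxU, hN, -, h2⟩ := hE.exists_normalField hx
  refine ⟨fun y => N y i, ?_, ?_⟩
  · have := hN.contDiffAt (hU.mem_nhds hxU)
    exact (EuclideanSpace.proj (𝕜 := ℝ) i).contDiff.contDiffAt.comp x this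
  · filter_upwards [nhdsWithin_le_nhds (hU.mem_nhds hxU), self_mem_nhdsWithin] with y hy hy'
    rw [h2 y hy hy']

namespace IsLocallySmooth

variable {f f₁ f₂ : E3 → ℝ}

theorem sum {ι : Type*} {s : Finset ι} {F : ι → E3 → ℝ} (h : ∀ i ∈ s, IsLocallySmooth E (F i)) :
    IsLocallySmooth E (fun y => ∑ i ∈ s, F i y) := by
  intro x hx
  have h' : ∀ i, ∃ g : E3 → ℝ, i ∈ s → ContDiffAt ℝ ∞ g x ∧ F i =ᶠ[𝓝[frontier E] x] g := by
    intro i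
    by_cases hi : i ∈ s
    · obtain ⟨g, hg⟩ := h i hi x hx
      exact ⟨g, fun _ => hg⟩
    · exact ⟨0, fun h => absurd h hi⟩
  choose g hg using h'
  refine ⟨fun y => ∑ i ∈ s, g i y, ContDiffAt.sum fun i hi => (hg i hi).1, ?_⟩
  have : ∀ᶠ y in 𝓝[frontier E] x, ∀ i ∈ s, F i y = g i y :=
    (Filter.eventually_all_finset s).2 fun i hi => (hg i hi).2
  filter_upwards [this] with y hy
  exact Finset.sum_congr rfl hy

theorem continuousOn (h : IsLocallySmooth E f) : ContinuousOn f (frontier E) := by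
  intro x hx
  obtain ⟨g, hg, hfg⟩ := h x hx
  exact hg.continuousAt.continuousWithinAt.congr_of_eventuallyEq hfg (hfg.self_of_nhdsWithin hx)

/-- The gradient of a smooth extension, projected by a smooth extension of the normal, is a smooth
extension of the tangential gradient. This permits iterated tangential derivatives. -/
theorem exists_tangGrad (h : IsLocallySmooth E f) (hE : IsSmoothSet E) {x : E3}
    (hx : x ∈ frontier E) : ∃ X : E3 → E3, ContDiffAt ℝ ∞ X x ∧
      tangGrad E f =ᶠ[𝓝[frontier E] x] X := by
  obtain ⟨g, hg, hfg⟩ := h x hx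
  obtain ⟨U, N, hU, hxU, hN, -, h2⟩ := hE.exists_normalField hx
  have hgrad : ContDiffAt ℝ ∞ (fun y => ∇ g y) x := by
    have h1 : ContDiffAt ℝ ∞ (fderiv ℝ g) x := hg.fderiv_right (by simp)
    exact (InnerProductSpace.toDual ℝ E3).symm.contDiff.contDiffAt.comp x h1
  have hN' := hN.contDiffAt (hU.mem_nhds hxU)
  refine ⟨fun y => tangPart (N y) (∇ g y), ?_, ?_⟩
  · exact hgrad.sub ((hgrad.inner ℝ hN').smul hN')
  · filter_upwards [nhdsWithin_le_nhds (hU.mem_nhds hxU), self_mem_nhdsWithin,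
      eventually_eventually_nhdsWithin.2 hfg,
      nhdsWithin_le_nhds (eventually_differentiableAt hg)] with y hy hy' hy2 hy3
    rw [hE.tangGrad_eq hy' hy2 hy3, h2 y hy hy']

theorem tangGrad (h : IsLocallySmooth E f) (hE : IsSmoothSet E) (j : Fin 3) :
    IsLocallySmooth E (fun y => tangGrad E f y j) := by
  intro x hx
  obtain ⟨X, hX, hfX⟩ := h.exists_tangGrad hE hx
  refine ⟨fun y => X y j, (EuclideanSpace.proj (𝕜 := ℝ) j).contDiff.contDiffAt.comp x hX, ?_⟩
  filter_upwards [hfX] with y hy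
  rw [hy]

theorem continuousOn_tangGrad (h : IsLocallySmooth E f) (hE : IsSmoothSet E) :
    ContinuousOn (TorusSurface.tangGrad E f) (frontier E) := by
  intro x hx
  obtain ⟨X, hX, hfX⟩ := h.exists_tangGrad hE hx
  exact hX.continuousAt.continuousWithinAt.congr_of_eventuallyEq hfX (hfX.self_of_nhdsWithin hx)

/-- The chain rule for maps into the boundary. -/
theorem hasFDerivAt_comp (h : IsLocallySmooth E f) (hE : IsSmoothSet E) {V : Type*}
    [NormedAddCommGroup V] [NormedSpace ℝ V] {γ : V → E3} {γ' : V →L[ℝ] E3} {a : V}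
    (hγ : HasFDerivAt γ γ' a) (hm : ∀ᶠ b in 𝓝 a, γ b ∈ frontier E) :
    HasFDerivAt (fun b => f (γ b))
      ((innerSL ℝ (TorusSurface.tangGrad E f (γ a))).comp γ') a := by
  have hx := hm.self_of_nhds
  obtain ⟨g, hg, hfg⟩ := h (γ a) hx
  have hgd := hg.differentiableAt (by simp)
  have h1 : HasFDerivAt (fun b => g (γ b)) ((fderiv ℝ g (γ a)).comp γ') a :=
    hgd.hasFDerivAt.comp a hγ
  have h2 : (fun b => f (γ b)) =ᶠ[𝓝 a] fun b => g (γ b) := by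
    have : Tendsto γ (𝓝 a) (𝓝[frontier E] (γ a)) :=
      tendsto_nhdsWithin_iff.2 ⟨hγ.continuousAt, hm⟩
    exact this.eventually hfg
  have h3 := h1.congr_of_eventuallyEq h2
  convert h3 using 1
  ext w
  simp only [ContinuousLinearMap.comp_apply, innerSL_apply_apply]
  rw [hE.tangGrad_eq hx hfg hgd,
    inner_tangPart_of_orthogonal (hE.inner_outerNormal_fderiv hγ hm w), inner_gradient]

theorem norm_fderiv_comp_le (h : IsLocallySmooth E f) (hE : IsSmoothSet E) {V : Type*}
    [NormedAddCommGroup V] [NormedSpace ℝ V] {γ : V → E3} {a : V}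
    (hγ : DifferentiableAt ℝ γ a) (hm : ∀ᶠ b in 𝓝 a, γ b ∈ frontier E) :
    ‖fderiv ℝ (fun b => f (γ b)) a‖ ≤ ‖TorusSurface.tangGrad E f (γ a)‖ * ‖fderiv ℝ γ a‖ := by
  rw [(h.hasFDerivAt_comp hE hγ.hasFDerivAt hm).fderiv]
  refine (ContinuousLinearMap.opNorm_comp_le _ _).trans ?_
  rw [innerSL_apply_norm]

end IsLocallySmooth

theorem IsSmoothSet.isLocallySmooth_meanCurv (hE : IsSmoothSet E) :
    IsLocallySmooth E (meanCurv E) :=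
  IsLocallySmooth.sum fun i _ => (hE.isLocallySmooth_outerNormal i).tangGrad hE i

theorem IsSmoothSet.continuousOn_outerNormal (hE : IsSmoothSet E) :
    ContinuousOn (outerNormal E) (frontier E) := by
  intro x hx
  obtain ⟨U, N, hU, hxU, hN, -, h2⟩ := hE.exists_normalField hx
  have hc := (hN.contDiffAt (hU.mem_nhds hxU)).continuousAt.continuousWithinAt (s := frontier E)
  refine hc.congr_of_eventuallyEq ?_ (h2 x hxU hx)
  filter_upwards [nhdsWithin_le_nhds (hU.mem_nhds hxU), self_mem_nhdsWithin] with y hy hy'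
  exact h2 y hy hy'

section Periodic

/-- Invariance under the lattice of the values on the boundary. -/
def IsPeriodicOnBdry {α : Type*} (E : Set E3) (f : E3 → α) : Prop :=
  ∀ (k : Fin 3 → ℤ), ∀ x ∈ frontier E, f (x + latticeVec k) = f x

theorem IsLocallySmooth.isPeriodic_tangGrad {f : E3 → ℝ} (h : IsLocallySmooth E f)
    (hE : IsSmoothSet E) (hp : IsPeriodicSet E) (hf : IsPeriodicOnBdry E f) :
    IsPeriodicOnBdry E (TorusSurface.tangGrad E f) := by
  intro k x hx
  obtain ⟨g, hg, hfg⟩ := h x hx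
  have hxk : x + latticeVec k ∈ frontier E := (hp.frontier k x).2 hx
  have hfg' : f =ᶠ[𝓝[frontier E] (x + latticeVec k)] fun y => g (y - latticeVec k) := by
    have ht : Tendsto (fun y => y - latticeVec k) (𝓝[frontier E] (x + latticeVec k))
        (𝓝[frontier E] x) := by
      refine tendsto_nhdsWithin_iff.2 ⟨?_, ?_⟩
      · have : Continuous fun y : E3 => y - latticeVec k := by fun_prop
        have h2 := this.tendsto (x + latticeVec k)
        simp only [add_sub_cancel_right] at h2
        exact h2.mono_left nhdsWithin_le_nhds
      · filter_upwards [self_mem_nhdsWithin] with y hy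
        exact (hp.frontier k _).1 (by simpa using hy)
    filter_upwards [ht.eventually hfg, ht.eventually self_mem_nhdsWithin] with y hy hy'
    rw [← hy, ← hf k _ hy', sub_add_cancel]
  have hgd := hg.differentiableAt (by simp)
  rw [hE.tangGrad_eq hx hfg hgd, hE.tangGrad_eq hxk hfg', hE.outerNormal_add hp hx]
  · simp [gradient, fderiv_comp_sub]
  · have : DifferentiableAt ℝ g ((x + latticeVec k) - latticeVec k) := by simpa using hgd
    exact DifferentiableAt.comp (x + latticeVec k) this (by fun_prop)

theorem IsSmoothSet.isPeriodic_meanCurv (hE : IsSmoothSet E) (hp : IsPeriodicSet E) :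
    IsPeriodicOnBdry E (meanCurv E) := by
  intro k x hx
  refine Finset.sum_congr rfl fun i _ => ?_
  rw [(hE.isLocallySmooth_outerNormal i).isPeriodic_tangGrad hE hp ?_ k x hx]
  intro k x hx
  simp only [hE.outerNormal_add hp hx]

end Periodic

end Tangent

/-! ### The area formula for graphs -/

open scoped NNReal

/-- A countable subcover is made disjoint; countable additivity then adds the local bounds with no
loss in the constant. -/
theorem measure_le_of_locally_le {X : Type*} [TopologicalSpace X] [SecondCountableTopology X]
    [MeasurableSpace X] [BorelSpace X] {μ ν : Measure X} {S : Set X} {c : ℝ≥0∞}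
    (h : ∀ x ∈ S, ∃ V ∈ 𝓝 x, ∀ A ⊆ V ∩ S, MeasurableSet A → μ A ≤ c * ν A)
    {B : Set X} (hB : B ⊆ S) (hBm : MeasurableSet B) : μ B ≤ c * ν B := by
  choose! V hV hA using h
  obtain ⟨t, htS, htc, ht⟩ := TopologicalSpace.countable_cover_nhdsWithin
    (s := S) (f := fun x => interior (V x)) fun x hx =>
      nhdsWithin_le_nhds (interior_mem_nhds.2 (hV x hx))
  rcases t.eq_empty_or_nonempty with rfl | htn
  · have : B = ∅ := by
      rw [Set.eq_empty_iff_forall_notMem]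
      intro x hx
      simpa using ht (hB hx)
    simp [this]
  obtain ⟨f, rfl⟩ := htc.exists_eq_range htn
  set D : ℕ → Set X := disjointed fun n => interior (V (f n)) with hD
  have hDm : ∀ n, MeasurableSet (D n) :=
    MeasurableSet.disjointed fun n => isOpen_interior.measurableSet
  have hDu : ⋃ n, B ∩ D n = B := by
    rw [← Set.inter_iUnion, hD, iUnion_disjointed, Set.inter_eq_left]
    intro x hx
    simpa using ht (hB hx)
  have hdisj : Pairwise (Function.onFun Disjoint fun n => B ∩ D n) := fun i j hij =>
    ((disjoint_disjointed _) hij).mono Set.inter_subset_right Set.inter_subset_right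
  calc μ B = μ (⋃ n, B ∩ D n) := by rw [hDu]
    _ = ∑' n, μ (B ∩ D n) := measure_iUnion hdisj fun n => hBm.inter (hDm n)
    _ ≤ ∑' n, c * ν (B ∩ D n) := by
        refine ENNReal.tsum_le_tsum fun n => hA (f n) (htS ⟨n, rfl⟩) _ ?_ (hBm.inter (hDm n))
        exact fun x hx => ⟨interior_subset (disjointed_subset _ n hx.2), hB hx.1⟩
    _ = c * ∑' n, ν (B ∩ D n) := ENNReal.tsum_mul_left
    _ = c * ν (⋃ n, B ∩ D n) := by rw [measure_iUnion hdisj fun n => hBm.inter (hDm n)]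
    _ = c * ν B := by rw [hDu]

theorem ENNReal_le_of_forall_one_lt_mul {a b : ℝ≥0∞} (h : ∀ c : ℝ≥0, 1 < c → a ≤ c * b) :
    a ≤ b := by
  rcases eq_or_ne b ∞ with rfl | hb
  · exact le_top
  have h1 : Tendsto (fun c : ℝ≥0 => (c : ℝ≥0∞) * b) (𝓝[>] 1) (𝓝 (1 * b)) := by
    refine ENNReal.Tendsto.mul_const ?_ (Or.inr hb)
    exact ((ENNReal.continuous_coe.tendsto 1).mono_left nhdsWithin_le_nhds)
  rw [one_mul] at h1
  exact ge_of_tendsto h1 (by filter_upwards [self_mem_nhdsWithin] with c hc using h c hc)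

theorem LipschitzOnWith.euclideanHausdorffMeasure_image_le {X Y : Type*}
    [EMetricSpace X] [EMetricSpace Y] [MeasurableSpace X] [BorelSpace X] [MeasurableSpace Y]
    [BorelSpace Y] {K : ℝ≥0} {f : X → Y} {s : Set X} (h : LipschitzOnWith K f s) :
    μHE[2] (f '' s) ≤ (K : ℝ≥0∞) ^ 2 * μHE[2] s := by
  simp_rw [Measure.euclideanHausdorffMeasure_def, Measure.smul_apply, ENNReal.smul_def, smul_eq_mul]
  have := h.hausdorffMeasure_image_le (d := 2) (by norm_num)
  rw [ENNReal.rpow_ofNat] at this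
  calc _ ≤ _ := mul_le_mul_right this _
    _ = _ := by
      push_cast
      ring

namespace IsGraphChart

variable {E : Set E3} {T : Frame} {x : E3} {r s : ℝ} {g : E2 → ℝ}

theorem hasFDerivAt_graphMap (h : IsGraphChart E T x r s g) {a : E2}
    (ha : a ∈ Metric.ball (T.proj x) r) :
    HasFDerivAt (graphMap T g) (fderiv ℝ (graphMap T g) a) a :=
  ((h.contDiffAt_graphMap ha).differentiableAt (by simp)).hasFDerivAt

theorem proj_fderiv_graphMap (h : IsGraphChart E T x r s g) {a : E2}
    (ha : a ∈ Metric.ball (T.proj x) r) (w : E2) :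
    T.proj (fderiv ℝ (graphMap T g) a w) = w := by
  have h1 : HasFDerivAt (fun b => T.proj (graphMap T g b)) _ a :=
    T.proj.hasFDerivAt.comp a (h.hasFDerivAt_graphMap ha)
  simp only [proj_graphMap] at h1
  have := DFunLike.congr_fun (h1.unique (hasFDerivAt_id a)) w
  simpa using this

theorem norm_le_norm_fderiv_graphMap (h : IsGraphChart E T x r s g) {a : E2}
    (ha : a ∈ Metric.ball (T.proj x) r) (w : E2) : ‖w‖ ≤ ‖fderiv ℝ (graphMap T g) a w‖ := by
  conv_lhs => rw [← h.proj_fderiv_graphMap ha w]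
  exact T.norm_proj_le _

theorem eventually_mem_frontier (h : IsGraphChart E T x r s g) {a : E2}
    (ha : a ∈ Metric.ball (T.proj x) r) : ∀ᶠ b in 𝓝 a, graphMap T g b ∈ frontier E := by
  filter_upwards [Metric.isOpen_ball.mem_nhds ha] with b hb using h.graphMap_mem hb

/-- Write the normal as `(p, c)` in the frame. Tangency forces `L w = (w, -⟨p, w⟩ / c)`, whose Gram
determinant is `1 + |p|² / c² = 1 / c²` because `|p|² + c² = 1`. -/
theorem normDet_fderiv (h : IsGraphChart E T x r s g) (hE : IsSmoothSet E) {a : E2}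
    (ha : a ∈ Metric.ball (T.proj x) r) :
    ((fderiv ℝ (graphMap T g) a : E2 →L[ℝ] E3) : E2 →ₗ[ℝ] E3).normDet =
      (inner ℝ T.axis (outerNormal E (graphMap T g a)))⁻¹ := by
  set L := fderiv ℝ (graphMap T g) a with hL
  set n := outerNormal E (graphMap T g a) with hn
  have hc : 0 < inner ℝ T.axis n := h.normal_pos a ha
  rw [T.inner_axis] at hc ⊢
  set c := T.height n with hc'
  set p := T.proj n with hp
  have hn1 : ‖p‖ ^ 2 + c ^ 2 = 1 := by
    rw [← T.norm_sq_eq, hE.norm_outerNormal (h.graphMap_mem ha)]; norm_num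
  have hLw : ∀ w, L w = T.pt w (-(inner ℝ p w) / c) := by
    intro w
    have h0 := hE.inner_outerNormal_fderiv (h.hasFDerivAt_graphMap ha)
      (h.eventually_mem_frontier ha) w
    rw [← hL, ← hn, ← T.pt_proj_height n, ← T.pt_proj_height (L w), T.inner_pt,
      h.proj_fderiv_graphMap ha] at h0
    rw [← T.pt_proj_height (L w), h.proj_fderiv_graphMap ha]
    congr 1
    rw [eq_div_iff hc.ne']
    rw [← hp, ← hc'] at h0
    linarith
  have hsq := LinearMap.normDet_sq_eq_det_gram (L : E2 →ₗ[ℝ] E3) (EuclideanSpace.basisFun (Fin 2) ℝ)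
  have hp2 : ‖p‖ ^ 2 = p 0 ^ 2 + p 1 ^ 2 := by
    rw [EuclideanSpace.norm_sq_eq]; simp
  rw [Matrix.det_fin_two] at hsq
  simp only [Matrix.gram_apply, ContinuousLinearMap.coe_coe, hLw, T.inner_pt,
    EuclideanSpace.basisFun_apply] at hsq
  simp only [RCLike.ofReal_real_eq_id, id_eq, EuclideanSpace.inner_single_right] at hsq
  simp at hsq
  have hval : ((L : E2 →ₗ[ℝ] E3).normDet) ^ 2 = (c⁻¹) ^ 2 := by
    rw [hsq]
    field_simp
    nlinarith
  exact (sq_eq_sq₀ (LinearMap.normDet_nonneg _) (inv_nonneg.2 hc.le)).1 hval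

/-- Near `a` the area of the graph is comparable to the area on the tangent plane. -/
theorem area_local (h : IsGraphChart E T x r s g) (hE : IsSmoothSet E) {a : E2}
    (ha : a ∈ Metric.ball (T.proj x) r) {c : ℝ≥0} (hc : 1 < c) :
    ∃ V ∈ 𝓝 a, ∀ A ⊆ V,
      μHE[2] (graphMap T g '' A) ≤ (c : ℝ≥0∞) ^ 2 *
        (ENNReal.ofReal (inner ℝ T.axis (outerNormal E (graphMap T g a)))⁻¹ * volume A) ∧
      ENNReal.ofReal (inner ℝ T.axis (outerNormal E (graphMap T g a)))⁻¹ * volume A ≤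
        (c : ℝ≥0∞) ^ 2 * μHE[2] (graphMap T g '' A) := by
  set L := fderiv ℝ (graphMap T g) a with hL
  have hc0 : (0 : ℝ) < c := lt_trans one_pos (by exact_mod_cast hc)
  have hc1 : (1 : ℝ) < c := by exact_mod_cast hc
  have hε : 0 < 1 - (c : ℝ)⁻¹ := by
    rw [sub_pos]; exact inv_lt_one_of_one_lt₀ hc1
  have hstrict : HasStrictFDerivAt (graphMap T g) L a :=
    (h.contDiffAt_graphMap ha).hasStrictFDerivAt (by simp)
  -- With error `1 - 1/c` relative to `‖L b - L b'‖`, increments of the graph map are at least `1/c`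
  -- and at most `2 - 1/c ≤ c` times those of `L`. Both comparison maps are therefore `c`-Lipschitz.
  obtain ⟨V, hV, hap⟩ := hstrict.approximates_deriv_on_nhds (c := ⟨1 - (c : ℝ)⁻¹, hε.le⟩)
    (Or.inr (by exact_mod_cast hε))
  refine ⟨V, hV, fun A hA => ?_⟩
  have hbase : ∀ b ∈ V, ∀ b' ∈ V,
      ‖graphMap T g b - graphMap T g b' - (L b - L b')‖ ≤ (1 - (c : ℝ)⁻¹) * ‖L b - L b'‖ := by
    intro b hb b' hb'
    rw [← map_sub]
    refine (hap b hb b' hb').trans ?_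
    exact mul_le_mul_of_nonneg_left (h.norm_le_norm_fderiv_graphMap ha _) hε.le
  have hcinv : (2 : ℝ) - (c : ℝ)⁻¹ ≤ c := by
    have h1 : (c : ℝ) * (c : ℝ)⁻¹ = 1 := mul_inv_cancel₀ hc0.ne'
    nlinarith [sq_nonneg ((c : ℝ) - 1), inv_pos.2 hc0]
  have hup : LipschitzOnWith c (fun y => graphMap T g (T.proj y)) (L '' A) := by
    refine LipschitzOnWith.of_dist_le_mul ?_
    rintro _ ⟨b, hb, rfl⟩ _ ⟨b', hb', rfl⟩
    simp only [hL, h.proj_fderiv_graphMap ha]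
    rw [← hL, dist_eq_norm, dist_eq_norm]
    have h1 := hbase b (hA hb) b' (hA hb')
    have h2 := norm_sub_norm_le (graphMap T g b - graphMap T g b') (L b - L b')
    nlinarith [norm_nonneg (L b - L b')]
  have hlow : LipschitzOnWith c (fun y => L (T.proj y)) (graphMap T g '' A) := by
    refine LipschitzOnWith.of_dist_le_mul ?_
    rintro _ ⟨b, hb, rfl⟩ _ ⟨b', hb', rfl⟩
    simp only [proj_graphMap]
    rw [dist_eq_norm, dist_eq_norm]
    have h1 := hbase b (hA hb) b' (hA hb')
    have h2 := norm_sub_norm_le (L b - L b') (graphMap T g b - graphMap T g b')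
    rw [norm_sub_rev (L b - L b')] at h2
    have h3 : (c : ℝ)⁻¹ * ‖L b - L b'‖ ≤ ‖graphMap T g b - graphMap T g b'‖ := by linarith
    rwa [inv_mul_le_iff₀ hc0] at h3
  have hvol : μHE[2] (L '' A) =
      ENNReal.ofReal (inner ℝ T.axis (outerNormal E (graphMap T g a)))⁻¹ * volume A := by
    rw [← h.normDet_fderiv hE ha]
    have := LinearMap.euclideanHausdorffMeasure_image_eq_normDet_mul_volume (L : E2 →ₗ[ℝ] E3) A
    simpa using this
  have him1 : (fun y => graphMap T g (T.proj y)) '' (L '' A) = graphMap T g '' A := by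
    rw [Set.image_image]
    refine Set.image_congr fun b _ => ?_
    rw [hL, h.proj_fderiv_graphMap ha]
  have him2 : (fun y => L (T.proj y)) '' (graphMap T g '' A) = L '' A := by
    rw [Set.image_image]
    refine Set.image_congr fun b _ => ?_
    rw [proj_graphMap]
  constructor
  · rw [← hvol, ← him1]
    exact LipschitzOnWith.euclideanHausdorffMeasure_image_le hup
  · rw [← hvol, ← him2]
    exact LipschitzOnWith.euclideanHausdorffMeasure_image_le hlow

/-- The part of the boundary described by the chart. -/
theorem image_eq (h : IsGraphChart E T x r s g) :
    graphMap T g '' Metric.ball (T.proj x) r = frontier E ∩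
      {y : E3 | T.proj y ∈ Metric.ball (T.proj x) r ∧ |T.height y - T.height x| < s} := by
  ext y
  constructor
  · rintro ⟨a, ha, rfl⟩
    refine ⟨h.graphMap_mem ha, ?_, ?_⟩
    · simpa using ha
    · simpa using h.height_lt a ha
  · rintro ⟨hy, h1, h2⟩
    exact ⟨T.proj y, h1, h.graphMap_proj hy h1 h2⟩

theorem measurableSet_image (h : IsGraphChart E T x r s g) :
    MeasurableSet (graphMap T g '' Metric.ball (T.proj x) r) := by
  rw [h.image_eq]
  exact isClosed_frontier.measurableSet.inter (isOpen_box T x r s).measurableSet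

theorem preimage_proj_inter_image (A : Set E2) (B : Set E2) :
    T.proj ⁻¹' A ∩ graphMap T g '' B = graphMap T g '' (A ∩ B) := by
  ext y
  constructor
  · rintro ⟨h1, a, ha, rfl⟩
    exact ⟨a, ⟨by simpa using h1, ha⟩, rfl⟩
  · rintro ⟨a, ha, rfl⟩
    exact ⟨by simpa using ha.1, a, ha.2, rfl⟩

/-- The area density of the graph. -/
def density (E : Set E3) (T : Frame) (g : E2 → ℝ) (a : E2) : ℝ :=
  (inner ℝ T.axis (outerNormal E (graphMap T g a)))⁻¹

theorem density_pos (h : IsGraphChart E T x r s g) {a : E2}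
    (ha : a ∈ Metric.ball (T.proj x) r) : 0 < density E T g a :=
  inv_pos.2 (h.normal_pos a ha)

theorem continuousOn_density (h : IsGraphChart E T x r s g) (hE : IsSmoothSet E) :
    ContinuousOn (density E T g) (Metric.ball (T.proj x) r) := by
  refine ContinuousOn.inv₀ ?_ fun a ha => (h.normal_pos a ha).ne'
  exact continuousOn_const.inner (hE.continuousOn_outerNormal.comp
    h.contDiffOn_graphMap.continuousOn fun a ha => h.graphMap_mem ha)

/-- The area formula for graphs. -/
theorem map_proj_restrict (h : IsGraphChart E T x r s g) (hE : IsSmoothSet E) :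
    ((μHE[2] : Measure E3).restrict (graphMap T g '' Metric.ball (T.proj x) r)).map T.proj =
      (volume.restrict (Metric.ball (T.proj x) r)).withDensity
        fun a => ENNReal.ofReal (density E T g a) := by
  set B := Metric.ball (T.proj x) r with hB
  set μ := ((μHE[2] : Measure E3).restrict (graphMap T g '' B)).map T.proj with hμ
  set ν := (volume.restrict B).withDensity fun a => ENNReal.ofReal (density E T g a) with hν
  have hμa : ∀ A : Set E2, A ⊆ B → MeasurableSet A → μ A = μHE[2] (graphMap T g '' A) := by
    intro A hA hAm
    rw [hμ, Measure.map_apply T.proj.continuous.measurable hAm,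
      Measure.restrict_apply (T.proj.continuous.measurable hAm), preimage_proj_inter_image,
      Set.inter_eq_left.2 hA]
  have hνa : ∀ A : Set E2, A ⊆ B → MeasurableSet A →
      ν A = ∫⁻ a in A, ENNReal.ofReal (density E T g a) := by
    intro A hA hAm
    rw [hν, withDensity_apply _ hAm, Measure.restrict_restrict hAm, Set.inter_eq_left.2 hA]
  have hcompl : ∀ A : Set E2, MeasurableSet A → μ A = μ (A ∩ B) ∧ ν A = ν (A ∩ B) := by
    intro A hAm
    constructor
    · rw [hμ, Measure.map_apply T.proj.continuous.measurable hAm,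
        Measure.map_apply T.proj.continuous.measurable (hAm.inter measurableSet_ball),
        Measure.restrict_apply (T.proj.continuous.measurable hAm),
        Measure.restrict_apply (T.proj.continuous.measurable (hAm.inter measurableSet_ball)),
        preimage_proj_inter_image, preimage_proj_inter_image, Set.inter_assoc, Set.inter_self]
    · rw [hν, withDensity_apply _ hAm, withDensity_apply _ (hAm.inter measurableSet_ball),
        Measure.restrict_restrict hAm, Measure.restrict_restrict (hAm.inter measurableSet_ball),
        Set.inter_assoc, Set.inter_self]
  -- Two factors `c` come from the Lipschitz comparison with the tangent plane, the third from the
  -- oscillation of the density near `a`.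
  have hloc : ∀ c : ℝ≥0, 1 < c → ∀ a ∈ B, ∃ V ∈ 𝓝 a, ∀ A ⊆ V ∩ B, MeasurableSet A →
      μ A ≤ (c : ℝ≥0∞) ^ 3 * ν A ∧ ν A ≤ (c : ℝ≥0∞) ^ 3 * μ A := by
    intro c hc a ha
    have hc0 : (0 : ℝ) < c := lt_trans one_pos (by exact_mod_cast hc)
    have hc1 : (1 : ℝ) < c := by exact_mod_cast hc
    obtain ⟨V, hV, hVA⟩ := h.area_local hE ha hc
    have hJ := h.density_pos ha
    have hJc := (h.continuousOn_density hE).continuousAt (Metric.isOpen_ball.mem_nhds ha)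
    have h1 : ∀ᶠ b in 𝓝 a, density E T g b ≤ c * density E T g a :=
      (hJc.eventually (gt_mem_nhds (by nlinarith : density E T g a < c * density E T g a))).mono
        fun b hb => hb.le
    have h2 : ∀ᶠ b in 𝓝 a, density E T g a ≤ c * density E T g b :=
      (((continuousAt_const (y := (c : ℝ))).mul hJc).eventually
        (lt_mem_nhds (by nlinarith : density E T g a < c * density E T g a))).mono
        fun b hb => hb.le
    refine ⟨V ∩ ({b | density E T g b ≤ c * density E T g a} ∩
      {b | density E T g a ≤ c * density E T g b}), inter_mem hV (inter_mem h1 h2), ?_⟩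
    intro A hA hAm
    have hAV : A ⊆ V := fun b hb => (hA hb).1.1
    have hAB : A ⊆ B := fun b hb => (hA hb).2
    obtain ⟨e1, e2⟩ := hVA A hAV
    have e3 : ENNReal.ofReal (density E T g a) * volume A ≤ c * ν A := by
      rw [hνa A hAB hAm, ← lintegral_const_mul' _ _ ENNReal.coe_ne_top,
        ← setLIntegral_const]
      refine setLIntegral_mono' hAm fun b hb => ?_
      rw [← ENNReal.ofReal_coe_nnreal, ← ENNReal.ofReal_mul hc0.le]
      exact ENNReal.ofReal_le_ofReal (hA hb).1.2.2
    have e4 : ν A ≤ c * (ENNReal.ofReal (density E T g a) * volume A) := by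
      rw [hνa A hAB hAm, ← setLIntegral_const, ← lintegral_const_mul' _ _ ENNReal.coe_ne_top]
      refine setLIntegral_mono' hAm fun b hb => ?_
      rw [← ENNReal.ofReal_coe_nnreal, ← ENNReal.ofReal_mul hc0.le]
      exact ENNReal.ofReal_le_ofReal (hA hb).1.2.1
    rw [hμa A hAB hAm]
    constructor
    · calc _ ≤ _ := e1
        _ ≤ (c : ℝ≥0∞) ^ 2 * (c * ν A) := mul_le_mul_right e3 _
        _ = _ := by ring
    · calc _ ≤ _ := e4
        _ ≤ c * ((c : ℝ≥0∞) ^ 2 * _) := mul_le_mul_right e2 _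
        _ = _ := by ring
  have hB3 : ∀ A : Set E2, A ⊆ B → MeasurableSet A → ∀ c : ℝ≥0, 1 < c →
      μ A ≤ c * ν A ∧ ν A ≤ c * μ A := by
    intro A hA hAm c hc
    -- The cube root absorbs the three factors of the local comparison.
    set d : ℝ≥0 := c ^ ((3 : ℝ)⁻¹) with hd
    have hd1 : 1 < d := NNReal.one_lt_rpow hc (by norm_num)
    have hd3 : (d : ℝ≥0∞) ^ 3 = c := by
      rw [← ENNReal.coe_pow, hd, ← NNReal.rpow_natCast, ← NNReal.rpow_mul]
      norm_num
    have hl := hloc d hd1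
    rw [hd3] at hl
    constructor
    · refine measure_le_of_locally_le (S := B) (fun a ha => ?_) hA hAm
      obtain ⟨V, hV, h'⟩ := hl a ha
      exact ⟨V, hV, fun A hA hAm => (h' A hA hAm).1⟩
    · refine measure_le_of_locally_le (S := B) (fun a ha => ?_) hA hAm
      obtain ⟨V, hV, h'⟩ := hl a ha
      exact ⟨V, hV, fun A hA hAm => (h' A hA hAm).2⟩
  ext A hAm
  rw [(hcompl A hAm).1, (hcompl A hAm).2]
  have := hB3 (A ∩ B) Set.inter_subset_right (hAm.inter measurableSet_ball)
  exact le_antisymm (ENNReal_le_of_forall_one_lt_mul fun c hc => (this c hc).1)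
    (ENNReal_le_of_forall_one_lt_mul fun c hc => (this c hc).2)

theorem one_le_density (h : IsGraphChart E T x r s g) (hE : IsSmoothSet E) {a : E2}
    (ha : a ∈ Metric.ball (T.proj x) r) : 1 ≤ density E T g a := by
  refine (one_le_inv₀ (h.normal_pos a ha)).2 ?_
  have := real_inner_le_norm T.axis (outerNormal E (graphMap T g a))
  rwa [T.norm_axis, hE.norm_outerNormal (h.graphMap_mem ha), mul_one] at this

theorem graphMap_proj_of_mem {B : Set E2} {y : E3} (hy : y ∈ graphMap T g '' B) :
    graphMap T g (T.proj y) = y := by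
  obtain ⟨a, -, rfl⟩ := hy
  rw [proj_graphMap]

/-- Since the density is at least one, no measurability of `F` is needed. This is what allows upper
gradients that are not assumed measurable. -/
theorem lintegral_le (h : IsGraphChart E T x r s g) (hE : IsSmoothSet E) (F : E3 → ℝ≥0∞) :
    ∫⁻ a in Metric.ball (T.proj x) r, F (graphMap T g a) ≤
      ∫⁻ y in graphMap T g '' Metric.ball (T.proj x) r, F y ∂μHE[2] := by
  set B := Metric.ball (T.proj x) r
  have h1 : volume.restrict B ≤
      ((μHE[2] : Measure E3).restrict (graphMap T g '' B)).map T.proj := by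
    rw [h.map_proj_restrict hE]
    refine Measure.le_iff.2 fun A hA => ?_
    rw [withDensity_apply _ hA, Measure.restrict_restrict hA, Measure.restrict_apply hA,
      ← setLIntegral_one]
    refine setLIntegral_mono' (hA.inter measurableSet_ball) fun a ha => ?_
    rw [← ENNReal.ofReal_one]
    exact ENNReal.ofReal_le_ofReal (h.one_le_density hE ha.2)
  calc _ ≤ ∫⁻ a, F (graphMap T g a)
        ∂(((μHE[2] : Measure E3).restrict (graphMap T g '' B)).map T.proj) :=
        lintegral_mono' h1 le_rfl
    _ ≤ ∫⁻ y in graphMap T g '' B, F (graphMap T g (T.proj y)) ∂μHE[2] :=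
        lintegral_map_le _ _
    _ = _ := setLIntegral_congr_fun h.measurableSet_image fun y hy => by
        simp only [graphMap_proj_of_mem hy]

theorem lintegral_image_le (h : IsGraphChart E T x r s g) (hE : IsSmoothSet E) {F : E3 → ℝ≥0∞}
    (hF : AEMeasurable (fun a => F (graphMap T g a)) (volume.restrict (Metric.ball (T.proj x) r)))
    {K : ℝ} (hK : ∀ a ∈ Metric.ball (T.proj x) r, density E T g a ≤ K) :
    ∫⁻ y in graphMap T g '' Metric.ball (T.proj x) r, F y ∂μHE[2] ≤
      ENNReal.ofReal K * ∫⁻ a in Metric.ball (T.proj x) r, F (graphMap T g a) := by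
  set B := Metric.ball (T.proj x) r
  have hd : AEMeasurable (fun a => ENNReal.ofReal (density E T g a)) (volume.restrict B) :=
    ((h.continuousOn_density hE).aemeasurable measurableSet_ball).ennreal_ofReal
  have hF' : AEMeasurable (fun a => F (graphMap T g a))
      (((μHE[2] : Measure E3).restrict (graphMap T g '' B)).map T.proj) := by
    rw [h.map_proj_restrict hE]
    exact hF.mono_ac (withDensity_absolutelyContinuous _ _)
  calc _ = ∫⁻ y in graphMap T g '' B, F (graphMap T g (T.proj y)) ∂μHE[2] :=
        setLIntegral_congr_fun h.measurableSet_image fun y hy => by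
          simp only [graphMap_proj_of_mem hy]
    _ = ∫⁻ a, F (graphMap T g a)
        ∂(((μHE[2] : Measure E3).restrict (graphMap T g '' B)).map T.proj) :=
        (lintegral_map' hF' T.proj.continuous.aemeasurable).symm
    _ = ∫⁻ a in B, ENNReal.ofReal (density E T g a) * F (graphMap T g a) := by
        rw [h.map_proj_restrict hE, lintegral_withDensity_eq_lintegral_mul₀ hd hF]
        rfl
    _ ≤ ∫⁻ a in B, ENNReal.ofReal K * F (graphMap T g a) := by
        refine setLIntegral_mono' measurableSet_ball fun a ha => ?_
        gcongr
        exact hK a ha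
    _ = _ := lintegral_const_mul'' _ hF

/-- The flux through the graph in the vertical direction. -/
theorem integral_inner_axis (h : IsGraphChart E T x r s g) (hE : IsSmoothSet E) {ζ : E3 → ℝ}
    (hζ : Continuous ζ) :
    ∫ y in graphMap T g '' Metric.ball (T.proj x) r,
      ζ y * inner ℝ T.axis (outerNormal E y) ∂μHE[2] =
      ∫ a in Metric.ball (T.proj x) r, ζ (graphMap T g a) := by
  set B := Metric.ball (T.proj x) r
  have hd : AEMeasurable (fun a => (density E T g a).toNNReal) (volume.restrict B) :=
    ((h.continuousOn_density hE).aemeasurable measurableSet_ball).real_toNNReal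
  set F : E3 → ℝ := fun y => ζ y * inner ℝ T.axis (outerNormal E y) with hF
  have hGc : ContinuousOn (graphMap T g) B := h.contDiffOn_graphMap.continuousOn
  have hFc : ContinuousOn (fun a => F (graphMap T g a)) B := by
    refine (hζ.comp_continuousOn hGc).mul (continuousOn_const.inner ?_)
    exact hE.continuousOn_outerNormal.comp hGc fun a ha => h.graphMap_mem ha
  have hFm : AEStronglyMeasurable (fun a => F (graphMap T g a)) (volume.restrict B) :=
    hFc.aestronglyMeasurable measurableSet_ball
  have hF' : AEStronglyMeasurable (fun a => F (graphMap T g a))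
      (((μHE[2] : Measure E3).restrict (graphMap T g '' B)).map T.proj) := by
    rw [h.map_proj_restrict hE]
    exact hFm.mono_ac (withDensity_absolutelyContinuous _ _)
  calc ∫ y in graphMap T g '' B, F y ∂μHE[2]
      = ∫ y in graphMap T g '' B, F (graphMap T g (T.proj y)) ∂μHE[2] :=
        setIntegral_congr_fun h.measurableSet_image fun y hy => by
          simp only [graphMap_proj_of_mem hy]
    _ = ∫ a, F (graphMap T g a)
        ∂(((μHE[2] : Measure E3).restrict (graphMap T g '' B)).map T.proj) :=
        (integral_map T.proj.continuous.aemeasurable hF').symm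
    _ = ∫ a in B, (density E T g a).toNNReal • F (graphMap T g a) := by
        rw [h.map_proj_restrict hE]
        exact integral_withDensity_eq_integral_smul₀ hd _
    _ = ∫ a in B, ζ (graphMap T g a) := by
        refine setIntegral_congr_fun measurableSet_ball fun a ha => ?_
        -- The area density is the reciprocal of the vertical component of the normal, so the two
        -- cancel.
        have h1 := h.normal_pos a ha
        have h2 : inner ℝ T.axis (outerNormal E (graphMap T g a)) ≠ 0 := h1.ne'
        simp only [hF, NNReal.smul_def, smul_eq_mul, Real.coe_toNNReal _ (h.density_pos ha).le]
        rw [density]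
        field_simp

end IsGraphChart

/-- The surface measure on the whole periodic boundary. -/
def bdryMeasure (E : Set E3) : Measure E3 := (μHE[2] : Measure E3).restrict (frontier E)

theorem IsSmoothSet.isLocallyFiniteMeasure {E : Set E3} (hE : IsSmoothSet E) :
    IsLocallyFiniteMeasure (bdryMeasure E) := by
  refine ⟨fun x => ?_⟩
  by_cases hx : x ∈ frontier E
  · obtain ⟨T, hT⟩ := Frame.exists_axis_eq _ (hE.norm_outerNormal hx)
    obtain ⟨r, s, g, h, -⟩ := hE.exists_graphChart hx T
      (by rw [hT, real_inner_self_eq_norm_sq, hE.norm_outerNormal hx]; norm_num) univ_mem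
    have hx0 : T.proj x ∈ Metric.ball (T.proj x) r := Metric.mem_ball_self h.r_pos
    obtain ⟨V, hV, hVA⟩ := h.area_local hE hx0 (c := 2) (by norm_num)
    have hVB : V ∩ Metric.ball (T.proj x) r ∈ 𝓝 (T.proj x) :=
      inter_mem hV (Metric.isOpen_ball.mem_nhds hx0)
    obtain ⟨O, hOV, hO, hxO⟩ := mem_nhds_iff.1 hVB
    refine ⟨T.proj ⁻¹' O ∩ {y : E3 | T.proj y ∈ Metric.ball (T.proj x) r ∧
      |T.height y - T.height x| < s}, inter_mem ((hO.preimage T.proj.continuous).mem_nhds hxO)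
      ((IsGraphChart.isOpen_box T x r s).mem_nhds ⟨hx0, by simpa using h.s_pos⟩), ?_⟩
    have hle := (hVA (V ∩ Metric.ball (T.proj x) r) Set.inter_subset_left).1
    rw [bdryMeasure, Measure.restrict_apply ((hO.preimage T.proj.continuous).measurableSet.inter
      (IsGraphChart.isOpen_box T x r s).measurableSet)]
    refine lt_of_le_of_lt (measure_mono ?_) (lt_of_le_of_lt hle ?_)
    · rintro y ⟨⟨hy1, hy2⟩, hy3⟩
      exact ⟨T.proj y, hOV hy1, h.graphMap_proj hy3 hy2.1 hy2.2⟩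
    · refine ENNReal.mul_lt_top (by norm_num) (ENNReal.mul_lt_top ENNReal.ofReal_lt_top ?_)
      exact lt_of_le_of_lt (measure_mono Set.inter_subset_right) measure_ball_lt_top
  · refine ⟨(frontier E)ᶜ, isClosed_frontier.isOpen_compl.mem_nhds hx, ?_⟩
    rw [bdryMeasure, Measure.restrict_apply isClosed_frontier.isOpen_compl.measurableSet]
    simp

theorem aestronglyMeasurable_bdry {E : Set E3} {V : Type*} [NormedAddCommGroup V]
    [SecondCountableTopology V] {f : E3 → V} (hf : ContinuousOn f (frontier E)) :
    AEStronglyMeasurable f (bdryMeasure E) :=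
  hf.aestronglyMeasurable isClosed_frontier.measurableSet

/-! ### The divergence theorem, locally -/

theorem integrable_of_support_compact {E : Set E3} (hE : IsSmoothSet E) {f : E3 → ℝ} {K : Set E3}
    (hK : IsCompact K) (hf : ContinuousOn f (frontier E)) (h0 : ∀ y ∈ frontier E, y ∉ K → f y = 0) :
    Integrable f (bdryMeasure E) := by
  have := hE.isLocallyFiniteMeasure
  have h1 : IntegrableOn f (K ∩ frontier E) (bdryMeasure E) :=
    (hf.mono Set.inter_subset_right).integrableOn_compact (hK.inter_right isClosed_frontier)
  have h2 : IntegrableOn f (frontier E) (bdryMeasure E) := by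
    refine h1.of_ae_sdiff_eq_zero isClosed_frontier.measurableSet.nullMeasurableSet ?_
    filter_upwards with y hy
    exact h0 y hy.1 fun hyK => hy.2 ⟨hyK, hy.1⟩
  rw [IntegrableOn, bdryMeasure, Measure.restrict_restrict isClosed_frontier.measurableSet,
    Set.inter_self] at h2
  exact h2

theorem inner_single_one_right (a : E3) (i : Fin 3) :
    inner ℝ a (EuclideanSpace.single i 1) = a i := by
  simp [EuclideanSpace.inner_single_right]

theorem inner_single_one_left (a : E3) (i : Fin 3) :
    inner ℝ (EuclideanSpace.single i 1) a = a i := by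
  simp [EuclideanSpace.inner_single_left]

theorem hasCompactSupport_fderiv_apply {ζ : E3 → ℝ} (h : HasCompactSupport ζ) (w : E3) :
    HasCompactSupport fun y => fderiv ℝ ζ y w :=
  (h.fderiv ℝ).mono fun y hy => by
    contrapose! hy
    simp only [Function.mem_support, ne_eq, not_not] at hy ⊢
    rw [hy]; rfl

theorem tsupport_fderiv_apply_subset (ζ : E3 → ℝ) (w : E3) :
    tsupport (fun y => fderiv ℝ ζ y w) ⊆ tsupport ζ :=
  (closure_mono fun y hy => by
    contrapose! hy
    simp only [Function.mem_support, ne_eq, not_not] at hy ⊢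
    rw [hy]; rfl).trans (tsupport_fderiv_subset ℝ)

theorem contDiff_fderiv_apply {ζ : E3 → ℝ} (h : ContDiff ℝ ∞ ζ) (w : E3) :
    ContDiff ℝ ∞ fun y => fderiv ℝ ζ y w :=
  (h.fderiv_right (by simp)).clm_apply contDiff_const

theorem setIntegral_eq_iterated (T : Frame) {O : Set E3} (hO : MeasurableSet O) {F : E3 → ℝ}
    (hF : Continuous F) (hFc : HasCompactSupport F) :
    ∫ y in O, F y = ∫ a, ∫ z, O.indicator F (T.pt a z) := by
  have h1 : Integrable (O.indicator F) := (hF.integrable_of_hasCompactSupport hFc).indicator hO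
  rw [← integral_indicator hO, ← T.measurePreserving_pt.integral_comp T.measurableEmbedding_pt]
  exact integral_prod _ ((T.measurePreserving_pt.integrable_comp_emb T.measurableEmbedding_pt).2 h1)

/-- Within the chart, a vertical line meets the interior in the part below the graph. Fubini and the
fundamental theorem of calculus reduce the volume integral to values of `ζ` on the graph, and the
area formula identifies these with the flux in the axis direction. -/
theorem IsGraphChart.flux_axis {E : Set E3} (hE : IsSmoothSet E) {T : Frame} {x : E3} {r s : ℝ}
    {g : E2 → ℝ} (h : IsGraphChart E T x r s g) {ζ : E3 → ℝ} (hζ : ContDiff ℝ ∞ ζ)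
    (hζc : HasCompactSupport ζ)
    (hs : tsupport ζ ⊆ {y : E3 | T.proj y ∈ Metric.ball (T.proj x) r ∧
      |T.height y - T.height x| < s}) :
    ∫ y, ζ y * inner ℝ T.axis (outerNormal E y) ∂(bdryMeasure E) =
      ∫ y in interior E, fderiv ℝ ζ y T.axis := by
  set B := Metric.ball (T.proj x) r with hB
  have hz : ∀ y, ¬ (T.proj y ∈ B ∧ |T.height y - T.height x| < s) → ζ y = 0 := fun y hy =>
    image_eq_zero_of_notMem_tsupport fun h => hy (hs h)
  have hl : ∫ y, ζ y * inner ℝ T.axis (outerNormal E y) ∂(bdryMeasure E) =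
      ∫ a in B, ζ (graphMap T g a) := by
    rw [← h.integral_inner_axis hE hζ.continuous, h.image_eq, bdryMeasure]
    refine setIntegral_eq_of_subset_of_forall_sdiff_eq_zero
      (isClosed_frontier (s := E)).measurableSet Set.inter_subset_left ?_
    rintro y ⟨hy1, hy2⟩
    rw [hz y fun hc => hy2 ⟨hy1, hc⟩, zero_mul]
  rw [hl, setIntegral_eq_iterated T isOpen_interior.measurableSet
    (contDiff_fderiv_apply hζ _).continuous (hasCompactSupport_fderiv_apply hζc _),
    ← integral_indicator measurableSet_ball]
  congr 1
  funext a
  have hz' : ∀ y, ¬ (T.proj y ∈ B ∧ |T.height y - T.height x| < s) → fderiv ℝ ζ y T.axis = 0 :=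
    fun y hy => by
      have : y ∉ tsupport (fun y => fderiv ℝ ζ y T.axis) := fun h =>
        hy (hs (tsupport_fderiv_apply_subset ζ _ h))
      exact image_eq_zero_of_notMem_tsupport (f := fun y => fderiv ℝ ζ y T.axis) this
  by_cases ha : a ∈ B
  · rw [Set.indicator_of_mem ha]
    have hpt : ContDiff ℝ ∞ fun z : ℝ => T.pt a z :=
      T.contDiff_pt.comp (contDiff_const.prodMk contDiff_id)
    have hf : ContDiff ℝ ∞ fun z => ζ (T.pt a z) := hζ.comp hpt
    have hfc : HasCompactSupport fun z => ζ (T.pt a z) := by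
      refine HasCompactSupport.intro (isCompact_Icc (a := T.height x - s) (b := T.height x + s))
        fun z hzz => hz _ ?_
      rintro ⟨-, h2⟩
      rw [T.height_pt, abs_lt] at h2
      exact hzz ⟨by linarith, by linarith⟩
    have hd : ∀ z, deriv (fun z => ζ (T.pt a z)) z = fderiv ℝ ζ (T.pt a z) T.axis := fun z => by
      rw [(hasDerivAt_height (hζ.differentiable (by simp) _)).deriv, inner_gradient]
    have h1 : ∀ z, (interior E).indicator (fun y => fderiv ℝ ζ y T.axis) (T.pt a z) =
        (Set.Iio (g a)).indicator (deriv fun z => ζ (T.pt a z)) z := by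
      intro z
      by_cases hzs : |z - T.height x| < s
      · by_cases hzg : z < g a
        · rw [Set.indicator_of_mem ((h.interior_iff a ha z hzs).2 hzg),
            Set.indicator_of_mem (show z ∈ Set.Iio (g a) from hzg), hd]
        · rw [Set.indicator_of_notMem (fun hc => hzg ((h.interior_iff a ha z hzs).1 hc)),
            Set.indicator_of_notMem (show z ∉ Set.Iio (g a) from hzg)]
      · have h0 : fderiv ℝ ζ (T.pt a z) T.axis = 0 :=
          hz' _ fun hc => hzs (by simpa using hc.2)
        simp only [Set.indicator, hd, h0, ite_self]
    simp_rw [h1]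
    rw [integral_indicator measurableSet_Iio, ← integral_Iic_eq_integral_Iio,
      HasCompactSupport.integral_Iic_deriv_eq (hf.of_le (by exact WithTop.coe_le_coe.2 le_top)) hfc]
    rfl
  · rw [Set.indicator_of_notMem ha]
    have : ∀ z, (interior E).indicator (fun y => fderiv ℝ ζ y T.axis) (T.pt a z) = 0 := fun z => by
      simp [Set.indicator, hz' (T.pt a z) fun hc => ha (by simpa using hc.1)]
    simp [this]

/-- The divergence theorem for `E` with constant direction `w` and test functions supported near
a given point. -/
theorem IsSmoothSet.flux_local {E : Set E3} (hE : IsSmoothSet E) (x : E3) :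
    ∃ V ∈ 𝓝 x, ∀ ζ : E3 → ℝ, ContDiff ℝ ∞ ζ → HasCompactSupport ζ → tsupport ζ ⊆ V → ∀ w : E3,
      ∫ y, ζ y * inner ℝ w (outerNormal E y) ∂(bdryMeasure E) =
        ∫ y in interior E, fderiv ℝ ζ y w := by
  by_cases hx : x ∈ frontier E
  · set n := outerNormal E x with hn
    have hn1 : ‖n‖ = 1 := hE.norm_outerNormal hx
    -- the identity holds near `x` for every direction transversal to the boundary at `x`
    have key : ∀ u : E3, 0 < inner ℝ u n → ∃ V ∈ 𝓝 x, ∀ ζ : E3 → ℝ, ContDiff ℝ ∞ ζ →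
        HasCompactSupport ζ → tsupport ζ ⊆ V →
        ∫ y, ζ y * inner ℝ u (outerNormal E y) ∂(bdryMeasure E) =
          ∫ y in interior E, fderiv ℝ ζ y u := by
      intro u hu
      have hu0 : 0 < ‖u‖ := norm_pos_iff.2 fun h => by simp [h] at hu
      obtain ⟨T, hT⟩ := Frame.exists_axis_eq (‖u‖⁻¹ • u) (by
        rw [norm_smul, norm_inv, norm_norm, inv_mul_cancel₀ hu0.ne'])
      obtain ⟨r, s, g, h, -⟩ := hE.exists_graphChart hx T
        (by rw [hT, real_inner_smul_left]; positivity) univ_mem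
      refine ⟨_, (IsGraphChart.isOpen_box T x r s).mem_nhds
        ⟨Metric.mem_ball_self h.r_pos, by simpa using h.s_pos⟩, fun ζ hζ hζc hs => ?_⟩
      have h1 := h.flux_axis hE hζ hζc hs
      have hu' : u = ‖u‖ • T.axis := by
        rw [hT, smul_smul, mul_inv_cancel₀ hu0.ne', one_smul]
      rw [hu']
      simp_rw [real_inner_smul_left, map_smul, smul_eq_mul, mul_left_comm _ ‖u‖]
      rw [integral_const_mul, integral_const_mul, h1]
    -- all directions can be handled near `x` by means of the basis vectors
    have key2 : ∀ w : E3, ∃ V ∈ 𝓝 x, ∀ ζ : E3 → ℝ, ContDiff ℝ ∞ ζ →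
        HasCompactSupport ζ → tsupport ζ ⊆ V →
        ∫ y, ζ y * inner ℝ w (outerNormal E y) ∂(bdryMeasure E) =
          ∫ y in interior E, fderiv ℝ ζ y w := by
      intro w
      have hwn := (abs_le.1 (abs_real_inner_le_norm w n)).1
      rw [hn1, mul_one] at hwn
      have hnn : inner ℝ n n = 1 := by rw [real_inner_self_eq_norm_sq, hn1]; norm_num
      obtain ⟨V₁, hV₁, h1⟩ := key n (by rw [hnn]; norm_num)
      -- As `⟨w, n⟩ ≥ -‖w‖`, adding `(‖w‖ + 1) n` makes any direction transversal; `w` is then a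
      -- difference of two transversal directions.
      obtain ⟨V₂, hV₂, h2⟩ := key (w + (‖w‖ + 1) • n) (by
        rw [inner_add_left, real_inner_smul_left, hnn]; linarith)
      refine ⟨V₁ ∩ V₂, inter_mem hV₁ hV₂, fun ζ hζ hζc hs => ?_⟩
      have e1 := h1 ζ hζ hζc (hs.trans Set.inter_subset_left)
      have e2 := h2 ζ hζ hζc (hs.trans Set.inter_subset_right)
      have hint : ∀ u : E3, Integrable (fun y => ζ y * inner ℝ u (outerNormal E y))
          (bdryMeasure E) := fun u =>
        integrable_of_support_compact hE hζc
          (hζ.continuous.continuousOn.mul (continuousOn_const.inner hE.continuousOn_outerNormal))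
          fun y _ hy => by rw [image_eq_zero_of_notMem_tsupport hy, zero_mul]
      have hint2 : ∀ u : E3, IntegrableOn (fun y => fderiv ℝ ζ y u) (interior E) := fun u =>
        ((contDiff_fderiv_apply hζ u).continuous.integrable_of_hasCompactSupport
          (hasCompactSupport_fderiv_apply hζc u)).integrableOn
      have hw : w = (w + (‖w‖ + 1) • n) - (‖w‖ + 1) • n := by abel
      rw [hw]
      simp_rw [inner_sub_left, map_sub, mul_sub]
      rw [integral_sub (hint _) (hint _), integral_sub (hint2 _) (hint2 _), e2]
      simp_rw [real_inner_smul_left, map_smul, smul_eq_mul, mul_left_comm _ (‖w‖ + 1)]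
      rw [integral_const_mul, integral_const_mul, e1]
    choose V hV hVe using fun i : Fin 3 => key2 (EuclideanSpace.single i 1)
    refine ⟨⋂ i, V i, Filter.iInter_mem.2 hV, fun ζ hζ hζc hs w => ?_⟩
    have hint : ∀ u : E3, Integrable (fun y => ζ y * inner ℝ u (outerNormal E y))
        (bdryMeasure E) := fun u =>
      integrable_of_support_compact hE hζc
        (hζ.continuous.continuousOn.mul (continuousOn_const.inner hE.continuousOn_outerNormal))
        fun y _ hy => by rw [image_eq_zero_of_notMem_tsupport hy, zero_mul]
    have hint2 : ∀ u : E3, IntegrableOn (fun y => fderiv ℝ ζ y u) (interior E) := fun u =>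
      ((contDiff_fderiv_apply hζ u).continuous.integrable_of_hasCompactSupport
        (hasCompactSupport_fderiv_apply hζc u)).integrableOn
    have hw : w = ∑ i, w i • EuclideanSpace.single i (1 : ℝ) := by
      have := (EuclideanSpace.basisFun (Fin 3) ℝ).sum_repr w
      simpa using this.symm
    rw [hw]
    simp_rw [sum_inner, map_sum, Finset.mul_sum]
    rw [integral_finsetSum _ fun i _ => hint _, integral_finsetSum _ fun i _ => hint2 _]
    refine Finset.sum_congr rfl fun i _ => ?_
    have e := hVe i ζ hζ hζc (hs.trans (Set.iInter_subset _ i))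
    simp_rw [real_inner_smul_left, map_smul, smul_eq_mul, mul_left_comm _ (w i)]
    rw [integral_const_mul, integral_const_mul, e]
  · have hb : ∀ ζ : E3 → ℝ, (∀ y ∈ frontier E, ζ y = 0) → ∀ w : E3,
        ∫ y, ζ y * inner ℝ w (outerNormal E y) ∂(bdryMeasure E) = 0 := fun ζ hζ w =>
      setIntegral_eq_zero_of_forall_eq_zero fun y hy => by rw [hζ y hy, zero_mul]
    by_cases hxi : x ∈ interior E
    · refine ⟨interior E, isOpen_interior.mem_nhds hxi, fun ζ hζ hζc hs w => ?_⟩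
      have hi1 := (contDiff_fderiv_apply hζ w).continuous.integrable_of_hasCompactSupport
        (μ := volume) (hasCompactSupport_fderiv_apply hζc w)
      have hi2 := hζ.continuous.integrable_of_hasCompactSupport (μ := volume) hζc
      -- Integration by parts against the constant `1` shows that a compactly supported derivative
      -- has zero integral.
      have h0 := integral_mul_fderiv_eq_neg_fderiv_mul_of_integrable (μ := volume)
        (f := fun _ : E3 => (1 : ℝ)) (g := ζ) (v := w) (by simp) (by simpa using hi1)
        (by simpa using hi2) (by fun_prop) fun y _ => hζ.differentiable (by simp) y
      simp only [one_mul, fderiv_fun_const, Pi.zero_apply, zero_apply, zero_mul,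
        integral_zero, neg_zero] at h0
      rw [hb ζ (fun y hy => image_eq_zero_of_notMem_tsupport fun h => hy.2 (hs h)),
        setIntegral_eq_integral_of_forall_compl_eq_zero, h0]
      intro y hy
      exact image_eq_zero_of_notMem_tsupport (f := fun y => fderiv ℝ ζ y w)
        fun h => hy (hs (tsupport_fderiv_apply_subset ζ w h))
    · have hxc : x ∉ closure E := fun h => hx ⟨h, hxi⟩
      refine ⟨(closure E)ᶜ, isClosed_closure.isOpen_compl.mem_nhds hxc, fun ζ hζ hζc hs w => ?_⟩
      rw [hb ζ (fun y hy => image_eq_zero_of_notMem_tsupport fun h => hs h hy.1),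
        setIntegral_eq_zero_of_forall_eq_zero]
      intro y hy
      exact image_eq_zero_of_notMem_tsupport (f := fun y => fderiv ℝ ζ y w)
        fun h => hs (tsupport_fderiv_apply_subset ζ w h) (subset_closure (interior_subset hy))

/-- The mean curvature is the divergence of any unit extension of the normal. -/
theorem IsSmoothSet.meanCurv_eq {E : Set E3} (hE : IsSmoothSet E) {U : Set E3} {N : E3 → E3}
    (hU : IsOpen U) (hN : ContDiffOn ℝ ∞ N U) (h1 : ∀ y ∈ U, ‖N y‖ = 1)
    (h2 : ∀ y ∈ U, y ∈ frontier E → outerNormal E y = N y) {y : E3} (hy : y ∈ U)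
    (hyE : y ∈ frontier E) :
    meanCurv E y = ∑ i, fderiv ℝ N y (EuclideanSpace.single i 1) i := by
  have hNd : DifferentiableAt ℝ N y := (hN.contDiffAt (hU.mem_nhds hy)).differentiableAt (by simp)
  have hNi : ∀ i, HasFDerivAt (fun y => N y i)
      ((EuclideanSpace.proj (𝕜 := ℝ) i).comp (fderiv ℝ N y)) y := fun i =>
    (EuclideanSpace.proj (𝕜 := ℝ) i).hasFDerivAt.comp y hNd.hasFDerivAt
  have hT : ∀ i, tangGrad E (fun y => outerNormal E y i) y =
      tangPart (N y) (∇ (fun y => N y i) y) := by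
    intro i
    rw [hE.tangGrad_eq hyE (g := fun y => N y i) ?_ (hNi i).differentiableAt, h2 y hy hyE]
    filter_upwards [nhdsWithin_le_nhds (hU.mem_nhds hy), self_mem_nhdsWithin] with z hz hz'
    rw [h2 z hz hz']
  have hgr : ∀ i (v : E3), inner ℝ (∇ (fun y => N y i) y) v = fderiv ℝ N y v i := fun i v => by
    rw [inner_gradient, (hNi i).fderiv]; rfl
  -- Differentiating `|N|² = 1` in the direction `N` kills the normal correction that separates the
  -- tangential from the full divergence.
  have horth : ∑ i, fderiv ℝ N y (N y) i * N y i = 0 := by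
    have hc : (fun z => ‖N z‖ ^ 2) =ᶠ[𝓝 y] fun _ => (1 : ℝ) := by
      filter_upwards [hU.mem_nhds hy] with z hz
      rw [h1 z hz]; norm_num
    have h3 := hNd.hasFDerivAt.norm_sq
    have h4 := h3.unique ((hasFDerivAt_const (1 : ℝ) y).congr_of_eventuallyEq hc)
    have h5 := DFunLike.congr_fun h4 (N y)
    simp only [smul_apply, ContinuousLinearMap.comp_apply, zero_apply,
      innerSL_apply_apply, PiLp.inner_apply] at h5
    simpa [mul_comm] using h5
  rw [meanCurv]
  simp_rw [hT, tangPart, hgr]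
  simp only [PiLp.sub_apply, PiLp.smul_apply, smul_eq_mul, Finset.sum_sub_distrib, horth, sub_zero]
  refine Finset.sum_congr rfl fun i _ => ?_
  rw [← inner_single_one_right, hgr]

/-- The tangential divergence theorem for constant directions and test functions supported near a
given point. -/
theorem IsSmoothSet.tangential_local {E : Set E3} (hE : IsSmoothSet E) (x : E3) :
    ∃ V ∈ 𝓝 x, ∀ ζ : E3 → ℝ, ContDiff ℝ ∞ ζ → HasCompactSupport ζ → tsupport ζ ⊆ V →
      ∀ i : Fin 3, ∫ y, (ζ y * meanCurv E y * outerNormal E y i -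
        tangPart (outerNormal E y) (∇ ζ y) i) ∂(bdryMeasure E) = 0 := by
  by_cases hx : x ∈ frontier E
  swap
  · refine ⟨(frontier E)ᶜ, isClosed_frontier.isOpen_compl.mem_nhds hx, fun ζ hζ hζc hs i => ?_⟩
    refine setIntegral_eq_zero_of_forall_eq_zero fun y hy => ?_
    have h1 : ζ y = 0 := image_eq_zero_of_notMem_tsupport fun h => hs h hy
    have h2 : ∇ ζ y = 0 := by
      have : fderiv ℝ ζ y = 0 :=
        image_eq_zero_of_notMem_tsupport fun h => hs (tsupport_fderiv_subset ℝ h) hy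
      simp [gradient, this]
    simp [h1, h2, tangPart]
  obtain ⟨V, hV, hVe⟩ := hE.flux_local x
  obtain ⟨U, N, hU, hxU, hN, h1, h2⟩ := hE.exists_normalField hx
  refine ⟨V ∩ U, inter_mem hV (hU.mem_nhds hxU), fun ζ hζ hζc hs i => ?_⟩
  set e : Fin 3 → E3 := fun j => EuclideanSpace.single j 1 with he
  -- The cut-off `ζ` makes the locally defined normal field globally smooth.
  set M : Fin 3 → E3 → ℝ := fun j y => ζ y * N y j with hM
  have hMz : ∀ j y, y ∉ tsupport ζ → M j y = 0 := fun j y hy => by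
    rw [hM]; simp only [image_eq_zero_of_notMem_tsupport hy, zero_mul]
  have hMs : ∀ j, tsupport (M j) ⊆ tsupport ζ := fun j =>
    closure_minimal (fun y hy => by
      by_contra hc
      exact hy (hMz j y hc)) (isClosed_tsupport ζ)
  have hMc : ∀ j, HasCompactSupport (M j) := fun j =>
    HasCompactSupport.intro hζc fun y hy => hMz j y hy
  have hMd : ∀ j, ContDiff ℝ ∞ (M j) := by
    intro j
    rw [contDiff_iff_contDiffAt]
    intro y
    by_cases hy : y ∈ tsupport ζ
    · have := hN.contDiffAt (hU.mem_nhds (hs hy).2)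
      exact hζ.contDiffAt.mul ((EuclideanSpace.proj (𝕜 := ℝ) j).contDiff.contDiffAt.comp y this)
    · refine contDiffAt_const (c := (0 : ℝ)) |>.congr_of_eventuallyEq ?_
      filter_upwards [(isClosed_tsupport ζ).isOpen_compl.mem_nhds hy] with z hz
      exact hMz j z hz
  -- the flux of the divergence-free field `∂ᵢ M - (div M) eᵢ`
  have hflux : ∀ j k l : Fin 3,
      ∫ y, fderiv ℝ (M j) y (e k) * inner ℝ (e l) (outerNormal E y) ∂(bdryMeasure E) =
        ∫ y in interior E, fderiv ℝ (fderiv ℝ (M j)) y (e l) (e k) := by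
    intro j k l
    rw [hVe _ (contDiff_fderiv_apply (hMd j) (e k)) (hasCompactSupport_fderiv_apply (hMc j) _)
      ((tsupport_fderiv_apply_subset _ _).trans ((hMs j).trans (hs.trans Set.inter_subset_left)))]
    refine integral_congr_ae (ae_of_all _ fun y => ?_)
    have hd : DifferentiableAt ℝ (fderiv ℝ (M j)) y :=
      ((hMd j).fderiv_right (m := ∞) (by simp)).differentiable (by simp) y
    have := (hd.hasFDerivAt.clm_apply (hasFDerivAt_const (e k) y)).fderiv
    simp [this]
  -- Both fluxes equal integrals of mixed second derivatives over the interior, which agree by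
  -- symmetry.
  have hsymm : ∀ j, ∫ y, (fderiv ℝ (M j) y (e i) * inner ℝ (e j) (outerNormal E y)) ∂(bdryMeasure E)
      - ∫ y, (fderiv ℝ (M j) y (e j) * inner ℝ (e i) (outerNormal E y)) ∂(bdryMeasure E) = 0 := by
    intro j
    rw [hflux, hflux, sub_eq_zero]
    refine integral_congr_ae (ae_of_all _ fun y => ?_)
    exact ((hMd j).contDiffAt.isSymmSndFDerivAt
      (by
      rw [minSmoothness_of_isRCLikeNormedField]; exact WithTop.coe_le_coe.2 le_top)).eq _ _
  have hint : ∀ j k l, Integrable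
      (fun y => fderiv ℝ (M j) y (e k) * inner ℝ (e l) (outerNormal E y)) (bdryMeasure E) := by
    intro j k l
    refine integrable_of_support_compact hE hζc ((contDiff_fderiv_apply (hMd j)
      (e k)).continuous.continuousOn.mul
        (continuousOn_const.inner hE.continuousOn_outerNormal)) fun y _ hy => ?_
    have : fderiv ℝ (M j) y (e k) = 0 := image_eq_zero_of_notMem_tsupport
      (f := fun y => fderiv ℝ (M j) y (e k))
      fun h => hy (hMs j (tsupport_fderiv_apply_subset _ _ h))
    rw [this, zero_mul]
  have hsum : ∫ y, (∑ j, (fderiv ℝ (M j) y (e i) * inner ℝ (e j) (outerNormal E y) -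
      fderiv ℝ (M j) y (e j) * inner ℝ (e i) (outerNormal E y))) ∂(bdryMeasure E) = 0 := by
    rw [integral_finsetSum (f := fun j y => fderiv ℝ (M j) y (e i) * inner ℝ (e j) (outerNormal E y)
      - fderiv ℝ (M j) y (e j) * inner ℝ (e i) (outerNormal E y)) _
      fun j _ => (hint j i j).sub (hint j j i)]
    refine Finset.sum_eq_zero fun j _ => ?_
    rw [integral_sub (hint j i j) (hint j j i), hsymm]
  rw [← neg_eq_zero, ← integral_neg, ← hsum]
  -- Pointwise on the boundary, `∑ⱼ (∂ᵢMⱼ νⱼ - ∂ⱼMⱼ νᵢ)` equals `∂ᵢζ - (∂_νζ) νᵢ - ζ H νᵢ`, by `|N|²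
  -- = 1` and its derivative. This is minus the integrand of the claim.
  refine setIntegral_congr_fun isClosed_frontier.measurableSet fun y hy => ?_
  by_cases hyU : y ∈ U
  · have hNd : DifferentiableAt ℝ N y :=
      (hN.contDiffAt (hU.mem_nhds hyU)).differentiableAt (by simp)
    have hMf : ∀ j (v : E3), fderiv ℝ (M j) y v =
        ζ y * fderiv ℝ N y v j + fderiv ℝ ζ y v * N y j := by
      intro j v
      have hNj : HasFDerivAt (fun y => N y j)
          ((EuclideanSpace.proj (𝕜 := ℝ) j).comp (fderiv ℝ N y)) y :=
        (EuclideanSpace.proj (𝕜 := ℝ) j).hasFDerivAt.comp y hNd.hasFDerivAt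
      have : fderiv ℝ (M j) y = _ := ((hζ.differentiable (by simp) y).hasFDerivAt.mul hNj).fderiv
      rw [this]
      simp [mul_comm]
    have hnn : ∑ j, N y j * N y j = 1 := by
      have h3 := h1 y hyU
      rw [EuclideanSpace.norm_eq, Real.sqrt_eq_one] at h3
      simpa [sq] using h3
    have horth : ∑ j, fderiv ℝ N y (e i) j * N y j = 0 := by
      have hc : (fun z => ‖N z‖ ^ 2) =ᶠ[𝓝 y] fun _ => (1 : ℝ) := by
        filter_upwards [hU.mem_nhds hyU] with z hz
        rw [h1 z hz]; norm_num
      have h4 := hNd.hasFDerivAt.norm_sq.unique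
        ((hasFDerivAt_const (1 : ℝ) y).congr_of_eventuallyEq hc)
      have h5 := DFunLike.congr_fun h4 (e i)
      simp only [smul_apply, ContinuousLinearMap.comp_apply, zero_apply,
        innerSL_apply_apply, PiLp.inner_apply] at h5
      simpa [mul_comm] using h5
    have hgr : ∑ j, fderiv ℝ ζ y (e j) * N y j = inner ℝ (∇ ζ y) (N y) := by
      rw [inner_gradient]
      have hw : N y = ∑ j, N y j • e j := by
        have := (EuclideanSpace.basisFun (Fin 3) ℝ).sum_repr (N y)
        simpa [he] using this.symm
      conv_rhs => rw [hw]
      simp [map_sum, mul_comm]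
    have hgi : (∇ ζ y) i = fderiv ℝ ζ y (e i) := by
      rw [← inner_gradient, he, inner_single_one_right]
    have hin : ∀ j, inner ℝ (e j) (N y) = N y j := fun j => inner_single_one_left _ _
    simp only [hE.meanCurv_eq hU hN h1 h2 hyU hy, h2 y hyU hy, hMf, hin, tangPart, PiLp.sub_apply,
      PiLp.smul_apply, smul_eq_mul, hgi, ← hgr]
    rw [Finset.sum_sub_distrib]
    have e1 : ∑ j, (ζ y * fderiv ℝ N y (e i) j + fderiv ℝ ζ y (e i) * N y j) * N y j =
        fderiv ℝ ζ y (e i) := by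
      calc _ = ζ y * ∑ j, fderiv ℝ N y (e i) j * N y j +
            fderiv ℝ ζ y (e i) * ∑ j, N y j * N y j := by
            rw [Finset.mul_sum, Finset.mul_sum, ← Finset.sum_add_distrib]
            exact Finset.sum_congr rfl fun j _ => by ring
        _ = _ := by rw [horth, hnn]; ring
    have e2 : ∑ j, (ζ y * fderiv ℝ N y (e j) j + fderiv ℝ ζ y (e j) * N y j) * N y i =
        ζ y * (∑ j, fderiv ℝ N y (e j) j) * N y i + (∑ j, fderiv ℝ ζ y (e j) * N y j) * N y i := by
      rw [← Finset.sum_mul, Finset.sum_add_distrib, ← Finset.mul_sum]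
      ring
    rw [e1, e2]
    ring
  · have hyζ : y ∉ tsupport ζ := fun h => hyU (hs h).2
    have hz1 : ζ y = 0 := image_eq_zero_of_notMem_tsupport hyζ
    have hz2 : fderiv ℝ ζ y = 0 :=
      image_eq_zero_of_notMem_tsupport fun h => hyζ (tsupport_fderiv_subset ℝ h)
    have hz3 : ∀ j, fderiv ℝ (M j) y = 0 := fun j =>
      image_eq_zero_of_notMem_tsupport fun h => hyζ (hMs j (tsupport_fderiv_subset ℝ h))
    simp [hz1, hz2, hz3, gradient, tangPart]

/-! ### Periodic integration -/

/-- The integer lattice acts on `ℝ³` by translations. -/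
instance latticeAction : AddAction (Fin 3 → ℤ) E3 where
  vadd k x := x + latticeVec k
  zero_vadd x := by change x + latticeVec 0 = x; rw [latticeVec_zero, add_zero]
  add_vadd k l x := by
    change x + latticeVec (k + l) = (x + latticeVec l) + latticeVec k
    rw [latticeVec_add]; abel

theorem lattice_vadd_def (k : Fin 3 → ℤ) (x : E3) : k +ᵥ x = x + latticeVec k := rfl

instance : MeasurableConstVAdd (Fin 3 → ℤ) E3 where
  measurable_const_vadd k := by
    change Measurable fun x : E3 => x + latticeVec k
    fun_prop

/-- A measure invariant under the lattice. -/
def IsLatticeInvariant (μ : Measure E3) : Prop :=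
  ∀ k : Fin 3 → ℤ, MeasurePreserving (fun x => x + latticeVec k) μ μ

theorem isLatticeInvariant_restrict {μ : Measure E3} (h : IsLatticeInvariant μ) {S : Set E3}
    (hS : MeasurableSet S) (hp : IsPeriodicSet S) : IsLatticeInvariant (μ.restrict S) := by
  intro k
  have h1 := (h k).restrict_preimage hS
  rwa [hp.preimage_eq k] at h1

theorem isLatticeInvariant_volume : IsLatticeInvariant volume := fun k =>
  measurePreserving_add_right volume (latticeVec k)

theorem isLatticeInvariant_hausdorff : IsLatticeInvariant μHE[2] := by
  intro k
  exact measurePreserving_add_right μHE[2] (latticeVec k)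

theorem isLatticeInvariant_bdryMeasure {E : Set E3} (hp : IsPeriodicSet E) :
    IsLatticeInvariant (bdryMeasure E) :=
  isLatticeInvariant_restrict isLatticeInvariant_hausdorff isClosed_frontier.measurableSet
    hp.frontier

theorem measurableSet_unitCell : MeasurableSet unitCell := by
  have : unitCell = ⋂ i : Fin 3, (fun x : E3 => x i) ⁻¹' Set.Ico (0 : ℝ) 1 := by
    ext x; simp [unitCell]
  rw [this]
  exact MeasurableSet.iInter fun i =>
    (EuclideanSpace.proj (𝕜 := ℝ) i).continuous.measurable measurableSet_Ico

theorem existsUnique_unitCell (x : E3) : ∃! k : Fin 3 → ℤ, x + latticeVec k ∈ unitCell := by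
  refine ⟨fun i => -⌊x i⌋, fun i => ?_, fun k hk => ?_⟩
  · simp only [PiLp.add_apply, latticeVec_apply, Int.cast_neg]
    exact ⟨by linarith [Int.floor_le (x i)], by linarith [Int.lt_floor_add_one (x i)]⟩
  · funext i
    have h1 := hk i
    simp only [PiLp.add_apply, latticeVec_apply, Set.mem_Ico] at h1
    have : ⌊x i⌋ = -k i := by
      rw [Int.floor_eq_iff]; push_cast
      constructor <;> linarith [h1.1, h1.2]
    omega

open scoped Pointwise in
/-- Fundamental domains for the lattice with respect to a measure carried by `S`. -/
theorem isAddFundamentalDomain {μ : Measure E3} {S D : Set E3} (hS : MeasurableSet S)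
    (hD : MeasurableSet D) (h : ∀ x ∈ S, ∃! k : Fin 3 → ℤ, x + latticeVec k ∈ D) :
    IsAddFundamentalDomain (Fin 3 → ℤ) D (μ.restrict S) where
  nullMeasurableSet := hD.nullMeasurableSet
  ae_covers := by
    filter_upwards [ae_restrict_mem hS] with x hx
    exact (h x hx).exists
  aedisjoint := by
    intro k l hkl
    rw [Function.onFun, AEDisjoint, Measure.restrict_apply₀']
    · have : (k +ᵥ D) ∩ (l +ᵥ D) ∩ S = ∅ := by
        rw [Set.eq_empty_iff_forall_notMem]
        rintro x ⟨⟨⟨a, ha, hax⟩, ⟨b, hb, hbx⟩⟩, hxS⟩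
        have h1 : x + latticeVec (-k) ∈ D := by
          rw [← hax]
          simpa [lattice_vadd_def, latticeVec_neg] using ha
        have h2 : x + latticeVec (-l) ∈ D := by
          rw [← hbx]
          simpa [lattice_vadd_def, latticeVec_neg] using hb
        exact hkl (neg_injective ((h x hxS).unique h1 h2))
      rw [this, measure_empty]
    · exact hS.nullMeasurableSet

theorem vaddInvariant {μ : Measure E3} (h : IsLatticeInvariant μ) :
    VAddInvariantMeasure (Fin 3 → ℤ) E3 μ where
  measure_preimage_vadd k _ hs := (h k).measure_preimage hs.nullMeasurableSet

theorem surfMeasure_eq (E : Set E3) : surfMeasure E = (bdryMeasure E).restrict unitCell := by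
  rw [surfMeasure, bdryMeasure, Measure.restrict_restrict measurableSet_unitCell, Set.inter_comm]

section Domain

variable {E D : Set E3}

theorem indicator_periodic {α : Type*} [Zero α] (hp : IsPeriodicSet E) {f : E3 → α}
    (hf : IsPeriodicOnBdry E f) (k : Fin 3 → ℤ) (x : E3) :
    (frontier E).indicator f (k +ᵥ x) = (frontier E).indicator f x := by
  rw [lattice_vadd_def]
  by_cases hx : x ∈ frontier E
  · rw [Set.indicator_of_mem hx, Set.indicator_of_mem ((hp.frontier k x).2 hx), hf k x hx]
  · rw [Set.indicator_of_notMem hx, Set.indicator_of_notMem fun h => hx ((hp.frontier k x).1 h)]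

/-- Any set meeting each lattice orbit in the boundary exactly once may replace the unit cell; below
it will be the image of the cell under a deformation. The function is cut off to the boundary
because invariance is known only there. -/
theorem setIntegral_domain (hp : IsPeriodicSet E) (hD : MeasurableSet D)
    (h : ∀ x ∈ frontier E, ∃! k : Fin 3 → ℤ, x + latticeVec k ∈ D) {V : Type*}
    [NormedAddCommGroup V] [NormedSpace ℝ V] {f : E3 → V} (hf : IsPeriodicOnBdry E f) :
    ∫ x in D, f x ∂(bdryMeasure E) = ∫ x, f x ∂(surfMeasure E) := by
  have := vaddInvariant (isLatticeInvariant_bdryMeasure hp)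
  have hfm := isClosed_frontier (s := E) |>.measurableSet
  have e := IsAddFundamentalDomain.setIntegral_eq (μ := bdryMeasure E)
    (isAddFundamentalDomain (μ := μHE[2]) hfm hD h)
    (isAddFundamentalDomain (μ := μHE[2]) hfm measurableSet_unitCell
      fun x _ => existsUnique_unitCell x) (f := (frontier E).indicator f) (indicator_periodic hp hf)
  have hr : ∀ A : Set E3, MeasurableSet A → ∫ x in A, (frontier E).indicator f x ∂(bdryMeasure E) =
      ∫ x in A, f x ∂(bdryMeasure E) := fun A hA => by
    refine integral_congr_ae ?_
    filter_upwards [ae_restrict_of_ae (ae_restrict_mem hfm)] with x hx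
    exact Set.indicator_of_mem hx f
  rw [surfMeasure_eq, ← hr D hD, ← hr _ measurableSet_unitCell]
  exact e

theorem setLIntegral_domain (hp : IsPeriodicSet E) (hD : MeasurableSet D)
    (h : ∀ x ∈ frontier E, ∃! k : Fin 3 → ℤ, x + latticeVec k ∈ D) {f : E3 → ℝ≥0∞}
    (hf : IsPeriodicOnBdry E f) :
    ∫⁻ x in D, f x ∂(bdryMeasure E) = ∫⁻ x, f x ∂(surfMeasure E) := by
  have := vaddInvariant (isLatticeInvariant_bdryMeasure hp)
  have hfm := isClosed_frontier (s := E) |>.measurableSet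
  have e := IsAddFundamentalDomain.setLIntegral_eq (μ := bdryMeasure E)
    (isAddFundamentalDomain (μ := μHE[2]) hfm hD h)
    (isAddFundamentalDomain (μ := μHE[2]) hfm measurableSet_unitCell
      fun x _ => existsUnique_unitCell x) ((frontier E).indicator f) (indicator_periodic hp hf)
  have hr : ∀ A : Set E3, MeasurableSet A → ∫⁻ x in A, (frontier E).indicator f x ∂(bdryMeasure E) =
      ∫⁻ x in A, f x ∂(bdryMeasure E) := fun A hA => by
    refine lintegral_congr_ae ?_
    filter_upwards [ae_restrict_of_ae (ae_restrict_mem hfm)] with x hx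
    exact Set.indicator_of_mem hx f
  rw [surfMeasure_eq, ← hr D hD, ← hr _ measurableSet_unitCell]
  exact e

end Domain

/-- The translated unit cell. -/
def cellAt (k : Fin 3 → ℤ) : Set E3 := (fun x => x + latticeVec (-k)) ⁻¹' unitCell

theorem measurableSet_cellAt (k : Fin 3 → ℤ) : MeasurableSet (cellAt k) :=
  (by fun_prop : Measurable fun x : E3 => x + latticeVec (-k)) measurableSet_unitCell

theorem mem_cellAt {k : Fin 3 → ℤ} {x : E3} : x ∈ cellAt k ↔ ∀ i, ⌊x i⌋ = k i := by
  simp only [cellAt, unitCell, Set.mem_preimage, Set.mem_ofPred_eq, PiLp.add_apply,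
    latticeVec_apply, Pi.neg_apply, Int.cast_neg, Set.mem_Ico]
  refine forall_congr' fun i => ?_
  rw [Int.floor_eq_iff]
  constructor <;> rintro ⟨h1, h2⟩ <;> constructor <;> linarith

theorem disjoint_cellAt {k l : Fin 3 → ℤ} (h : k ≠ l) : Disjoint (cellAt k) (cellAt l) := by
  rw [Set.disjoint_left]
  intro x hk hl
  exact h (funext fun i => (mem_cellAt.1 hk i).symm.trans (mem_cellAt.1 hl i))

theorem setIntegral_cellAt {μ : Measure E3} (hμ : IsLatticeInvariant μ) {V : Type*}
    [NormedAddCommGroup V] [NormedSpace ℝ V] (f : E3 → V) (k : Fin 3 → ℤ) :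
    ∫ x in cellAt k, f x ∂μ = ∫ x in unitCell, f (x + latticeVec k) ∂μ := by
  have he : MeasurableEmbedding fun x : E3 => x + latticeVec k :=
    (MeasurableEquiv.addRight (latticeVec k)).measurableEmbedding
  rw [← (hμ k).setIntegral_preimage_emb he]
  congr 2
  ext x
  simp [cellAt, latticeVec_neg]

theorem setLIntegral_cellAt {μ : Measure E3} (hμ : IsLatticeInvariant μ) (f : E3 → ℝ≥0∞)
    (k : Fin 3 → ℤ) :
    ∫⁻ x in cellAt k, f x ∂μ = ∫⁻ x in unitCell, f (x + latticeVec k) ∂μ := by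
  have he : MeasurableEmbedding fun x : E3 => x + latticeVec k :=
    (MeasurableEquiv.addRight (latticeVec k)).measurableEmbedding
  rw [← (hμ k).setLIntegral_comp_preimage_emb he]
  congr 2
  ext x
  simp [cellAt, latticeVec_neg]

/-- The lattice points with coordinates in `[-m, m]`. -/
def latticeBox (m : ℕ) : Finset (Fin 3 → ℤ) := Fintype.piFinset fun _ => Finset.Icc (-m : ℤ) m

theorem mem_latticeBox {m : ℕ} {k : Fin 3 → ℤ} :
    k ∈ latticeBox m ↔ ∀ i, -(m : ℤ) ≤ k i ∧ k i ≤ m := by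
  simp [latticeBox, Fintype.mem_piFinset]

theorem mem_iUnion_cellAt {m : ℕ} {x : E3} (hx : ∀ i, |x i| ≤ m) :
    x ∈ ⋃ k ∈ latticeBox m, cellAt k := by
  simp only [Set.mem_iUnion]
  refine ⟨fun i => ⌊x i⌋, mem_latticeBox.2 fun i => ⟨?_, ?_⟩, mem_cellAt.2 fun i => rfl⟩
  · rw [Int.le_floor]; push_cast; exact (abs_le.1 (hx i)).1
  · have := Int.floor_le (x i)
    have h2 : ((⌊x i⌋ : ℤ) : ℝ) ≤ ((m : ℤ) : ℝ) := by
      rw [Int.cast_natCast]; exact this.trans (abs_le.1 (hx i)).2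
    exact Int.cast_le.1 h2

theorem abs_apply_le_norm (x : E3) (i : Fin 3) : |x i| ≤ ‖x‖ := by
  simpa using PiLp.norm_apply_le x i

/-- Integrals over bounded pieces are controlled by integrals over the torus. -/
theorem exists_lintegral_le_of_isBounded {P : Set E3} (hP : Bornology.IsBounded P) :
    ∃ C : ℝ≥0∞, C ≠ ⊤ ∧ ∀ E : Set E3, IsPeriodicSet E → ∀ f : E3 → ℝ≥0∞, IsPeriodicOnBdry E f →
      ∫⁻ x in P, f x ∂(bdryMeasure E) ≤ C * ∫⁻ x, f x ∂(surfMeasure E) := by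
  obtain ⟨R, hR⟩ := hP.exists_norm_le
  obtain ⟨m, hm⟩ := exists_nat_ge R
  refine ⟨(latticeBox m).card, by simp, fun E hp f hf => ?_⟩
  have hsub : P ⊆ ⋃ k ∈ latticeBox m, cellAt k := fun x hx =>
    mem_iUnion_cellAt fun i => (abs_apply_le_norm x i).trans ((hR x hx).trans hm)
  calc ∫⁻ x in P, f x ∂(bdryMeasure E)
      ≤ ∫⁻ x in ⋃ k ∈ latticeBox m, cellAt k, f x ∂(bdryMeasure E) := lintegral_mono_set hsub
    _ = ∑ k ∈ latticeBox m, ∫⁻ x in cellAt k, f x ∂(bdryMeasure E) :=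
        lintegral_biUnion_finset (fun k _ l _ hkl => disjoint_cellAt hkl)
          (fun k _ => measurableSet_cellAt k) f
    _ = ∑ k ∈ latticeBox m, ∫⁻ x, f x ∂(surfMeasure E) := by
        refine Finset.sum_congr rfl fun k _ => ?_
        rw [setLIntegral_cellAt (isLatticeInvariant_bdryMeasure hp), surfMeasure_eq]
        refine lintegral_congr_ae ?_
        filter_upwards [ae_restrict_of_ae
          (ae_restrict_mem (isClosed_frontier (s := E)).measurableSet)] with x hx
        exact hf k x hx
    _ = _ := by rw [Finset.sum_const, nsmul_eq_mul]

theorem integral_eq_sum_cell {μ : Measure E3} (hμ : IsLatticeInvariant μ) {g : E3 → ℝ}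
    (hg : Integrable g μ) {m : ℕ} (h0 : ∀ x, g x ≠ 0 → ∀ i, |x i| ≤ m) :
    ∫ x, g x ∂μ = ∑ k ∈ latticeBox m, ∫ x in unitCell, g (x + latticeVec k) ∂μ := by
  have h1 : ∫ x, g x ∂μ = ∫ x in ⋃ k ∈ latticeBox m, cellAt k, g x ∂μ :=
    (setIntegral_eq_integral_of_forall_compl_eq_zero fun x hx => by
      by_contra hne
      exact hx (mem_iUnion_cellAt (h0 x hne))).symm
  rw [h1, integral_biUnion_finset _ (fun k _ => measurableSet_cellAt k)
    (fun k _ l _ hkl => disjoint_cellAt hkl) fun k _ => hg.integrableOn]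
  exact Finset.sum_congr rfl fun k _ => setIntegral_cellAt hμ g k

/-! ### A periodic partition of unity -/

/-- The one-dimensional bump of a partition of unity at scale `1 / M`. -/
def bump (M : ℕ) (j : ℕ) (t : ℝ) : ℝ :=
  Real.smoothTransition (M * t - j + 1) - Real.smoothTransition (M * t - j)

theorem bump_ne_zero {M j : ℕ} {t : ℝ} (h : bump M j t ≠ 0) : |M * t - j| ≤ 1 := by
  by_contra hc
  rw [abs_le, not_and_or, not_le, not_le] at hc
  refine h ?_
  rcases hc with hc | hc
  · rw [bump, Real.smoothTransition.zero_of_nonpos (by linarith),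
      Real.smoothTransition.zero_of_nonpos (by linarith), sub_zero]
  · rw [bump, Real.smoothTransition.one_of_one_le (by linarith),
      Real.smoothTransition.one_of_one_le (by linarith), sub_self]

theorem contDiff_bump (M j : ℕ) : ContDiff ℝ ∞ (bump M j) :=
  (Real.smoothTransition.contDiff.comp (by fun_prop)).sub
    (Real.smoothTransition.contDiff.comp (by fun_prop))

/-- The sum over `j` telescopes to `τ u - τ (u - 1)`, and the sum over integer shifts telescopes
again to `τ (t + 3) - τ (t - 4) = 1 - 0`. An open interval containing `[0, 1]` is used so that the
identity can be differentiated on the cell. -/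
theorem sum_bump {M : ℕ} (hM : 0 < M) {t : ℝ} (h1 : -1 < t) (h2 : t < 2) :
    ∑ q ∈ Finset.Icc (-((3 : ℕ) : ℤ)) (3 : ℕ), ∑ j ∈ Finset.range M, bump M j (t + q) = 1 := by
  set τ : ℝ → ℝ := fun u => Real.smoothTransition (M * u + 1) with hτ
  have hM' : (1 : ℝ) ≤ M := by exact_mod_cast hM
  have hin : ∀ u : ℝ, ∑ j ∈ Finset.range M, bump M j u = τ u - τ (u - 1) := by
    intro u
    have h := Finset.sum_range_sub' (fun j : ℕ => Real.smoothTransition (M * u - j + 1)) M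
    calc _ = ∑ j ∈ Finset.range M, (Real.smoothTransition (M * u - (j : ℕ) + 1) -
          Real.smoothTransition (M * u - ((j + 1 : ℕ) : ℝ) + 1)) := by
          refine Finset.sum_congr rfl fun j _ => ?_
          rw [bump]; congr 2; push_cast; ring
      _ = _ := by
          rw [h, hτ]; simp only [Nat.cast_zero, sub_zero]; congr 2; ring
  simp_rw [hin]
  have hI : Finset.Icc (-((3 : ℕ) : ℤ)) (3 : ℕ) = {-3, -2, -1, 0, 1, 2, 3} := by decide
  have e1 : τ (t + 3) = 1 := Real.smoothTransition.one_of_one_le (by nlinarith)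
  have e2 : τ (t - 4) = 0 := Real.smoothTransition.zero_of_nonpos (by nlinarith)
  rw [hI]
  simp only [Finset.mem_insert, Finset.mem_singleton, Finset.sum_insert, Finset.sum_singleton,
    Int.reduceNeg, Int.reduceEq, or_self, not_false_eq_true, Int.cast_neg,
    Int.cast_ofNat, Int.cast_one, Int.cast_zero]
  have r1 : t + -3 - 1 = t - 4 := by ring
  have r2 : t + -2 - 1 = t + -3 := by ring
  have r3 : t + -1 - 1 = t + -2 := by ring
  have r4 : t + 0 - 1 = t + -1 := by ring
  have r5 : t + 1 - 1 = t + 0 := by ring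
  have r6 : t + 2 - 1 = t + 1 := by ring
  have r7 : t + 3 - 1 = t + 2 := by ring
  rw [r1, r2, r3, r4, r5, r6, r7, e1, e2]
  ring

/-- The bumps of the periodic partition of unity. -/
def bump3 (M : ℕ) (j : Fin 3 → ℕ) (x : E3) : ℝ := ∏ i, bump M (j i) (x i)

theorem contDiff_bump3 (M : ℕ) (j : Fin 3 → ℕ) : ContDiff ℝ ∞ (bump3 M j) :=
  contDiff_prod fun i _ => (contDiff_bump M (j i)).comp (EuclideanSpace.proj (𝕜 := ℝ) i).contDiff

theorem bump3_ne_zero {M : ℕ} {j : Fin 3 → ℕ} {x : E3} (h : bump3 M j x ≠ 0) (i : Fin 3) :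
    |M * x i - j i| ≤ 1 :=
  bump_ne_zero fun h0 => h (Finset.prod_eq_zero (Finset.mem_univ i) h0)

theorem sum_bump3 {M : ℕ} (hM : 0 < M) {x : E3} (hx : ∀ i, -1 < x i ∧ x i < 2) :
    ∑ q ∈ latticeBox 3, ∑ j ∈ Fintype.piFinset fun _ : Fin 3 => Finset.range M,
      bump3 M j (x + latticeVec q) = 1 := by
  have h1 : ∀ q : Fin 3 → ℤ, ∑ j ∈ Fintype.piFinset fun _ : Fin 3 => Finset.range M,
      bump3 M j (x + latticeVec q) = ∏ i, ∑ n ∈ Finset.range M, bump M n (x i + q i) := by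
    intro q
    rw [Finset.prod_univ_sum]
    rfl
  simp_rw [h1]
  rw [latticeBox, ← Finset.prod_univ_sum (fun _ => Finset.Icc (-((3 : ℕ) : ℤ)) (3 : ℕ))
    (fun i (q : ℤ) => ∑ n ∈ Finset.range M, bump M n (x i + q))]
  exact Finset.prod_eq_one fun i _ => sum_bump hM (hx i).1 (hx i).2

/-! ### From local to global divergence theorems -/

theorem isCompact_closedCell : IsCompact {x : E3 | ∀ i, x i ∈ Set.Icc (0 : ℝ) 1} := by
  have h1 : {x : E3 | ∀ i, x i ∈ Set.Icc (0 : ℝ) 1} =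
      (EuclideanSpace.equiv (Fin 3) ℝ) ⁻¹' (Set.univ.pi fun _ => Set.Icc (0 : ℝ) 1) := by
    ext x
    simp only [Set.mem_preimage, Set.mem_univ_pi]
    rfl
  rw [h1]
  exact (EuclideanSpace.equiv (Fin 3) ℝ).toHomeomorph.isCompact_preimage.2
    (isCompact_univ_pi fun _ => isCompact_Icc)

theorem norm_le_of_abs_apply_le {x : E3} {c : ℝ} (hc : 0 ≤ c) (h : ∀ i, |x i| ≤ c) :
    ‖x‖ ≤ 2 * c := by
  rw [EuclideanSpace.norm_eq, Real.sqrt_le_left (by positivity), Fin.sum_univ_three]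
  have h' : ∀ i, ‖x i‖ ^ 2 ≤ c ^ 2 := fun i => by
    rw [Real.norm_eq_abs]; exact pow_le_pow_left₀ (abs_nonneg _) (h i) 2
  nlinarith [h' 0, h' 1, h' 2]

/-- A first-order identity valid for test functions with small support and for periodic data can be
integrated over the torus. -/
theorem integral_unitCell_eq_zero {μ₁ μ₂ : Measure E3} [IsLocallyFiniteMeasure μ₁]
    [IsLocallyFiniteMeasure μ₂] (hμ₁ : IsLatticeInvariant μ₁) (hμ₂ : IsLatticeInvariant μ₂)
    {a : E3 → ℝ} {b : Fin 3 → E3 → ℝ} (ha : LocallyIntegrable a μ₁)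
    (hb : ∀ i, LocallyIntegrable (b i) μ₂)
    (hap : ∀ k : Fin 3 → ℤ, ∀ᵐ x ∂μ₁, a (x + latticeVec k) = a x)
    (hbp : ∀ i, ∀ k : Fin 3 → ℤ, ∀ᵐ x ∂μ₂, b i (x + latticeVec k) = b i x)
    (h : ∀ x, ∃ V ∈ 𝓝 x, ∀ ζ : E3 → ℝ, ContDiff ℝ ∞ ζ → HasCompactSupport ζ → tsupport ζ ⊆ V →
      ∫ y, ζ y * a y ∂μ₁ = ∑ i, ∫ y, fderiv ℝ ζ y (EuclideanSpace.single i 1) * b i y ∂μ₂) :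
    ∫ y in unitCell, a y ∂μ₁ = 0 := by
  choose V hV hVe using h
  -- A Lebesgue number of the closed cell: every ball of radius `δ` centred in it lies in one of the
  -- neighbourhoods `V x`.
  obtain ⟨δ, hδ, hball⟩ := lebesgue_number_lemma_of_metric (c := fun x => interior (V x))
    isCompact_closedCell (fun _ => isOpen_interior)
    (fun x _ => Set.mem_iUnion.2 ⟨x, mem_interior_iff_mem_nhds.2 (hV x)⟩)
  -- A bump at scale `1 / M` is supported within coordinate distance `1 / M` of its centre, hence
  -- within distance `2 / M < δ`.
  obtain ⟨M, hM⟩ := exists_nat_gt (2 / δ)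
  have hM0 : (0 : ℝ) < M := lt_of_le_of_lt (by positivity) hM
  have hMn : 0 < M := by exact_mod_cast hM0
  set J : Finset (Fin 3 → ℕ) := Fintype.piFinset fun _ : Fin 3 => Finset.range M with hJ
  have hJmem : ∀ j ∈ J, ∀ i, (j i : ℝ) + 1 ≤ M := fun j hj i => by
    have := Finset.mem_range.1 (Fintype.mem_piFinset.1 hj i)
    exact_mod_cast this
  -- supports of the bumps
  have hsupp : ∀ j ∈ J, ∃ x, tsupport (bump3 M j) ⊆ V x := by
    intro j hj
    set c : E3 := WithLp.toLp 2 fun i => (j i : ℝ) / M with hc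
    have hcc : ∀ i, c i = (j i : ℝ) / M := fun i => rfl
    obtain ⟨x, hx⟩ := hball c (by
      intro i
      rw [hcc]
      exact ⟨by positivity, (div_le_one hM0).2 (by linarith [hJmem j hj i])⟩)
    refine ⟨x, (closure_minimal (fun y hy => ?_) Metric.isClosed_closedBall).trans
      ((Metric.closedBall_subset_ball (ε₁ := 2 * (1 / M)) ?_).trans (hx.trans interior_subset))⟩
    · rw [Metric.mem_closedBall, dist_eq_norm]
      refine norm_le_of_abs_apply_le (by positivity) fun i => ?_
      have := bump3_ne_zero hy i
      rw [PiLp.sub_apply, hcc]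
      have h2 : y i - (j i : ℝ) / M = (1 / M) * (M * y i - j i) := by field_simp
      rw [h2, abs_mul, abs_of_pos (by positivity)]
      exact mul_le_of_le_one_right (by positivity) this
    · rw [mul_one_div, div_lt_iff₀ hM0]
      rwa [div_lt_iff₀ hδ, mul_comm] at hM
  have hbd : ∀ j ∈ J, ∀ y, bump3 M j y ≠ 0 → ∀ i, |y i| ≤ (3 : ℕ) := by
    intro j hj y hy i
    have h1 := abs_le.1 (bump3_ne_zero hy i)
    have h2 := hJmem j hj i
    have hM1 : (1 : ℝ) ≤ M := by exact_mod_cast hMn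
    have h3 : (0 : ℝ) ≤ j i := Nat.cast_nonneg _
    rw [abs_le]; push_cast
    constructor <;> nlinarith
  have hcompact : ∀ j ∈ J, HasCompactSupport (bump3 M j) := fun j hj =>
    HasCompactSupport.intro (K := Metric.closedBall 0 (2 * (3 : ℕ)))
      (isCompact_closedBall (0 : E3) (2 * (3 : ℕ))) fun y hy => by
      by_contra hne
      refine hy ?_
      rw [mem_closedBall_zero_iff]
      exact norm_le_of_abs_apply_le (by positivity) (hbd j hj y hne)
  have hbd' : ∀ j ∈ J, ∀ i y, fderiv ℝ (bump3 M j) y (EuclideanSpace.single i 1) ≠ 0 →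
      ∀ l, |y l| ≤ (3 : ℕ) := by
    intro j hj i y hy
    have hcl : IsClosed {y : E3 | ∀ l, |y l| ≤ (3 : ℕ)} := by
      have : {y : E3 | ∀ l, |y l| ≤ (3 : ℕ)} = ⋂ l : Fin 3, {y : E3 | |y l| ≤ (3 : ℕ)} := by
        ext; simp
      rw [this]
      exact isClosed_iInter fun l => isClosed_le (by fun_prop) continuous_const
    have h1 : tsupport (bump3 M j) ⊆ {y : E3 | ∀ l, |y l| ≤ (3 : ℕ)} :=
      closure_minimal (fun y hy => hbd j hj y hy) hcl
    refine h1 (tsupport_fderiv_apply_subset _ _ (subset_closure hy))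
  -- integrability
  have hIa : ∀ j ∈ J, Integrable (fun y => bump3 M j y * a y) μ₁ := fun j hj =>
    ha.integrable_smul_left_of_hasCompactSupport (contDiff_bump3 M j).continuous (hcompact j hj)
  have hIb : ∀ j ∈ J, ∀ i, Integrable
      (fun y => fderiv ℝ (bump3 M j) y (EuclideanSpace.single i 1) * b i y) μ₂ := fun j hj i =>
    (hb i).integrable_smul_left_of_hasCompactSupport
      (contDiff_fderiv_apply (contDiff_bump3 M j) _).continuous
      (hasCompactSupport_fderiv_apply (hcompact j hj) _)
  have hshift : ∀ {μ : Measure E3}, IsLatticeInvariant μ → ∀ {g : E3 → ℝ}, Integrable g μ →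
      ∀ k, IntegrableOn (fun y => g (y + latticeVec k)) unitCell μ := fun hμ g hg k =>
    ((hμ k).integrable_comp_of_integrable hg).integrableOn
  have hcell : ∀ y ∈ unitCell, ∀ i, -1 < y i ∧ y i < 2 := fun y hy i =>
    ⟨by linarith [(hy i).1], by linarith [(hy i).2]⟩
  have hrestr : ∀ {μ : Measure E3} {c : E3 → ℝ}, (∀ k : Fin 3 → ℤ, ∀ᵐ x ∂μ,
      c (x + latticeVec k) = c x) → ∀ᵐ x ∂(μ.restrict unitCell), ∀ k : Fin 3 → ℤ,
      c (x + latticeVec k) = c x := fun hc => ae_restrict_of_ae (ae_all_iff.2 hc)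
  -- the two sides of the summed identity
  have hA : ∑ j ∈ J, ∫ y, bump3 M j y * a y ∂μ₁ = ∫ y in unitCell, a y ∂μ₁ := by
    calc _ = ∑ j ∈ J, ∑ k ∈ latticeBox 3, ∫ y in unitCell,
          bump3 M j (y + latticeVec k) * a (y + latticeVec k) ∂μ₁ :=
          Finset.sum_congr rfl fun j hj => integral_eq_sum_cell hμ₁ (hIa j hj)
            fun y hy => hbd j hj y (left_ne_zero_of_mul hy)
      _ = ∫ y in unitCell, ∑ j ∈ J, ∑ k ∈ latticeBox 3,
          bump3 M j (y + latticeVec k) * a (y + latticeVec k) ∂μ₁ := by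
          rw [integral_finsetSum _ fun j hj => integrable_finsetSum _ fun k _ =>
            hshift hμ₁ (hIa j hj) k]
          refine Finset.sum_congr rfl fun j hj => ?_
          rw [integral_finsetSum _ fun k _ => hshift hμ₁ (hIa j hj) k]
      _ = _ := by
          refine integral_congr_ae ?_
          filter_upwards [hrestr hap, ae_restrict_mem measurableSet_unitCell] with y hy hyc
          simp only [hy]
          rw [Finset.sum_comm]
          simp_rw [← Finset.sum_mul]
          rw [sum_bump3 hMn (hcell y hyc), one_mul]
  have hB : ∀ i, ∑ j ∈ J, ∫ y, fderiv ℝ (bump3 M j) y (EuclideanSpace.single i 1) * b i y ∂μ₂ =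
      0 := by
    intro i
    calc _ = ∑ j ∈ J, ∑ k ∈ latticeBox 3, ∫ y in unitCell,
          fderiv ℝ (bump3 M j) (y + latticeVec k) (EuclideanSpace.single i 1) *
            b i (y + latticeVec k) ∂μ₂ :=
          Finset.sum_congr rfl fun j hj => integral_eq_sum_cell hμ₂ (hIb j hj i)
            fun y hy => hbd' j hj i y (left_ne_zero_of_mul hy)
      _ = ∫ y in unitCell, ∑ j ∈ J, ∑ k ∈ latticeBox 3,
          fderiv ℝ (bump3 M j) (y + latticeVec k) (EuclideanSpace.single i 1) *
            b i (y + latticeVec k) ∂μ₂ := by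
          rw [integral_finsetSum _ fun j hj => integrable_finsetSum _ fun k _ =>
            hshift hμ₂ (hIb j hj i) k]
          refine Finset.sum_congr rfl fun j hj => ?_
          rw [integral_finsetSum _ fun k _ => hshift hμ₂ (hIb j hj i) k]
      _ = ∫ y in unitCell, (0 : ℝ) ∂μ₂ := by
          refine integral_congr_ae ?_
          filter_upwards [hrestr (hbp i), ae_restrict_mem measurableSet_unitCell] with y hy hyc
          simp only [hy]
          rw [Finset.sum_comm]
          simp_rw [← Finset.sum_mul]
          -- All shifted bumps add up to the constant `1` near the cell, so their derivatives cancel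
          -- and the right-hand sides sum to zero.
          have hone : (fun z : E3 => ∑ q ∈ latticeBox 3, ∑ j ∈ J, bump3 M j (z + latticeVec q))
              =ᶠ[𝓝 y] fun _ => (1 : ℝ) := by
            have ho : ∀ᶠ z : E3 in 𝓝 y, ∀ i, -1 < z i ∧ z i < 2 := by
              rw [Filter.eventually_all]
              intro i
              have hc : ContinuousAt (fun z : E3 => z i) y :=
                (EuclideanSpace.proj (𝕜 := ℝ) i).continuous.continuousAt
              exact (hc.eventually (lt_mem_nhds (hcell y hyc i).1)).and
                (hc.eventually (gt_mem_nhds (hcell y hyc i).2))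
            filter_upwards [ho] with z hz
            exact sum_bump3 hMn hz
          have hder : HasFDerivAt
              (fun z : E3 => ∑ q ∈ latticeBox 3, ∑ j ∈ J, bump3 M j (z + latticeVec q))
              (∑ q ∈ latticeBox 3, ∑ j ∈ J, fderiv ℝ (bump3 M j) (y + latticeVec q)) y := by
            refine HasFDerivAt.fun_sum fun q _ => HasFDerivAt.fun_sum fun j _ => ?_
            rw [hasFDerivAt_comp_add_right]
            exact ((contDiff_bump3 M j).differentiable (by simp) _).hasFDerivAt
          have h0 := hder.unique ((hasFDerivAt_const (1 : ℝ) y).congr_of_eventuallyEq hone)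
          have h1 := DFunLike.congr_fun h0 (EuclideanSpace.single i 1)
          simp only [sum_apply, zero_apply] at h1
          rw [h1, zero_mul]
      _ = 0 := by simp
  rw [← hA]
  calc _ = ∑ j ∈ J, ∑ i, ∫ y, fderiv ℝ (bump3 M j) y (EuclideanSpace.single i 1) * b i y ∂μ₂ := by
        refine Finset.sum_congr rfl fun j hj => ?_
        obtain ⟨x, hx⟩ := hsupp j hj
        exact hVe x _ (contDiff_bump3 M j) (hcompact j hj) hx
    _ = 0 := by
        rw [Finset.sum_comm]
        exact Finset.sum_eq_zero fun i _ => hB i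

/-! ### The divergence theorems on the torus -/

theorem sum_fderiv_single (L : E3 →L[ℝ] ℝ) (w : E3) :
    ∑ i, L (EuclideanSpace.single i 1) * w i = L w := by
  have h : w = ∑ i, w i • EuclideanSpace.single i (1 : ℝ) := by
    have := (EuclideanSpace.basisFun (Fin 3) ℝ).sum_repr w
    simpa using this.symm
  conv_rhs => rw [h]
  simp [map_sum, mul_comm]

theorem locallyIntegrable_bdry {E : Set E3} (hE : IsSmoothSet E) {f : E3 → ℝ}
    (hf : ContinuousOn f (frontier E)) : LocallyIntegrable f (bdryMeasure E) := by
  have := hE.isLocallyFiniteMeasure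
  have h1 := hf.locallyIntegrableOn (μ := bdryMeasure E) isClosed_frontier.measurableSet
  rw [locallyIntegrableOn_iff_locallyIntegrable_restrict isClosed_frontier, bdryMeasure,
    Measure.restrict_restrict isClosed_frontier.measurableSet, Set.inter_self] at h1
  exact h1

theorem ae_bdry {E : Set E3} {P : E3 → Prop} (h : ∀ x ∈ frontier E, P x) :
    ∀ᵐ x ∂(bdryMeasure E), P x := by
  filter_upwards [ae_restrict_mem (isClosed_frontier (s := E)).measurableSet] with x hx
  exact h x hx

theorem ae_surf {E : Set E3} {P : E3 → Prop} (h : ∀ x ∈ frontier E, P x) :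
    ∀ᵐ x ∂(surfMeasure E), P x := by
  rw [surfMeasure_eq]
  exact ae_restrict_of_ae (ae_bdry h)

/-- The outer normal of a subset of the torus has zero average. -/
theorem IsSmoothSet.integral_outerNormal {E : Set E3} (hE : IsSmoothSet E) (hp : IsPeriodicSet E)
    (w : E3) : ∫ x, inner ℝ w (outerNormal E x) ∂(surfMeasure E) = 0 := by
  have := hE.isLocallyFiniteMeasure
  rw [surfMeasure_eq]
  -- The local flux identity has the required form, with the constant field `w` on the interior as
  -- second datum.
  refine integral_unitCell_eq_zero (μ₂ := volume.restrict (interior E))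
    (b := fun i _ => w i) (isLatticeInvariant_bdryMeasure hp)
    (isLatticeInvariant_restrict isLatticeInvariant_volume isOpen_interior.measurableSet
      hp.interior)
    (locallyIntegrable_bdry hE (continuousOn_const.inner hE.continuousOn_outerNormal))
    (fun i => locallyIntegrable_const _) (fun k => ae_bdry fun x hx => by
      rw [hE.outerNormal_add hp hx]) (fun i k => ae_of_all _ fun x => rfl) fun x => ?_
  obtain ⟨V, hV, h⟩ := hE.flux_local x
  refine ⟨V, hV, fun ζ hζ hζc hs => ?_⟩
  rw [h ζ hζ hζc hs w, ← integral_finsetSum]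
  · simp_rw [sum_fderiv_single]
  · intro i _
    exact (((contDiff_fderiv_apply hζ _).continuous.integrable_of_hasCompactSupport
      (hasCompactSupport_fderiv_apply hζc _)).integrableOn).mul_const _

/-- A function which is locally constant on the boundary. -/
def IsLocallyConstOnBdry (E : Set E3) (χ : E3 → ℝ) : Prop :=
  ∀ x ∈ frontier E, ∀ᶠ y in 𝓝[frontier E] x, χ y = χ x

theorem IsLocallyConstOnBdry.continuousOn {E : Set E3} {χ : E3 → ℝ}
    (h : IsLocallyConstOnBdry E χ) : ContinuousOn χ (frontier E) := fun x hx =>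
  tendsto_const_nhds.congr' ((h x hx).mono fun _ hy => hy.symm)

/-- The mean curvature vector has zero average on each union of components. -/
theorem IsSmoothSet.integral_meanCurv_outerNormal {E : Set E3} (hE : IsSmoothSet E)
    (hp : IsPeriodicSet E) {χ : E3 → ℝ} (hχ : IsLocallyConstOnBdry E χ)
    (hχp : IsPeriodicOnBdry E χ) (i : Fin 3) :
    ∫ x, χ x * (meanCurv E x * outerNormal E x i) ∂(surfMeasure E) = 0 := by
  have := hE.isLocallyFiniteMeasure
  have hνi : ∀ j : Fin 3, ContinuousOn (fun y => outerNormal E y j) (frontier E) := fun j =>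
    (hE.isLocallySmooth_outerNormal j).continuousOn
  set d : Fin 3 → ℝ := fun j => if j = i then 1 else 0 with hd
  rw [surfMeasure_eq]
  -- The coefficients `δᵢⱼ - νᵢ νⱼ` are those of the projection to the tangent plane, so the sum
  -- over `j` produces the tangential derivative of `ζ`.
  refine integral_unitCell_eq_zero (μ₂ := bdryMeasure E)
    (b := fun j y => χ y * (d j - outerNormal E y j * outerNormal E y i))
    (isLatticeInvariant_bdryMeasure hp) (isLatticeInvariant_bdryMeasure hp)
    (locallyIntegrable_bdry hE (hχ.continuousOn.mul
      (hE.isLocallySmooth_meanCurv.continuousOn.mul (hνi i))))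
    (fun j => locallyIntegrable_bdry hE (hχ.continuousOn.mul
      (continuousOn_const.sub ((hνi j).mul (hνi i)))))
    (fun k => ae_bdry fun x hx => by
      rw [hE.outerNormal_add hp hx, hχp k x hx, hE.isPeriodic_meanCurv hp k x hx])
    (fun j k => ae_bdry fun x hx => by rw [hE.outerNormal_add hp hx, hχp k x hx]) fun x => ?_
  obtain ⟨V, hV, h⟩ := hE.tangential_local x
  -- On a small neighbourhood the weight `χ` is constant along the boundary and factors out of the
  -- local identity.
  have hW : ∃ W ∈ 𝓝 x, ∃ c, ∀ y ∈ W, y ∈ frontier E → χ y = c := by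
    by_cases hx : x ∈ frontier E
    · have h1 := hχ x hx
      rw [eventually_nhdsWithin_iff] at h1
      exact ⟨_, h1, χ x, fun y hy hyE => hy hyE⟩
    · exact ⟨_, isClosed_frontier.isOpen_compl.mem_nhds hx, 0, fun y hy hyE => absurd hyE hy⟩
  obtain ⟨W, hW, c, hc⟩ := hW
  refine ⟨V ∩ W, inter_mem hV hW, fun ζ hζ hζc hs => ?_⟩
  have h0 := h ζ hζ hζc (hs.trans Set.inter_subset_left) i
  have hz : ∀ y ∉ tsupport ζ, ζ y = 0 ∧ fderiv ℝ ζ y = 0 := fun y hy =>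
    ⟨image_eq_zero_of_notMem_tsupport hy,
      image_eq_zero_of_notMem_tsupport fun hh => hy (tsupport_fderiv_subset ℝ hh)⟩
  have hb : ∀ j, Integrable (fun y => fderiv ℝ ζ y (EuclideanSpace.single j 1) *
      (χ y * (d j - outerNormal E y j * outerNormal E y i))) (bdryMeasure E) := fun j =>
    integrable_of_support_compact hE hζc
      ((contDiff_fderiv_apply hζ _).continuous.continuousOn.mul (hχ.continuousOn.mul
        (continuousOn_const.sub ((hνi j).mul (hνi i))))) fun y _ hy => by simp [(hz y hy).2]
  have ha : Integrable (fun y => ζ y * (χ y * (meanCurv E y * outerNormal E y i)))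
      (bdryMeasure E) :=
    integrable_of_support_compact hE hζc (hζ.continuous.continuousOn.mul (hχ.continuousOn.mul
      (hE.isLocallySmooth_meanCurv.continuousOn.mul (hνi i)))) fun y _ hy => by simp [(hz y hy).1]
  rw [← integral_finsetSum _ fun j _ => hb j, ← sub_eq_zero,
    ← integral_sub ha (integrable_finsetSum _ fun j _ => hb j),
    ← mul_zero c, ← h0, ← integral_const_mul]
  refine integral_congr_ae (ae_bdry fun y hy => ?_)
  by_cases hyζ : y ∈ tsupport ζ
  · have hχy : χ y = c := hc y (hs hyζ).2 hy
    have e1 : ∑ j, fderiv ℝ ζ y (EuclideanSpace.single j 1) *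
        (χ y * (d j - outerNormal E y j * outerNormal E y i)) =
        c * tangPart (outerNormal E y) (∇ ζ y) i := by
      calc _ = c * (∑ j, fderiv ℝ ζ y (EuclideanSpace.single j 1) * d j -
            (∑ j, fderiv ℝ ζ y (EuclideanSpace.single j 1) * outerNormal E y j) *
              outerNormal E y i) := by
            rw [Finset.sum_mul, ← Finset.sum_sub_distrib, Finset.mul_sum, hχy]
            exact Finset.sum_congr rfl fun j _ => by ring
        _ = _ := by
            rw [sum_fderiv_single, ← inner_gradient]
            simp only [hd, mul_ite, mul_one, mul_zero, Finset.sum_ite_eq', Finset.mem_univ, if_true,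
              tangPart, PiLp.sub_apply, PiLp.smul_apply, smul_eq_mul]
            rw [← inner_gradient, inner_single_one_right]
    beta_reduce
    rw [e1, hχy]
    ring
  · simp [(hz y hyζ).1, (hz y hyζ).2, gradient, tangPart]

/-! ### Planar inequalities of Morrey and Poincaré -/

/-- This is the fundamental theorem of calculus on a segment. No continuity of the derivative is
needed: if the integral on the right is infinite there is nothing to show, and otherwise the
derivative is integrable. -/
theorem enorm_sub_le_lintegral_segment {u : E2 → ℝ} {x y : E2}
    (hu : ∀ t ∈ Set.Icc (0 : ℝ) 1, DifferentiableAt ℝ u (x + t • (y - x))) :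
    ‖u y - u x‖ₑ ≤ ‖y - x‖ₑ * ∫⁻ t in Set.Ioc (0 : ℝ) 1, ‖fderiv ℝ u (x + t • (y - x))‖ₑ := by
  rcases eq_or_ne y x with rfl | hne
  · simp
  have hyx : ‖y - x‖ₑ ≠ 0 := by simpa [sub_eq_zero] using hne
  set I := ∫⁻ t in Set.Ioc (0 : ℝ) 1, ‖fderiv ℝ u (x + t • (y - x))‖ₑ with hI
  rcases eq_or_ne I ⊤ with htop | hfin
  · rw [htop, ENNReal.mul_top hyx]; exact le_top
  have hder : ∀ t ∈ Set.uIcc (0 : ℝ) 1,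
      HasDerivAt (fun t : ℝ => u (x + t • (y - x))) (fderiv ℝ u (x + t • (y - x)) (y - x)) t := by
    intro t ht
    rw [Set.uIcc_of_le zero_le_one] at ht
    have h1 : HasDerivAt (fun t : ℝ => x + t • (y - x)) (y - x) t := by
      simpa using ((hasDerivAt_id t).smul_const (y - x)).const_add x
    exact (hu t ht).hasFDerivAt.comp_hasDerivAt t h1
  have hm : Measurable fun t : ℝ => fderiv ℝ u (x + t • (y - x)) :=
    (measurable_fderiv ℝ u).comp (by fun_prop)
  have hm' : Measurable fun t : ℝ => fderiv ℝ u (x + t • (y - x)) (y - x) :=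
    hm.apply_continuousLinearMap _
  have hle : ∀ t : ℝ, ‖fderiv ℝ u (x + t • (y - x)) (y - x)‖ₑ ≤
      ‖y - x‖ₑ * ‖fderiv ℝ u (x + t • (y - x))‖ₑ := fun t => by
    rw [mul_comm]; exact ContinuousLinearMap.le_opENorm _ _
  have hbound : ∫⁻ t in Set.Ioc (0 : ℝ) 1, ‖fderiv ℝ u (x + t • (y - x)) (y - x)‖ₑ ≤
      ‖y - x‖ₑ * I := by
    rw [hI, ← lintegral_const_mul _ hm.enorm]
    exact lintegral_mono hle
  have hint : IntervalIntegrable (fun t : ℝ => fderiv ℝ u (x + t • (y - x)) (y - x)) volume 0 1 := by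
    rw [intervalIntegrable_iff_integrableOn_Ioc_of_le zero_le_one]
    exact ⟨hm'.aestronglyMeasurable, lt_of_le_of_lt hbound
      (ENNReal.mul_lt_top enorm_lt_top hfin.lt_top)⟩
  have hftc := intervalIntegral.integral_eq_sub_of_hasDerivAt hder hint
  simp only [one_smul, add_sub_cancel, zero_smul, add_zero] at hftc
  rw [← hftc, intervalIntegral.integral_of_le zero_le_one]
  exact (enorm_integral_le_lintegral_enorm _).trans hbound

theorem ball_convexComb {a₀ x y : E2} {r t : ℝ} (hx : x ∈ Metric.ball a₀ r)
    (hy : y ∈ Metric.ball a₀ r) (ht : t ∈ Set.Icc (0 : ℝ) 1) :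
    x + t • (y - x) ∈ Metric.ball a₀ r :=
  (convex_ball a₀ r).add_smul_sub_mem hx hy ht

/-- Change of variables for a homothety, restricted to a subset of the ball. -/
theorem lintegral_homothety {S : Set E2} (hS : MeasurableSet S) (x : E2) {t : ℝ} (ht : 0 < t)
    (f : E2 → ℝ≥0∞) :
    ∫⁻ y in S, f (x + t • (y - x)) =
      ENNReal.ofReal (t ^ 2)⁻¹ * ∫⁻ y in (fun y => x + t • (y - x)) '' S, f y := by
  have hder : ∀ y ∈ S, HasFDerivWithinAt (fun y => x + t • (y - x))
      (t • ContinuousLinearMap.id ℝ E2) S y := fun y _ =>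
    ((((hasFDerivAt_id y).sub_const x).const_smul t).const_add x).hasFDerivWithinAt
  have hinj : Set.InjOn (fun y : E2 => x + t • (y - x)) S := fun y _ z _ h => by
    have h1 : t • (y - x) = t • (z - x) := add_left_cancel h
    exact sub_left_injective (smul_right_injective E2 ht.ne' h1)
  rw [lintegral_image_eq_lintegral_abs_det_fderiv_mul volume hS hder hinj]
  have hdet : (t • ContinuousLinearMap.id ℝ E2).det = t ^ 2 := by
    have : ((t • ContinuousLinearMap.id ℝ E2 : E2 →L[ℝ] E2) : E2 →ₗ[ℝ] E2) = t • LinearMap.id := rfl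
    rw [ContinuousLinearMap.det, this, LinearMap.det_smul]
    simp
  rw [hdet, abs_of_pos (by positivity), lintegral_const_mul' _ _ ENNReal.ofReal_ne_top,
    ← mul_assoc, ← ENNReal.ofReal_mul (by positivity), inv_mul_cancel₀ (by positivity),
    ENNReal.ofReal_one, one_mul]

theorem lintegral_homothety_ball_le {a₀ x : E2} {r t : ℝ} (hx : x ∈ Metric.ball a₀ r)
    (ht : 0 < t) (ht1 : t ≤ 1) (f : E2 → ℝ≥0∞) :
    ∫⁻ y in Metric.ball a₀ r, f (x + t • (y - x)) ≤
      ENNReal.ofReal (t ^ 2)⁻¹ * ∫⁻ y in Metric.ball a₀ r, f y := by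
  rw [lintegral_homothety measurableSet_ball x ht]
  gcongr
  rintro _ ⟨y, hy, rfl⟩
  exact ball_convexComb hx hy ⟨ht.le, ht1⟩

theorem enorm_sub_le_of_mem_ball {a₀ x y : E2} {r : ℝ} (hx : x ∈ Metric.ball a₀ r)
    (hy : y ∈ Metric.ball a₀ r) : ‖y - x‖ₑ ≤ ENNReal.ofReal (2 * r) := by
  rw [← ofReal_norm]
  refine ENNReal.ofReal_le_ofReal ?_
  rw [← dist_eq_norm]
  have h1 := Metric.mem_ball.1 hx
  have h2 := Metric.mem_ball.1 hy
  have h3 := dist_triangle_right y x a₀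
  linarith

/-- The Poincaré inequality on a disc, for double differences. -/
theorem poincare_ball {a₀ : E2} {r : ℝ} {u : E2 → ℝ}
    (hu : ∀ a ∈ Metric.ball a₀ r, DifferentiableAt ℝ u a) :
    ∫⁻ x in Metric.ball a₀ r, ∫⁻ y in Metric.ball a₀ r, ‖u y - u x‖ₑ ^ 2 ≤
      ENNReal.ofReal (2 * r) ^ 2 * 4 * volume (Metric.ball a₀ r) *
        ∫⁻ a in Metric.ball a₀ r, ‖fderiv ℝ u a‖ₑ ^ 2 := by
  set B := Metric.ball a₀ r with hB
  set D : E2 → ℝ≥0∞ := fun a => ‖fderiv ℝ u a‖ₑ ^ 2 with hD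
  have hDm : Measurable D := (measurable_fderiv ℝ u).enorm.pow_const 2
  have hpt : ∀ x ∈ B, ∀ y ∈ B, ‖u y - u x‖ₑ ^ 2 ≤
      ENNReal.ofReal (2 * r) ^ 2 * ∫⁻ t in Set.Ioc (0 : ℝ) 1, D (x + t • (y - x)) := by
    intro x hx y hy
    have h1 := enorm_sub_le_lintegral_segment (u := u) fun t ht => hu _ (ball_convexComb hx hy ht)
    have hm : Measurable fun t : ℝ => ‖fderiv ℝ u (x + t • (y - x))‖ₑ :=
      ((measurable_fderiv ℝ u).comp (by fun_prop)).enorm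
    have h2 : (∫⁻ t in Set.Ioc (0 : ℝ) 1, ‖fderiv ℝ u (x + t • (y - x))‖ₑ) ^ 2 ≤
        ∫⁻ t in Set.Ioc (0 : ℝ) 1, D (x + t • (y - x)) := by
      have h3 := ENNReal.lintegral_mul_le_Lp_mul_Lq (volume.restrict (Set.Ioc (0 : ℝ) 1))
        Real.HolderConjugate.two_two hm.aemeasurable
        (aemeasurable_const (b := (1 : ℝ≥0∞)))
      simp only [Pi.mul_apply, mul_one, lintegral_const,
        Measure.restrict_apply MeasurableSet.univ, Set.univ_inter, Real.volume_Ioc, sub_zero,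
        ENNReal.ofReal_one, ENNReal.rpow_ofNat] at h3
      calc _ ≤ ((∫⁻ t in Set.Ioc (0 : ℝ) 1, D (x + t • (y - x))) ^ (1 / (2 : ℝ))) ^ 2 := by
            gcongr
            simpa [D] using h3
        _ = _ := by
            rw [← ENNReal.rpow_natCast, ← ENNReal.rpow_mul]
            norm_num
    calc ‖u y - u x‖ₑ ^ 2 ≤ (ENNReal.ofReal (2 * r) *
          ∫⁻ t in Set.Ioc (0 : ℝ) 1, ‖fderiv ℝ u (x + t • (y - x))‖ₑ) ^ 2 := by
          gcongr
          exact h1.trans (by gcongr; exact enorm_sub_le_of_mem_ball hx hy)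
      _ ≤ _ := by rw [mul_pow]; gcongr
  have hDm3 : Measurable fun q : E2 × E2 × ℝ => D (q.1 + q.2.2 • (q.2.1 - q.1)) :=
    hDm.comp (by fun_prop)
  -- For `t ≥ 1/2` the homothety in `y` has inverse Jacobian `t⁻² ≤ 4`. For `t ≤ 1/2` the roles of
  -- `x` and `y` are exchanged, which replaces `t` by `1 - t`.
  have key : ∀ t ∈ Set.Ioc (0 : ℝ) 1, ∫⁻ x in B, ∫⁻ y in B, D (x + t • (y - x)) ≤
      4 * volume B * ∫⁻ a in B, D a := by
    intro t ht
    have hstep : ∀ s : ℝ, 1 / 2 ≤ s → s ≤ 1 → ∀ x ∈ B, ∫⁻ y in B, D (x + s • (y - x)) ≤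
        4 * ∫⁻ a in B, D a := by
      intro s hs hs1 x hx
      refine (lintegral_homothety_ball_le hx (by linarith) hs1 D).trans ?_
      gcongr
      rw [show (4 : ℝ≥0∞) = ENNReal.ofReal 4 by norm_num]
      refine ENNReal.ofReal_le_ofReal ?_
      rw [inv_le_comm₀ (by positivity) (by norm_num)]
      nlinarith
    have hfin : ∀ s : ℝ, 1 / 2 ≤ s → s ≤ 1 → ∫⁻ x in B, ∫⁻ y in B, D (x + s • (y - x)) ≤
        4 * volume B * ∫⁻ a in B, D a := by
      intro s hs hs1
      calc _ ≤ ∫⁻ x in B, 4 * ∫⁻ a in B, D a :=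
            setLIntegral_mono' measurableSet_ball fun x hx => hstep s hs hs1 x hx
        _ = _ := by rw [setLIntegral_const]; ring
    rcases le_total (1 / 2) t with h | h
    · exact hfin t h ht.2
    · have hm5 : Measurable fun q : E2 × E2 => D (q.1 + t • (q.2 - q.1)) :=
        hDm.comp (by fun_prop)
      rw [lintegral_lintegral_swap (f := fun x y => D (x + t • (y - x))) hm5.aemeasurable]
      refine le_trans (le_of_eq ?_) (hfin (1 - t) (by linarith) (by linarith [ht.1]))
      refine lintegral_congr fun y => lintegral_congr fun x => ?_
      congr 1
      module
  calc _ ≤ ∫⁻ x in B, ∫⁻ y in B, ENNReal.ofReal (2 * r) ^ 2 *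
        ∫⁻ t in Set.Ioc (0 : ℝ) 1, D (x + t • (y - x)) :=
        setLIntegral_mono' measurableSet_ball fun x hx =>
          setLIntegral_mono' measurableSet_ball fun y hy => hpt x hx y hy
    _ = ENNReal.ofReal (2 * r) ^ 2 * ∫⁻ x in B, ∫⁻ y in B,
        ∫⁻ t in Set.Ioc (0 : ℝ) 1, D (x + t • (y - x)) := by
        rw [← lintegral_const_mul' _ _ (by finiteness)]
        exact lintegral_congr fun x => lintegral_const_mul' _ _ (by finiteness)
    _ = ENNReal.ofReal (2 * r) ^ 2 * ∫⁻ t in Set.Ioc (0 : ℝ) 1, ∫⁻ x in B, ∫⁻ y in B,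
        D (x + t • (y - x)) := by
        congr 1
        have e1 : ∀ x, ∫⁻ y in B, ∫⁻ t in Set.Ioc (0 : ℝ) 1, D (x + t • (y - x)) =
            ∫⁻ t in Set.Ioc (0 : ℝ) 1, ∫⁻ y in B, D (x + t • (y - x)) := fun x =>
          lintegral_lintegral_swap (hDm3.comp (by fun_prop :
            Measurable fun q : E2 × ℝ => (x, q.1, q.2))).aemeasurable
        simp_rw [e1]
        refine lintegral_lintegral_swap (Measurable.aemeasurable ?_)
        have hm4 : Measurable fun q : (E2 × ℝ) × E2 => D (q.1.1 + q.1.2 • (q.2 - q.1.1)) :=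
          hDm.comp (by fun_prop)
        exact hm4.lintegral_prod_right'
    _ ≤ ENNReal.ofReal (2 * r) ^ 2 * ∫⁻ t in Set.Ioc (0 : ℝ) 1,
        4 * volume B * ∫⁻ a in B, D a := by
        gcongr 1
        exact setLIntegral_mono' measurableSet_Ioc key
    _ = _ := by
        rw [setLIntegral_const, Real.volume_Ioc]
        simp only [sub_zero, ENNReal.ofReal_one, mul_one]
        ring

theorem lintegral_le_rpow_mul_volume {p : ℝ} (hp : 1 < p) {S : Set E2} {f : E2 → ℝ≥0∞}
    (hf : AEMeasurable f (volume.restrict S)) :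
    ∫⁻ a in S, f a ≤ (∫⁻ a in S, f a ^ p) ^ (1 / p) * volume S ^ (1 / p.conjExponent) := by
  have h := ENNReal.lintegral_mul_le_Lp_mul_Lq (volume.restrict S)
    (Real.HolderConjugate.conjExponent hp) hf (aemeasurable_const (b := (1 : ℝ≥0∞)))
  simpa using h

/-- The integrand is `t ^ (-2/p)`, integrable at `0` because `p > 2`. This is where the exponent is
decisive for Morrey's inequality. -/
theorem lintegral_rpow_lt_top {p : ℝ} (hp : 2 < p) :
    ∫⁻ t in Set.Ioc (0 : ℝ) 1, ENNReal.ofReal (t ^ 2)⁻¹ ^ (1 / p) < ⊤ := by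
  have hi : IntegrableOn (fun t : ℝ => t ^ (-(2 / p))) (Set.Ioc 0 1) volume := by
    rw [← intervalIntegrable_iff_integrableOn_Ioc_of_le zero_le_one]
    refine intervalIntegral.intervalIntegrable_rpow' ?_
    have : 2 / p < 1 := by rw [div_lt_one (by linarith)]; exact hp
    linarith
  have h := hi.lintegral_lt_top
  refine lt_of_le_of_lt (le_of_eq (setLIntegral_congr_fun measurableSet_Ioc fun t ht => ?_)) h
  have ht0 : 0 < t := ht.1
  rw [ENNReal.ofReal_rpow_of_pos (by positivity)]
  congr 1
  rw [Real.inv_rpow (by positivity), ← Real.rpow_natCast, ← Real.rpow_mul ht0.le,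
    Real.rpow_neg ht0.le]
  congr 2
  push_cast
  ring

/-- Morrey's inequality in the plane: the sup norm on a disc is controlled by the norm of
`W^{1,p}`, `p > 2`. -/
theorem morrey_ball {p : ℝ} (hp : 2 < p) {r : ℝ} (hr : 0 < r) :
    ∃ C : ℝ≥0∞, C ≠ ⊤ ∧ ∀ (a₀ : E2) (u : E2 → ℝ),
      (∀ a ∈ Metric.ball a₀ r, DifferentiableAt ℝ u a) → ∀ x ∈ Metric.ball a₀ r,
        ‖u x‖ₑ ≤ C * ((∫⁻ a in Metric.ball a₀ r, ‖u a‖ₑ ^ p) ^ (1 / p) +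
          (∫⁻ a in Metric.ball a₀ r, ‖fderiv ℝ u a‖ₑ ^ p) ^ (1 / p)) := by
  set K := ∫⁻ t in Set.Ioc (0 : ℝ) 1, ENNReal.ofReal (t ^ 2)⁻¹ ^ (1 / p) with hK
  have hKtop : K ≠ ⊤ := (lintegral_rpow_lt_top hp).ne
  set V := volume (Metric.ball (0 : E2) r) with hV
  have hV0 : V ≠ 0 := (Metric.measure_ball_pos volume (0 : E2) hr).ne'
  have hVtop : V ≠ ⊤ := measure_ball_lt_top.ne
  set W := V ^ (1 / p.conjExponent) with hW
  have hq : 0 ≤ 1 / p.conjExponent :=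
    one_div_nonneg.2 (Real.HolderConjugate.conjExponent (by linarith : 1 < p)).symm.nonneg
  have hWtop : W ≠ ⊤ := ENNReal.rpow_ne_top_of_nonneg hq hVtop
  refine ⟨V⁻¹ * (W * (1 + ENNReal.ofReal (2 * r) * K)), by finiteness, fun a₀ u hu x hx => ?_⟩
  set B := Metric.ball a₀ r with hB
  have hVB : volume B = V := by rw [hV, hB, Measure.addHaar_ball_center]
  set D : E2 → ℝ≥0∞ := fun a => ‖fderiv ℝ u a‖ₑ with hD
  have hDm : Measurable D := (measurable_fderiv ℝ u).enorm
  have hum : AEMeasurable (fun a => ‖u a‖ₑ) (volume.restrict B) :=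
    (ContinuousOn.aestronglyMeasurable (fun a ha => (hu a ha).continuousAt.continuousWithinAt)
      measurableSet_ball).enorm
  set N₀ := (∫⁻ a in B, ‖u a‖ₑ ^ p) ^ (1 / p)
  set N₁ := (∫⁻ a in B, D a ^ p) ^ (1 / p)
  -- Hölder's inequality is applied before the change of variables, so that the Jacobian `t⁻²`
  -- enters only with the power `1/p`.
  have hinner : ∀ t ∈ Set.Ioc (0 : ℝ) 1, ∫⁻ y in B, D (x + t • (y - x)) ≤
      ENNReal.ofReal (t ^ 2)⁻¹ ^ (1 / p) * (N₁ * W) := by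
    intro t ht
    have hm : Measurable fun y => D (x + t • (y - x)) := hDm.comp (by fun_prop)
    refine (lintegral_le_rpow_mul_volume (p := p) (by linarith) hm.aemeasurable).trans ?_
    rw [hVB, ← mul_assoc, ← ENNReal.mul_rpow_of_nonneg _ _ (by positivity)]
    gcongr
    exact lintegral_homothety_ball_le hx ht.1 ht.2 fun a => D a ^ p
  have hdiff : ∫⁻ y in B, ‖u y - u x‖ₑ ≤ ENNReal.ofReal (2 * r) * (K * (N₁ * W)) := by
    have hm2 : Measurable fun q : E2 × ℝ => D (x + q.2 • (q.1 - x)) := hDm.comp (by fun_prop)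
    calc _ ≤ ∫⁻ y in B, ENNReal.ofReal (2 * r) *
          ∫⁻ t in Set.Ioc (0 : ℝ) 1, D (x + t • (y - x)) := by
          refine setLIntegral_mono' measurableSet_ball fun y hy => ?_
          refine (enorm_sub_le_lintegral_segment fun t ht =>
            hu _ (ball_convexComb hx hy ht)).trans ?_
          gcongr
          exact enorm_sub_le_of_mem_ball hx hy
      _ = ENNReal.ofReal (2 * r) * ∫⁻ t in Set.Ioc (0 : ℝ) 1,
          ∫⁻ y in B, D (x + t • (y - x)) := by
          rw [lintegral_const_mul' _ _ (by finiteness)]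
          congr 1
          exact lintegral_lintegral_swap (f := fun y t => D (x + t • (y - x))) hm2.aemeasurable
      _ ≤ ENNReal.ofReal (2 * r) * ∫⁻ t in Set.Ioc (0 : ℝ) 1,
          ENNReal.ofReal (t ^ 2)⁻¹ ^ (1 / p) * (N₁ * W) := by
          gcongr 1
          exact setLIntegral_mono' measurableSet_Ioc hinner
      _ = _ := by
          rw [lintegral_mul_const]
          exact (Measurable.ennreal_ofReal (by fun_prop)).pow_const _
  have hmain : V * ‖u x‖ₑ ≤ W * (1 + ENNReal.ofReal (2 * r) * K) * (N₀ + N₁) := by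
    calc V * ‖u x‖ₑ = ∫⁻ y in B, ‖u x‖ₑ := by rw [setLIntegral_const, hVB, mul_comm]
      _ ≤ ∫⁻ y in B, (‖u y‖ₑ + ‖u y - u x‖ₑ) := by
          refine lintegral_mono fun y => ?_
          calc ‖u x‖ₑ = ‖u y - (u y - u x)‖ₑ := by rw [sub_sub_cancel]
            _ ≤ _ := enorm_sub_le
      _ = (∫⁻ y in B, ‖u y‖ₑ) + ∫⁻ y in B, ‖u y - u x‖ₑ := lintegral_add_left' hum _
      _ ≤ N₀ * W + ENNReal.ofReal (2 * r) * (K * (N₁ * W)) := by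
          gcongr
          rw [hW, ← hVB]
          exact lintegral_le_rpow_mul_volume (by linarith) hum
      _ ≤ (N₀ + N₁) * W + ENNReal.ofReal (2 * r) * (K * ((N₀ + N₁) * W)) := by
          gcongr
          · exact le_self_add
          · exact le_add_self
      _ = _ := by ring
  calc ‖u x‖ₑ = V⁻¹ * (V * ‖u x‖ₑ) := by
        rw [← mul_assoc, ENNReal.inv_mul_cancel hV0 hVtop, one_mul]
    _ ≤ V⁻¹ * (W * (1 + ENNReal.ofReal (2 * r) * K) * (N₀ + N₁)) := by gcongr
    _ = _ := by ring

theorem enorm_add_sq_le (a b : ℝ) : ‖a + b‖ₑ ^ 2 ≤ 4 * ‖a‖ₑ ^ 2 + 4 * ‖b‖ₑ ^ 2 := by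
  have h : ‖a + b‖ₑ ≤ ‖a‖ₑ + ‖b‖ₑ := enorm_add_le a b
  rcases le_total ‖a‖ₑ ‖b‖ₑ with h1 | h1
  · calc ‖a + b‖ₑ ^ 2 ≤ (‖b‖ₑ + ‖b‖ₑ) ^ 2 := by gcongr; exact h.trans (by gcongr)
      _ = 4 * ‖b‖ₑ ^ 2 := by ring
      _ ≤ _ := le_add_self
  · calc ‖a + b‖ₑ ^ 2 ≤ (‖a‖ₑ + ‖a‖ₑ) ^ 2 := by gcongr; exact h.trans (by gcongr)
      _ = 4 * ‖a‖ₑ ^ 2 := by ring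
      _ ≤ _ := le_self_add

theorem aemeasurable_enorm_sub_sq {a₀ : E2} {r : ℝ} {u : E2 → ℝ}
    (hu : ∀ a ∈ Metric.ball a₀ r, DifferentiableAt ℝ u a) (c : ℝ) :
    AEMeasurable (fun a => ‖u a - c‖ₑ ^ 2) (volume.restrict (Metric.ball a₀ r)) := by
  have h : ContinuousOn (fun a => u a - c) (Metric.ball a₀ r) := fun a ha =>
    ((hu a ha).continuousAt.sub continuousAt_const).continuousWithinAt
  exact (h.aestronglyMeasurable measurableSet_ball).enorm.pow_const 2

/-- The Poincaré inequality on a disc, relative to a subset of positive measure. -/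
theorem poincare_ball_subset (a₀ : E2) (r : ℝ) {W : Set E2} (hWm : MeasurableSet W)
    (hW : W ⊆ Metric.ball a₀ r) (hW0 : volume W ≠ 0) :
    ∃ C : ℝ≥0∞, C ≠ ⊤ ∧ ∀ u : E2 → ℝ, (∀ a ∈ Metric.ball a₀ r, DifferentiableAt ℝ u a) → ∀ c : ℝ,
      ∫⁻ a in Metric.ball a₀ r, ‖u a - c‖ₑ ^ 2 ≤ C * ((∫⁻ a in W, ‖u a - c‖ₑ ^ 2) +
        ∫⁻ a in Metric.ball a₀ r, ‖fderiv ℝ u a‖ₑ ^ 2) := by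
  set B := Metric.ball a₀ r with hB
  have hBtop : volume B ≠ ⊤ := measure_ball_lt_top.ne
  have hWtop : volume W ≠ ⊤ := ((measure_mono hW).trans_lt hBtop.lt_top).ne
  set K := ENNReal.ofReal (2 * r) ^ 2 * 4 * volume B with hK
  refine ⟨(volume W)⁻¹ * (4 * K + 4 * volume B), by finiteness, fun u hu c => ?_⟩
  have hum := aemeasurable_enorm_sub_sq hu c
  -- The splitting `u y - c = (u y - u x) + (u x - c)` is integrated over `x` in `W` and `y` in the
  -- disc. The first term is bounded by the Poincaré inequality for double differences.
  have h1 : volume W * ∫⁻ y in B, ‖u y - c‖ₑ ^ 2 ≤ (4 * K + 4 * volume B) *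
      ((∫⁻ a in W, ‖u a - c‖ₑ ^ 2) + ∫⁻ a in B, ‖fderiv ℝ u a‖ₑ ^ 2) := by
    calc volume W * ∫⁻ y in B, ‖u y - c‖ₑ ^ 2
        = ∫⁻ x in W, ∫⁻ y in B, ‖u y - c‖ₑ ^ 2 := by rw [setLIntegral_const, mul_comm]
      _ ≤ ∫⁻ x in W, ((4 * ∫⁻ y in B, ‖u y - u x‖ₑ ^ 2) + 4 * volume B * ‖u x - c‖ₑ ^ 2) := by
          refine setLIntegral_mono' hWm fun x hx => ?_
          have hum' := aemeasurable_enorm_sub_sq hu (u x)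
          calc _ ≤ ∫⁻ y in B, (4 * ‖u y - u x‖ₑ ^ 2 + 4 * ‖u x - c‖ₑ ^ 2) := by
                refine lintegral_mono fun y => ?_
                have := enorm_add_sq_le (u y - u x) (u x - c)
                rwa [sub_add_sub_cancel] at this
            _ = _ := by
                rw [lintegral_add_left' (hum'.const_mul _), setLIntegral_const,
                  lintegral_const_mul' _ _ (by finiteness)]
                ring
      _ = 4 * (∫⁻ x in W, ∫⁻ y in B, ‖u y - u x‖ₑ ^ 2) +
          4 * volume B * ∫⁻ x in W, ‖u x - c‖ₑ ^ 2 := by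
          rw [lintegral_add_right', lintegral_const_mul' _ _ (by finiteness),
            lintegral_const_mul' _ _ (by finiteness)]
          exact (hum.mono_measure (Measure.restrict_mono hW le_rfl)).const_mul _
      _ ≤ 4 * (K * ∫⁻ a in B, ‖fderiv ℝ u a‖ₑ ^ 2) +
          4 * volume B * ∫⁻ x in W, ‖u x - c‖ₑ ^ 2 := by
          gcongr
          exact (lintegral_mono_set hW).trans (poincare_ball hu)
      _ ≤ 4 * (K * ((∫⁻ a in W, ‖u a - c‖ₑ ^ 2) + ∫⁻ a in B, ‖fderiv ℝ u a‖ₑ ^ 2)) +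
          4 * volume B * ((∫⁻ a in W, ‖u a - c‖ₑ ^ 2) + ∫⁻ a in B, ‖fderiv ℝ u a‖ₑ ^ 2) := by
          gcongr
          · exact le_add_self
          · exact le_self_add
      _ = _ := by ring
  calc _ = (volume W)⁻¹ * (volume W * ∫⁻ y in B, ‖u y - c‖ₑ ^ 2) := by
        rw [← mul_assoc, ENNReal.inv_mul_cancel hW0 hWtop, one_mul]
    _ ≤ _ := by
        rw [mul_assoc]
        gcongr

/-- The constant is the value of `u` at a point where the inner integral of the double difference
does not exceed its average. -/
theorem exists_base_poincare_ball (a₀ : E2) {r : ℝ} (hr : 0 < r) :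
    ∃ C : ℝ≥0∞, C ≠ ⊤ ∧ ∀ u : E2 → ℝ, (∀ a ∈ Metric.ball a₀ r, DifferentiableAt ℝ u a) →
      ∃ c : ℝ, ∫⁻ a in Metric.ball a₀ r, ‖u a - c‖ₑ ^ 2 ≤
        C * ∫⁻ a in Metric.ball a₀ r, ‖fderiv ℝ u a‖ₑ ^ 2 := by
  set B := Metric.ball a₀ r with hB
  have hBtop : volume B ≠ ⊤ := measure_ball_lt_top.ne
  have hB0 : volume B ≠ 0 := (Metric.measure_ball_pos volume a₀ hr).ne'
  set K := ENNReal.ofReal (2 * r) ^ 2 * 4 * volume B with hK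
  refine ⟨(volume B)⁻¹ * K, by finiteness, fun u hu => ?_⟩
  have hum : AEMeasurable u (volume.restrict B) :=
    ((show ContinuousOn u B from fun a ha => (hu a ha).continuousAt.continuousWithinAt).aemeasurable
      measurableSet_ball)
  have hm : AEMeasurable (fun x => ∫⁻ y in B, ‖u y - u x‖ₑ ^ 2) (volume.restrict B) :=
    AEMeasurable.lintegral_prod_right'
      (f := fun q : E2 × E2 => ‖u q.2 - u q.1‖ₑ ^ 2) ((hum.comp_snd.sub hum.comp_fst).enorm.pow_const 2)
  obtain ⟨x, -, hx⟩ := exists_le_setLAverage hB0 hBtop hm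
  refine ⟨u x, hx.trans ?_⟩
  rw [setLAverage_eq, ENNReal.div_eq_inv_mul, mul_assoc]
  gcongr
  exact poincare_ball hu

/-! ### Finite atlases of graph patches -/

/-- A graph chart in which the area density and the derivative are bounded. -/
structure Patch (E : Set E3) where
  T : Frame
  x : E3
  r : ℝ
  s : ℝ
  g : E2 → ℝ
  bound : ℝ
  chart : IsGraphChart E T x r s g
  density_le : ∀ a ∈ Metric.ball (T.proj x) r, IsGraphChart.density E T g a ≤ bound
  norm_fderiv_le : ∀ a ∈ Metric.ball (T.proj x) r, ‖fderiv ℝ (graphMap T g) a‖ ≤ bound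

namespace Patch

variable {E : Set E3}

def dom (P : Patch E) : Set E2 := Metric.ball (P.T.proj P.x) P.r

def map (P : Patch E) : E2 → E3 := graphMap P.T P.g

def box (P : Patch E) : Set E3 :=
  {y | P.T.proj y ∈ Metric.ball (P.T.proj P.x) P.r ∧ |P.T.height y - P.T.height P.x| < P.s}

def carrier (P : Patch E) : Set E3 := P.map '' P.dom

theorem isOpen_box (P : Patch E) : IsOpen P.box := IsGraphChart.isOpen_box _ _ _ _

theorem carrier_eq (P : Patch E) : P.carrier = frontier E ∩ P.box := P.chart.image_eq

theorem carrier_subset (P : Patch E) : P.carrier ⊆ frontier E := by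
  rw [P.carrier_eq]; exact Set.inter_subset_left

theorem measurableSet_carrier (P : Patch E) : MeasurableSet P.carrier :=
  P.chart.measurableSet_image

theorem map_mem (P : Patch E) {a : E2} (ha : a ∈ P.dom) : P.map a ∈ frontier E :=
  P.chart.graphMap_mem ha

theorem continuousOn_map (P : Patch E) : ContinuousOn P.map P.dom :=
  P.chart.contDiffOn_graphMap.continuousOn

theorem differentiableAt_map (P : Patch E) {a : E2} (ha : a ∈ P.dom) :
    DifferentiableAt ℝ P.map a := (P.chart.hasFDerivAt_graphMap ha).differentiableAt

theorem isBounded_carrier (P : Patch E) : Bornology.IsBounded P.carrier := by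
  refine (isBounded_iff_forall_norm_le).2 ⟨‖P.T.proj P.x‖ + P.r + (|P.T.height P.x| + P.s), ?_⟩
  rintro _ ⟨a, ha, rfl⟩
  refine (P.T.norm_pt_le _ _).trans (add_le_add ?_ ?_)
  · have h1 : ‖a - P.T.proj P.x‖ < P.r := by rw [← dist_eq_norm]; exact ha
    have h2 := norm_add_le (P.T.proj P.x) (a - P.T.proj P.x)
    rw [add_sub_cancel] at h2
    linarith
  · have h1 := P.chart.height_lt a ha
    have h2 := abs_add_le (P.T.height P.x) (P.g a - P.T.height P.x)
    rw [add_sub_cancel] at h2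
    linarith

theorem restrict_carrier (P : Patch E) :
    (bdryMeasure E).restrict P.carrier = (μHE[2] : Measure E3).restrict P.carrier := by
  rw [bdryMeasure, Measure.restrict_restrict P.measurableSet_carrier,
    Set.inter_eq_left.2 P.carrier_subset]

theorem lintegral_dom_le (P : Patch E) (hE : IsSmoothSet E) (f : E3 → ℝ≥0∞) :
    ∫⁻ a in P.dom, f (P.map a) ≤ ∫⁻ y in P.carrier, f y ∂(bdryMeasure E) := by
  rw [P.restrict_carrier]
  exact P.chart.lintegral_le hE f

theorem lintegral_carrier_le (P : Patch E) (hE : IsSmoothSet E) {f : E3 → ℝ≥0∞}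
    (hf : AEMeasurable (fun a => f (P.map a)) (volume.restrict P.dom)) :
    ∫⁻ y in P.carrier, f y ∂(bdryMeasure E) ≤
      ENNReal.ofReal P.bound * ∫⁻ a in P.dom, f (P.map a) := by
  rw [P.restrict_carrier]
  exact P.chart.lintegral_image_le hE hf P.density_le

theorem norm_sub_le (P : Patch E) (a b : E2) : ‖a - b‖ ≤ ‖P.map a - P.map b‖ := by
  have h := P.T.norm_proj_le (P.map a - P.map b)
  rwa [map_sub, Patch.map, proj_graphMap, proj_graphMap] at h

end Patch

/-- Shrinking the disc bounds the density and the derivative by their values at the centre plus one,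
by continuity. -/
theorem IsSmoothSet.exists_patch {E : Set E3} (hE : IsSmoothSet E) {x : E3}
    (hx : x ∈ frontier E) {W : Set E3} (hW : W ∈ 𝓝 x) :
    ∃ P : Patch E, x ∈ P.carrier ∧ P.carrier ⊆ W := by
  obtain ⟨T, hT⟩ := Frame.exists_axis_eq _ (hE.norm_outerNormal hx)
  obtain ⟨r, s, g, h, hsub⟩ := hE.exists_graphChart hx T
    (by rw [hT, real_inner_self_eq_norm_sq, hE.norm_outerNormal hx]; norm_num) hW
  have hx0 : T.proj x ∈ Metric.ball (T.proj x) r := Metric.mem_ball_self h.r_pos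
  have hnhds := Metric.isOpen_ball.mem_nhds hx0
  have h1 : ∀ᶠ a in 𝓝 (T.proj x), IsGraphChart.density E T g a ≤ IsGraphChart.density E T g (T.proj x) + 1 :=
    ((h.continuousOn_density hE).continuousAt hnhds).eventually_le_const (by linarith)
  have h2 : ∀ᶠ a in 𝓝 (T.proj x), ‖fderiv ℝ (graphMap T g) a‖ ≤
      ‖fderiv ℝ (graphMap T g) (T.proj x)‖ + 1 :=
    ((h.contDiffAt_graphMap hx0).continuousAt_fderiv (by simp)).norm.eventually_le_const
      (by linarith)
  obtain ⟨r', hr', hball⟩ := Metric.eventually_nhds_iff_ball.1 (h1.and h2)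
  have hmin : 0 < min r r' := lt_min h.r_pos hr'
  refine ⟨⟨T, x, min r r', s, g, max (IsGraphChart.density E T g (T.proj x) + 1)
    (‖fderiv ℝ (graphMap T g) (T.proj x)‖ + 1), h.mono hmin (min_le_left _ _), fun a ha => ?_,
    fun a ha => ?_⟩, ?_, ?_⟩
  · exact (hball a (Metric.ball_subset_ball (min_le_right _ _) ha)).1.trans (le_max_left _ _)
  · exact (hball a (Metric.ball_subset_ball (min_le_right _ _) ha)).2.trans (le_max_right _ _)
  · exact ⟨T.proj x, Metric.mem_ball_self hmin, h.graphMap_proj_self hx⟩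
  · rintro _ ⟨a, ha, rfl⟩
    have ha' : a ∈ Metric.ball (T.proj x) r := Metric.ball_subset_ball (min_le_left _ _) ha
    exact hsub a ha' _ (h.height_lt a ha')

theorem IsSmoothSet.measure_pos {E : Set E3} (hE : IsSmoothSet E) {x : E3}
    (hx : x ∈ frontier E) {W : Set E3} (hW : W ∈ 𝓝[frontier E] x) : 0 < bdryMeasure E W := by
  obtain ⟨U, hU, hUW⟩ := mem_nhdsWithin_iff_exists_mem_nhds_inter.1 hW
  obtain ⟨P, -, hP⟩ := hE.exists_patch hx hU
  have h1 := P.lintegral_dom_le hE fun _ => 1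
  simp only [lintegral_const, one_mul, Measure.restrict_apply MeasurableSet.univ,
    Set.univ_inter] at h1
  refine lt_of_lt_of_le (Metric.measure_ball_pos volume _ P.chart.r_pos) (h1.trans ?_)
  exact measure_mono fun y hy => hUW ⟨hP hy, P.carrier_subset hy⟩

/-- Finitely many patches whose translates cover the boundary, with a Lebesgue number. -/
structure Atlas (E : Set E3) where
  n : ℕ
  patch : Fin n → Patch E
  scale : ℝ
  scale_pos : 0 < scale
  exists_patch : ∀ y ∈ frontier E, ∃ i, ∃ k : Fin 3 → ℤ, ∀ z ∈ frontier E, dist z y < scale →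
    z + latticeVec k ∈ (patch i).carrier

theorem unitCell_subset_closedCell {x : E3} (h : x ∈ unitCell) :
    x ∈ {x : E3 | ∀ i, x i ∈ Set.Icc (0 : ℝ) 1} := fun i => ⟨(h i).1, (h i).2.le⟩

/-- The part of the boundary in the closed unit cell is compact, so finitely many patch boxes cover
it with a Lebesgue number; translations bring every boundary point there. -/
theorem IsSmoothSet.nonempty_atlas {E : Set E3} (hE : IsSmoothSet E) (hp : IsPeriodicSet E) :
    Nonempty (Atlas E) := by
  set Q := frontier E ∩ {x : E3 | ∀ i, x i ∈ Set.Icc (0 : ℝ) 1} with hQ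
  have hQc : IsCompact Q := isCompact_closedCell.inter_left isClosed_frontier
  have h1 : ∀ x : Q, ∃ P : Patch E, (x : E3) ∈ P.carrier := fun x =>
    let ⟨P, h, _⟩ := hE.exists_patch x.2.1 univ_mem
    ⟨P, h⟩
  choose P hP using h1
  obtain ⟨t, ht⟩ := hQc.elim_finite_subcover (fun x : Q => (P x).box)
    (fun x => (P x).isOpen_box) fun x hx => Set.mem_iUnion.2 ⟨⟨x, hx⟩, by
      have := hP ⟨x, hx⟩
      rw [Patch.carrier_eq] at this
      exact this.2⟩
  set e := t.equivFin.symm with he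
  obtain ⟨δ, hδ, hleb⟩ := lebesgue_number_lemma_of_metric (s := Q) (ι := Fin t.card)
    (c := fun i => (P (e i)).box) hQc
    (fun i => (P (e i)).isOpen_box) fun x hx => by
      obtain ⟨y, hy, hxy⟩ := Set.mem_iUnion₂.1 (ht hx)
      exact Set.mem_iUnion.2 ⟨t.equivFin ⟨y, hy⟩, by simpa [he] using hxy⟩
  refine ⟨⟨t.card, fun i => P (e i), δ, hδ, fun y hy => ?_⟩⟩
  obtain ⟨k, hk, -⟩ := existsUnique_unitCell y
  obtain ⟨i, hi⟩ := hleb (y + latticeVec k)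
    ⟨(hp.frontier k y).2 hy, unitCell_subset_closedCell hk⟩
  refine ⟨i, k, fun z hz hzy => ?_⟩
  rw [Patch.carrier_eq]
  refine ⟨(hp.frontier k z).2 hz, hi ?_⟩
  rw [Metric.mem_ball, dist_add_right]
  exact hzy

theorem isFiniteMeasure_surfMeasure {E : Set E3} (hE : IsSmoothSet E) :
    IsFiniteMeasure (surfMeasure E) := by
  have := hE.isLocallyFiniteMeasure
  rw [surfMeasure_eq]
  refine ⟨?_⟩
  rw [Measure.restrict_apply_univ]
  exact (measure_mono fun x hx => unitCell_subset_closedCell hx).trans_lt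
    isCompact_closedCell.measure_lt_top

/-- The part of the torus covered by a set. -/
def saturation (A : Set E3) : Set E3 := {x | ∃ k : Fin 3 → ℤ, x + latticeVec k ∈ A}

theorem saturation_eq_iUnion (A : Set E3) :
    saturation A = ⋃ k : Fin 3 → ℤ, (fun x => x + latticeVec k) ⁻¹' A := by
  ext x; simp [saturation]

theorem measurableSet_saturation {A : Set E3} (hA : MeasurableSet A) :
    MeasurableSet (saturation A) := by
  rw [saturation_eq_iUnion]
  exact MeasurableSet.iUnion fun k => hA.preimage (by fun_prop)

theorem isPeriodicSet_saturation (A : Set E3) : IsPeriodicSet (saturation A) := by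
  intro k x
  constructor
  · rintro ⟨l, hl⟩
    exact ⟨k + l, by rwa [latticeVec_add, ← add_assoc]⟩
  · rintro ⟨l, hl⟩
    refine ⟨-k + l, ?_⟩
    rwa [latticeVec_add, latticeVec_neg, add_assoc, add_neg_cancel_left]

/-- The part of the cell that a translation by `k` moves into `A` lands in `cellAt k`. These cells
are disjoint, so no point of `A` is counted twice. -/
theorem lintegral_saturation_le {E : Set E3} (hp : IsPeriodicSet E) {A : Set E3}
    (hA : MeasurableSet A) {f : E3 → ℝ≥0∞} (hf : IsPeriodicOnBdry E f) :
    ∫⁻ x in saturation A, f x ∂(surfMeasure E) ≤ ∫⁻ x in A, f x ∂(bdryMeasure E) := by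
  have hμ := isLatticeInvariant_bdryMeasure hp
  calc _ ≤ ∑' k : Fin 3 → ℤ, ∫⁻ x in (fun x => x + latticeVec k) ⁻¹' A, f x ∂(surfMeasure E) := by
        rw [saturation_eq_iUnion]
        exact lintegral_iUnion_le _ _
    _ = ∑' k : Fin 3 → ℤ, ∫⁻ x in cellAt k, A.indicator f x ∂(bdryMeasure E) := by
        refine tsum_congr fun k => ?_
        rw [setLIntegral_cellAt hμ, ← lintegral_indicator (hA.preimage (by fun_prop)),
          ← surfMeasure_eq]
        refine lintegral_congr_ae (ae_surf fun x hx => ?_)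
        change _ = A.indicator f (x + latticeVec k)
        by_cases h : x + latticeVec k ∈ A
        · rw [Set.indicator_of_mem (by exact h), Set.indicator_of_mem h, hf k x hx]
        · rw [Set.indicator_of_notMem (by exact h), Set.indicator_of_notMem h]
    _ = ∫⁻ x in ⋃ k : Fin 3 → ℤ, cellAt k, A.indicator f x ∂(bdryMeasure E) :=
        (lintegral_iUnion (fun k => measurableSet_cellAt k)
          (fun k l hkl => disjoint_cellAt hkl) _).symm
    _ ≤ ∫⁻ x, A.indicator f x ∂(bdryMeasure E) := setLIntegral_le_lintegral _ _
    _ = _ := lintegral_indicator hA f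

/-- Near `x` the set has positive area. A bounded piece has at most finitely many times the area of
`W` in the torus, which therefore cannot vanish. -/
theorem surfMeasure_pos {E : Set E3} (hE : IsSmoothSet E) (hp : IsPeriodicSet E) {x : E3}
    (hx : x ∈ frontier E) {W : Set E3} (hWm : MeasurableSet W) (hWp : IsPeriodicSet W)
    (hW : W ∈ 𝓝[frontier E] x) : 0 < surfMeasure E W := by
  obtain ⟨C, hC, h⟩ := exists_lintegral_le_of_isBounded (Metric.isBounded_ball (x := x) (r := 1))
  have h1 := h E hp (W.indicator 1) fun k y _ => by
    by_cases hy : y ∈ W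
    · rw [Set.indicator_of_mem hy, Set.indicator_of_mem ((hWp k y).2 hy)]; rfl
    · rw [Set.indicator_of_notMem hy, Set.indicator_of_notMem (mt (hWp k y).1 hy)]
  rw [lintegral_indicator_one hWm, lintegral_indicator_one hWm,
    Measure.restrict_apply hWm] at h1
  have h2 := hE.measure_pos hx (inter_mem hW
    (mem_nhdsWithin_of_mem_nhds (Metric.ball_mem_nhds x one_pos)))
  by_contra h0
  rw [not_lt, nonpos_iff_eq_zero] at h0
  rw [h0, mul_zero] at h1
  exact absurd h1 (not_le.2 h2)

/-! ### Sobolev inequalities on the boundary -/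

/-- `g` bounds the tangential gradient of the function `u` on `∂E`, where both are regarded as
functions on the torus. -/
structure IsUpperGradient (E : Set E3) (u : E3 → ℝ) (g : E3 → ℝ≥0∞) : Prop where
  periodic : IsPeriodicOnBdry E u
  periodic_grad : IsPeriodicOnBdry E g
  -- Testing against maps from the plane into the boundary makes the notion stable under composition
  -- with a deformation.
  differentiableAt : ∀ (γ : E2 → E3) (a : E2), DifferentiableAt ℝ γ a →
    (∀ᶠ b in 𝓝 a, γ b ∈ frontier E) → DifferentiableAt ℝ (fun b => u (γ b)) a
  enorm_fderiv_le : ∀ (γ : E2 → E3) (a : E2), DifferentiableAt ℝ γ a →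
    (∀ᶠ b in 𝓝 a, γ b ∈ frontier E) →
    ‖fderiv ℝ (fun b => u (γ b)) a‖ₑ ≤ g (γ a) * ‖fderiv ℝ γ a‖ₑ

theorem IsLocallySmooth.isUpperGradient {E : Set E3} {f : E3 → ℝ} (h : IsLocallySmooth E f)
    (hE : IsSmoothSet E) (hp : IsPeriodicSet E) (hf : IsPeriodicOnBdry E f) :
    IsUpperGradient E f fun x => ‖TorusSurface.tangGrad E f x‖ₑ where
  periodic := hf
  periodic_grad k x hx := by beta_reduce; rw [h.isPeriodic_tangGrad hE hp hf k x hx]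
  differentiableAt γ a hγ hm := (h.hasFDerivAt_comp hE hγ.hasFDerivAt hm).differentiableAt
  enorm_fderiv_le γ a hγ hm := by
    rw [← ofReal_norm, ← ofReal_norm, ← ofReal_norm, ← ENNReal.ofReal_mul (norm_nonneg _)]
    exact ENNReal.ofReal_le_ofReal (h.norm_fderiv_comp_le hE hγ hm)

namespace Patch

variable {E : Set E3} {u : E3 → ℝ} {g : E3 → ℝ≥0∞}

theorem eventually_mem_frontier (P : Patch E) {a : E2} (ha : a ∈ P.dom) :
    ∀ᶠ b in 𝓝 a, P.map b ∈ frontier E := P.chart.eventually_mem_frontier ha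

theorem differentiableAt_comp (P : Patch E) (h : IsUpperGradient E u g) :
    ∀ a ∈ P.dom, DifferentiableAt ℝ (fun b => u (P.map b)) a := fun a ha =>
  h.differentiableAt _ a (P.differentiableAt_map ha) (P.eventually_mem_frontier ha)

theorem lintegral_fderiv_le (P : Patch E) (hE : IsSmoothSet E) (h : IsUpperGradient E u g)
    {q : ℝ} (hq : 0 ≤ q) :
    ∫⁻ a in P.dom, ‖fderiv ℝ (fun b => u (P.map b)) a‖ₑ ^ q ≤
      ENNReal.ofReal P.bound ^ q * ∫⁻ y in P.carrier, g y ^ q ∂(bdryMeasure E) := by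
  calc _ ≤ ∫⁻ a in P.dom, ENNReal.ofReal P.bound ^ q * g (P.map a) ^ q := by
        refine setLIntegral_mono' measurableSet_ball fun a ha => ?_
        rw [← ENNReal.mul_rpow_of_nonneg _ _ hq]
        refine ENNReal.rpow_le_rpow ((h.enorm_fderiv_le _ a (P.differentiableAt_map ha)
          (P.eventually_mem_frontier ha)).trans ?_) hq
        rw [mul_comm]
        gcongr
        rw [← ofReal_norm]
        exact ENNReal.ofReal_le_ofReal (P.norm_fderiv_le a ha)
    _ = ENNReal.ofReal P.bound ^ q * ∫⁻ a in P.dom, g (P.map a) ^ q :=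
        lintegral_const_mul' _ _ (ENNReal.rpow_ne_top_of_nonneg hq ENNReal.ofReal_ne_top)
    _ ≤ _ := by
        gcongr
        exact P.lintegral_dom_le hE fun y => g y ^ q

theorem exists_enorm_le (P : Patch E) (hE : IsSmoothSet E) (hp : IsPeriodicSet E) {p : ℝ}
    (h2 : 2 < p) : ∃ M : ℝ≥0∞, M ≠ ⊤ ∧ ∀ u g, IsUpperGradient E u g → ∀ x ∈ P.carrier,
      ‖u x‖ₑ ≤ M * ((∫⁻ y, ‖u y‖ₑ ^ p ∂(surfMeasure E)) ^ (1 / p) +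
        (∫⁻ y, g y ^ p ∂(surfMeasure E)) ^ (1 / p)) := by
  have hp0 : 0 ≤ p := by linarith
  have hp1 : 0 ≤ 1 / p := by positivity
  obtain ⟨C, hC, hmor⟩ := morrey_ball h2 P.chart.r_pos
  obtain ⟨D, hD, hb⟩ := exists_lintegral_le_of_isBounded P.isBounded_carrier
  set Λ := ENNReal.ofReal P.bound with hΛ
  have hfin : (D ^ (1 / p) : ℝ≥0∞) ≠ ⊤ := ENNReal.rpow_ne_top_of_nonneg hp1 hD
  have hΛtop : Λ ≠ ⊤ := ENNReal.ofReal_ne_top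
  refine ⟨C * (D ^ (1 / p) * (1 + Λ)), by finiteness, fun u g h x hx => ?_⟩
  obtain ⟨a, ha, rfl⟩ := hx
  refine (hmor _ (fun b => u (P.map b)) (P.differentiableAt_comp h) a ha).trans ?_
  rw [mul_assoc]
  gcongr
  have e1 : (∫⁻ b in P.dom, ‖u (P.map b)‖ₑ ^ p) ^ (1 / p) ≤
      D ^ (1 / p) * (∫⁻ y, ‖u y‖ₑ ^ p ∂(surfMeasure E)) ^ (1 / p) := by
    rw [← ENNReal.mul_rpow_of_nonneg _ _ hp1]
    gcongr
    refine (P.lintegral_dom_le hE fun y => ‖u y‖ₑ ^ p).trans (hb E hp _ fun k y hy => ?_)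
    rw [h.periodic k y hy]
  have e2 : (∫⁻ b in P.dom, ‖fderiv ℝ (fun b => u (P.map b)) b‖ₑ ^ p) ^ (1 / p) ≤
      Λ * (D ^ (1 / p) * (∫⁻ y, g y ^ p ∂(surfMeasure E)) ^ (1 / p)) := by
    have e3 : (Λ ^ p) ^ (1 / p) = Λ := by
      rw [← ENNReal.rpow_mul, mul_one_div_cancel (by linarith), ENNReal.rpow_one]
    rw [← ENNReal.mul_rpow_of_nonneg _ _ hp1, ← e3, ← ENNReal.mul_rpow_of_nonneg _ _ hp1]
    gcongr
    refine (P.lintegral_fderiv_le hE h hp0).trans ?_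
    gcongr
    refine hb E hp _ fun k y hy => ?_
    rw [h.periodic_grad k y hy]
  set N₀ := (∫⁻ y, ‖u y‖ₑ ^ p ∂(surfMeasure E)) ^ (1 / p)
  set N₁ := (∫⁻ y, g y ^ p ∂(surfMeasure E)) ^ (1 / p)
  calc _ ≤ D ^ (1 / p) * N₀ + Λ * (D ^ (1 / p) * N₁) := add_le_add e1 e2
    _ ≤ D ^ (1 / p) * (N₀ + N₁) + Λ * (D ^ (1 / p) * (N₀ + N₁)) := by
        gcongr
        · exact le_self_add
        · exact le_add_self
    _ = _ := by ring

end Patch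

/-- Morrey's inequality on the boundary of a smooth set. -/
theorem Atlas.exists_enorm_le {E : Set E3} (𝒜 : Atlas E) (hE : IsSmoothSet E)
    (hp : IsPeriodicSet E) {p : ℝ} (h2 : 2 < p) :
    ∃ M : ℝ≥0∞, M ≠ ⊤ ∧ ∀ u g, IsUpperGradient E u g → ∀ x ∈ frontier E,
      ‖u x‖ₑ ≤ M * ((∫⁻ y, ‖u y‖ₑ ^ p ∂(surfMeasure E)) ^ (1 / p) +
        (∫⁻ y, g y ^ p ∂(surfMeasure E)) ^ (1 / p)) := by
  choose M hM h using fun i => (𝒜.patch i).exists_enorm_le hE hp h2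
  refine ⟨∑ i, M i, by simp [ENNReal.sum_eq_top, hM], fun u g hug x hx => ?_⟩
  obtain ⟨i, k, hi⟩ := 𝒜.exists_patch x hx
  have h1 := h i u g hug _ (hi x hx (by simpa using 𝒜.scale_pos))
  rw [hug.periodic k x hx] at h1
  refine h1.trans ?_
  gcongr
  exact Finset.single_le_sum (fun _ _ => zero_le) (Finset.mem_univ i)

/-! ### Poincaré inequalities on components -/

namespace Patch

variable {E : Set E3}

theorem lintegral_enorm_fderiv_sq_le (P : Patch E) (hE : IsSmoothSet E) (hp : IsPeriodicSet E) :
    ∃ C : ℝ≥0∞, C ≠ ⊤ ∧ ∀ u g, IsUpperGradient E u g →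
      ∫⁻ a in P.dom, ‖fderiv ℝ (fun b => u (P.map b)) a‖ₑ ^ 2 ≤
        C * ∫⁻ y, g y ^ 2 ∂(surfMeasure E) := by
  obtain ⟨D, hD, hb⟩ := exists_lintegral_le_of_isBounded P.isBounded_carrier
  refine ⟨ENNReal.ofReal P.bound ^ 2 * D, by finiteness, fun u g h => ?_⟩
  have h1 := P.lintegral_fderiv_le hE h zero_le_two
  simp only [ENNReal.rpow_two] at h1
  refine h1.trans ?_
  rw [mul_assoc]
  gcongr
  refine hb E hp _ fun k y hy => ?_
  rw [h.periodic_grad k y hy]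

theorem lintegral_carrier_sub_sq_le (P : Patch E) (hE : IsSmoothSet E) {u : E3 → ℝ}
    {g : E3 → ℝ≥0∞} (h : IsUpperGradient E u g) (c : ℝ) :
    ∫⁻ y in P.carrier, ‖u y - c‖ₑ ^ 2 ∂(bdryMeasure E) ≤
      ENNReal.ofReal P.bound * ∫⁻ a in P.dom, ‖u (P.map a) - c‖ₑ ^ 2 :=
  P.lintegral_carrier_le hE (f := fun y => ‖u y - c‖ₑ ^ 2)
    (aemeasurable_enorm_sub_sq (P.differentiableAt_comp h) c)

theorem exists_poincare (P : Patch E) (hE : IsSmoothSet E) (hp : IsPeriodicSet E) :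
    ∃ C : ℝ≥0∞, C ≠ ⊤ ∧ ∀ u g, IsUpperGradient E u g → ∃ c : ℝ,
      ∫⁻ y in P.carrier, ‖u y - c‖ₑ ^ 2 ∂(bdryMeasure E) ≤
        C * ∫⁻ y, g y ^ 2 ∂(surfMeasure E) := by
  obtain ⟨C, hC, h1⟩ := exists_base_poincare_ball (P.T.proj P.x) P.chart.r_pos
  obtain ⟨D, hD, h2⟩ := P.lintegral_enorm_fderiv_sq_le hE hp
  refine ⟨ENNReal.ofReal P.bound * (C * D), by finiteness, fun u g h => ?_⟩
  obtain ⟨c, hc⟩ := h1 _ (P.differentiableAt_comp h)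
  refine ⟨c, (P.lintegral_carrier_sub_sq_le hE h c).trans ?_⟩
  rw [mul_assoc, mul_assoc]
  gcongr
  exact hc.trans (by gcongr; exact h2 u g h)

/-- The deviation from a constant on `Q` is controlled by that on `P`. -/
def Controls (P Q : Patch E) : Prop :=
  ∃ C : ℝ≥0∞, C ≠ ⊤ ∧ ∀ u g, IsUpperGradient E u g → ∀ c : ℝ,
    ∫⁻ y in Q.carrier, ‖u y - c‖ₑ ^ 2 ∂(bdryMeasure E) ≤
      C * ((∫⁻ y in P.carrier, ‖u y - c‖ₑ ^ 2 ∂(bdryMeasure E)) +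
        ∫⁻ y, g y ^ 2 ∂(surfMeasure E))

theorem Controls.refl (P : Patch E) : P.Controls P :=
  ⟨1, by simp, fun u g _ c => by rw [one_mul]; exact le_self_add⟩

theorem Controls.trans {P Q R : Patch E} (h : P.Controls Q) (h' : Q.Controls R) :
    P.Controls R := by
  obtain ⟨C, hC, h⟩ := h
  obtain ⟨D, hD, h'⟩ := h'
  refine ⟨D * (C + 1), by finiteness, fun u g hu c => (h' u g hu c).trans ?_⟩
  rw [mul_assoc]
  gcongr
  have := h u g hu c
  set X := ∫⁻ y in P.carrier, ‖u y - c‖ₑ ^ 2 ∂(bdryMeasure E)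
  set G := ∫⁻ y, g y ^ 2 ∂(surfMeasure E)
  calc _ ≤ C * (X + G) + (X + G) := by gcongr; exact le_add_self
    _ = _ := by ring

/-- In the disc of `Q` the overlap is open and nonempty, so of positive measure. The Poincaré
inequality relative to it bounds the deviation from `c` on the whole disc by the deviation on the
overlap, which after translation by `k` is part of the deviation on `P`. -/
theorem controls_of_overlap (hE : IsSmoothSet E) (hp : IsPeriodicSet E) {P Q : Patch E}
    {x : E3} {k : Fin 3 → ℤ} (hxP : x + latticeVec k ∈ P.carrier) (hxQ : x ∈ Q.carrier) :
    P.Controls Q := by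
  have := vaddInvariant (isLatticeInvariant_bdryMeasure hp)
  set W := Q.dom ∩ Q.map ⁻¹' ((fun y => y + latticeVec k) ⁻¹' P.box) with hW
  have hWo : IsOpen W := Q.continuousOn_map.isOpen_inter_preimage Metric.isOpen_ball
    (P.isOpen_box.preimage (by fun_prop))
  have hW0 : volume W ≠ 0 := by
    obtain ⟨a, ha, rfl⟩ := hxQ
    rw [P.carrier_eq] at hxP
    exact (hWo.measure_pos volume ⟨a, ha, hxP.2⟩).ne'
  obtain ⟨C, hC, h1⟩ := poincare_ball_subset (Q.T.proj Q.x) Q.r hWo.measurableSet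
    Set.inter_subset_left hW0
  obtain ⟨D, hD, h2⟩ := Q.lintegral_enorm_fderiv_sq_le hE hp
  refine ⟨ENNReal.ofReal Q.bound * (C * (1 + D)), by finiteness, fun u g h c => ?_⟩
  refine (Q.lintegral_carrier_sub_sq_le hE h c).trans ?_
  rw [mul_assoc, mul_assoc]
  gcongr
  refine (h1 _ (Q.differentiableAt_comp h) c).trans ?_
  gcongr
  have h3 : ∫⁻ a in W, ‖u (Q.map a) - c‖ₑ ^ 2 ≤
      ∫⁻ y in P.carrier, ‖u y - c‖ₑ ^ 2 ∂(bdryMeasure E) := by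
    set f : E3 → ℝ≥0∞ := fun y => ‖u y - c‖ₑ ^ 2 with hf
    set S := (fun y => y + latticeVec k) ⁻¹' P.carrier with hS
    have hSm : MeasurableSet S := P.measurableSet_carrier.preimage (by fun_prop)
    calc ∫⁻ a in W, f (Q.map a) ≤ ∫⁻ a in Q.dom, S.indicator f (Q.map a) := by
          rw [← lintegral_indicator hWo.measurableSet, ← lintegral_indicator (show MeasurableSet Q.dom from measurableSet_ball)]
          refine lintegral_mono fun a => ?_
          by_cases ha : a ∈ W
          · have hmem : Q.map a ∈ S := by
              rw [hS, Set.mem_preimage, P.carrier_eq]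
              exact ⟨(hp.frontier k _).2 (Q.map_mem ha.1), ha.2⟩
            rw [Set.indicator_of_mem ha, Set.indicator_of_mem ha.1, Set.indicator_of_mem hmem]
          · rw [Set.indicator_of_notMem ha]; exact zero_le
      _ ≤ ∫⁻ y in Q.carrier, S.indicator f y ∂(bdryMeasure E) := Q.lintegral_dom_le hE _
      _ ≤ ∫⁻ y, S.indicator f y ∂(bdryMeasure E) := setLIntegral_le_lintegral _ _
      _ = ∫⁻ y, P.carrier.indicator f (k +ᵥ y) ∂(bdryMeasure E) := by
          refine lintegral_congr_ae (ae_bdry fun y hy => ?_)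
          change S.indicator f y = P.carrier.indicator f (y + latticeVec k)
          by_cases hyS : y ∈ S
          · rw [Set.indicator_of_mem hyS, Set.indicator_of_mem (by exact hyS), hf]
            beta_reduce
            rw [h.periodic k y hy]
          · rw [Set.indicator_of_notMem hyS, Set.indicator_of_notMem (by exact hyS)]
      _ = ∫⁻ y, P.carrier.indicator f y ∂(bdryMeasure E) :=
          (measurePreserving_vadd k (bdryMeasure E)).lintegral_comp_emb
            (measurableEmbedding_const_vadd k) _
      _ = _ := lintegral_indicator P.measurableSet_carrier f
  set X := ∫⁻ y in P.carrier, ‖u y - c‖ₑ ^ 2 ∂(bdryMeasure E)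
  set G := ∫⁻ y, g y ^ 2 ∂(surfMeasure E)
  calc _ ≤ X + D * G := add_le_add h3 (h2 u g h)
    _ ≤ (X + G) + D * (X + G) := by
        gcongr
        · exact le_self_add
        · exact le_add_self
    _ = _ := by ring

end Patch

/-- A union of components of the boundary (as a subset of the torus) on which a Poincaré inequality
holds. -/
structure IsComponent (E S : Set E3) : Prop where
  subset : S ⊆ frontier E
  nonempty : S.Nonempty
  measurableSet : MeasurableSet S
  periodic : IsPeriodicSet S
  eventually_mem_iff : ∀ x ∈ frontier E, ∀ᶠ z in 𝓝[frontier E] x, (z ∈ S ↔ x ∈ S)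
  poincare : ∃ C : ℝ≥0∞, C ≠ ⊤ ∧ ∀ u g, IsUpperGradient E u g → ∃ c : ℝ,
    ∫⁻ y in S, ‖u y - c‖ₑ ^ 2 ∂(surfMeasure E) ≤ C * ∫⁻ y, g y ^ 2 ∂(surfMeasure E)

/-- Connectedness is replaced by the relation `Controls`. The translates of all patches controlled
by patch `i` form a set that is open and closed in the boundary. Its Poincaré inequality uses the
constant of patch `i` on all these patches. -/
theorem Atlas.exists_isComponent {E : Set E3} (𝒜 : Atlas E) (hE : IsSmoothSet E)
    (hp : IsPeriodicSet E) (i : Fin 𝒜.n) :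
    ∃ S, IsComponent E S ∧ (𝒜.patch i).carrier ⊆ S := by
  classical
  set J : Finset (Fin 𝒜.n) := {j | (𝒜.patch i).Controls (𝒜.patch j)} with hJ
  set A : Set E3 := ⋃ j ∈ J, (𝒜.patch j).carrier with hA
  have hAm : MeasurableSet A := J.measurableSet_biUnion fun j _ => (𝒜.patch j).measurableSet_carrier
  have hAsub : A ⊆ frontier E := Set.iUnion₂_subset fun j _ => (𝒜.patch j).carrier_subset
  have hiA : (𝒜.patch i).carrier ⊆ A := Set.subset_biUnion_of_mem (u := fun j =>
    (𝒜.patch j).carrier) (show i ∈ J by simpa [hJ] using Patch.Controls.refl _)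
  have hAsat : A ⊆ saturation A := fun x hx => ⟨0, by rwa [latticeVec_zero, add_zero]⟩
  refine ⟨saturation A, ⟨?_, ?_, measurableSet_saturation hAm, isPeriodicSet_saturation A, ?_, ?_⟩,
    hiA.trans hAsat⟩
  · rintro x ⟨k, hk⟩
    exact (hp.frontier k x).1 (hAsub hk)
  · exact ⟨_, hAsat (hiA ⟨_, Metric.mem_ball_self (𝒜.patch i).chart.r_pos, rfl⟩)⟩
  · intro x hx
    obtain ⟨j, k, hjk⟩ := 𝒜.exists_patch x hx
    have hnear : ∀ᶠ z in 𝓝[frontier E] x, z + latticeVec k ∈ (𝒜.patch j).carrier := by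
      filter_upwards [self_mem_nhdsWithin,
        mem_nhdsWithin_of_mem_nhds (Metric.ball_mem_nhds x 𝒜.scale_pos)] with z hz hzx
      exact hjk z hz hzx
    -- A patch meeting the union is itself controlled by patch `i`, so membership depends only on
    -- the index `j`, not on the point of the patch.
    have hiff : ∀ z, z + latticeVec k ∈ (𝒜.patch j).carrier → (z ∈ saturation A ↔ j ∈ J) := by
      intro z hz
      constructor
      · rintro ⟨l, hl⟩
        obtain ⟨j', hj', hl'⟩ := Set.mem_iUnion₂.1 hl
        have h1 : (𝒜.patch i).Controls (𝒜.patch j') := by simpa [hJ] using hj'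
        have h2 : (𝒜.patch j').Controls (𝒜.patch j) := by
          refine Patch.controls_of_overlap hE hp (k := l - k) ?_ hz
          rwa [add_assoc, ← latticeVec_add, add_sub_cancel]
        simpa [hJ] using h1.trans h2
      · intro hj
        exact ⟨k, Set.mem_iUnion₂.2 ⟨j, hj, hz⟩⟩
    have hxk := hjk x hx (by simpa using 𝒜.scale_pos)
    filter_upwards [hnear] with z hz
    rw [hiff z hz, hiff x hxk]
  · obtain ⟨C, hC, h1⟩ := (𝒜.patch i).exists_poincare hE hp
    have h2 : ∀ j, ∃ D : ℝ≥0∞, D ≠ ⊤ ∧ (j ∈ J → ∀ u g, IsUpperGradient E u g → ∀ c : ℝ,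
        ∫⁻ y in (𝒜.patch j).carrier, ‖u y - c‖ₑ ^ 2 ∂(bdryMeasure E) ≤
          D * ((∫⁻ y in (𝒜.patch i).carrier, ‖u y - c‖ₑ ^ 2 ∂(bdryMeasure E)) +
            ∫⁻ y, g y ^ 2 ∂(surfMeasure E))) := by
      intro j
      by_cases hj : j ∈ J
      · obtain ⟨D, hD, h⟩ : (𝒜.patch i).Controls (𝒜.patch j) := by simpa [hJ] using hj
        exact ⟨D, hD, fun _ => h⟩
      · exact ⟨0, by simp, fun h => absurd h hj⟩
    choose D hD h2 using h2
    have hsum : ∑ j ∈ J, D j ≠ ⊤ := by simp [ENNReal.sum_eq_top, hD]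
    refine ⟨(∑ j ∈ J, D j) * (C + 1), by finiteness, fun u g h => ?_⟩
    obtain ⟨c, hc⟩ := h1 u g h
    refine ⟨c, ?_⟩
    have hper : IsPeriodicOnBdry E fun y => ‖u y - c‖ₑ ^ 2 := fun k y hy => by
      beta_reduce
      rw [h.periodic k y hy]
    calc _ ≤ ∫⁻ y in A, ‖u y - c‖ₑ ^ 2 ∂(bdryMeasure E) := lintegral_saturation_le hp hAm hper
      _ ≤ ∑ j ∈ J, ∫⁻ y in (𝒜.patch j).carrier, ‖u y - c‖ₑ ^ 2 ∂(bdryMeasure E) := by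
          have hAJ : A = ⋃ j : J, (𝒜.patch j).carrier := by ext; simp [hA]
          rw [hAJ, ← Finset.sum_coe_sort J]
          exact (lintegral_iUnion_le _ _).trans_eq (tsum_fintype _)
      _ ≤ ∑ j ∈ J, D j * (C * (∫⁻ y, g y ^ 2 ∂(surfMeasure E)) +
            ∫⁻ y, g y ^ 2 ∂(surfMeasure E)) := by
          refine Finset.sum_le_sum fun j hj => (h2 j hj u g h c).trans ?_
          gcongr
      _ = _ := by rw [← Finset.sum_mul]; ring

/-! ### Consequences of strict stability -/

theorem ae_mem_frontier (E : Set E3) : ∀ᵐ x ∂(surfMeasure E), x ∈ frontier E :=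
  ae_surf fun _ hx => hx

theorem tangGrad_eq_zero {E : Set E3} (hE : IsSmoothSet E) {χ : E3 → ℝ}
    (hχ : IsLocallyConstOnBdry E χ) {x : E3} (hx : x ∈ frontier E) : tangGrad E χ x = 0 := by
  rw [hE.tangGrad_eq hx (g := fun _ => χ x) (hχ x hx) (differentiableAt_const _)]
  simp [gradient, tangPart]

theorem IsLocallyConstOnBdry.isSmoothOnBdry {E : Set E3} {χ : E3 → ℝ}
    (hχ : IsLocallyConstOnBdry E χ) (hp : IsPeriodicOnBdry E χ) : IsSmoothOnBdry E χ :=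
  ⟨fun x hx => contDiffWithinAt_const.congr_of_eventuallyEq (hχ x hx) rfl, hp⟩

theorem IsLocallyConstOnBdry.memLp {E : Set E3} (hE : IsSmoothSet E) {χ : E3 → ℝ}
    (hχ : IsLocallyConstOnBdry E χ) {M : ℝ} (hM : ∀ x, ‖χ x‖ ≤ M) (q : ℝ≥0∞) :
    MemLp χ q (surfMeasure E) := by
  have := isFiniteMeasure_surfMeasure hE
  refine MemLp.of_bound ?_ M (Eventually.of_forall hM)
  rw [surfMeasure_eq]
  exact (aestronglyMeasurable_bdry hχ.continuousOn).restrict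

theorem IsLocallyConstOnBdry.hasH1Gradient {E : Set E3} (hE : IsSmoothSet E) {χ : E3 → ℝ}
    (hχ : IsLocallyConstOnBdry E χ) (hp : IsPeriodicOnBdry E χ) {M : ℝ} (hM : ∀ x, ‖χ x‖ ≤ M) :
    HasH1Gradient E χ 0 := by
  refine ⟨hχ.memLp hE hM 2, MemLp.zero, fun _ => χ, fun _ => hχ.isSmoothOnBdry hp, ?_, ?_⟩
  · simp
  · have h : tangGrad E χ - 0 =ᵐ[surfMeasure E] 0 := by
      rw [sub_zero]
      exact ae_surf fun x hx => tangGrad_eq_zero hE hχ hx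
    simp only [eLpNorm_congr_ae h, eLpNorm_zero, tendsto_const_nhds]

theorem integrable_inner_outerNormal {E : Set E3} (hE : IsSmoothSet E) (η : E3) :
    Integrable (fun x => inner ℝ η (outerNormal E x)) (surfMeasure E) := by
  have := isFiniteMeasure_surfMeasure hE
  refine Integrable.of_bound (C := ‖η‖) ?_ (ae_surf fun x hx => ?_)
  · rw [surfMeasure_eq]
    exact (aestronglyMeasurable_bdry (continuousOn_const.inner hE.continuousOn_outerNormal)).restrict
  · refine (norm_inner_le_norm _ _).trans ?_
    rw [hE.norm_outerNormal hx, mul_one]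

/-- A union of components of a strictly stable critical set, on which the average of the normal
vanishes, is the whole boundary. -/
theorem IsStrictlyStable.frontier_subset {F S : Set E3} (hF : IsStrictlyStable F)
    (hS : IsComponent F S)
    (h0 : ∀ η : E3, ∫ x in S, inner ℝ η (outerNormal F x) ∂(surfMeasure F) = 0) :
    frontier F ⊆ S := by
  classical
  have hE := hF.smooth
  have hp := hF.periodic
  have hfin := isFiniteMeasure_surfMeasure hE
  intro z hz
  by_contra hzS
  set a := (surfMeasure F).real S with ha
  set b := (surfMeasure F).real Sᶜ with hb
  have hapos : 0 < a := by
    obtain ⟨y, hy⟩ := hS.nonempty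
    have h1 := surfMeasure_pos hE hp (hS.subset hy) hS.measurableSet hS.periodic
      ((hS.eventually_mem_iff y (hS.subset hy)).mono fun z hz => hz.2 hy)
    exact ENNReal.toReal_pos h1.ne' (measure_ne_top _ _)
  have hbpos : 0 < b := by
    have h1 := surfMeasure_pos hE hp hz hS.measurableSet.compl
      (fun k x => not_congr (hS.periodic k x))
      ((hS.eventually_mem_iff z hz).mono fun y hy => (not_congr hy).2 hzS)
    exact ENNReal.toReal_pos h1.ne' (measure_ne_top _ _)
  -- The values are weighted by the areas of the complementary pieces to give zero average.
  set φ : E3 → ℝ := fun x => if x ∈ S then b else -a with hφ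
  have hφc : IsLocallyConstOnBdry F φ := fun x hx => by
    filter_upwards [hS.eventually_mem_iff x hx] with y hy
    simp only [hφ, hy]
  have hφp : IsPeriodicOnBdry F φ := fun k x _ => by simp only [hφ, hS.periodic k x]
  have hφM : ∀ x, ‖φ x‖ ≤ a + b := fun x => by
    by_cases hx : x ∈ S
    · simp only [hφ, hx, if_true, Real.norm_eq_abs, abs_of_pos hbpos]; linarith
    · simp only [hφ, hx, if_false, norm_neg, Real.norm_eq_abs, abs_of_pos hapos]; linarith
  have hφi : Integrable φ (surfMeasure F) :=
    memLp_one_iff_integrable.1 (hφc.memLp hE hφM 1)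
  have hsplit : ∀ f : E3 → ℝ, Integrable f (surfMeasure F) →
      ∫ x, φ x * f x ∂(surfMeasure F) =
        b * ∫ x in S, f x ∂(surfMeasure F) - a * ∫ x in Sᶜ, f x ∂(surfMeasure F) := by
    intro f hf
    have hi : Integrable (fun x => φ x * f x) (surfMeasure F) :=
      hf.bdd_mul hφi.1 (Eventually.of_forall hφM)
    rw [← integral_add_compl hS.measurableSet hi,
      setIntegral_congr_fun (g := fun x => b * f x) hS.measurableSet fun x hx => by
        simp [hφ, hx],
      setIntegral_congr_fun (g := fun x => -a * f x) hS.measurableSet.compl fun x hx => by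
        have : x ∉ S := hx
        simp [hφ, this],
      integral_const_mul, integral_const_mul]
    ring
  -- The gradient of `φ` is zero, so only the nonpositive curvature term of the second variation
  -- remains, contradicting stability.
  have hpos := hF.pos φ 0 (hφc.hasH1Gradient hE hφp hφM) ?_ ?_ ?_
  · rw [secondVariation] at hpos
    have h1 : 0 ≤ ∫ x, secondFormSq F x * φ x ^ 2 ∂(surfMeasure F) :=
      integral_nonneg fun x => mul_nonneg (Finset.sum_nonneg fun i _ => sq_nonneg _) (sq_nonneg _)
    simp at hpos
    linarith
  · have h1 := hsplit (fun _ => 1) (integrable_const _)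
    simp only [mul_one, integral_const, smul_eq_mul, measureReal_restrict_apply_univ] at h1
    rw [h1]
    ring
  -- The normal has zero integral over `S` by hypothesis and over the whole boundary, hence also
  -- over the complement of `S`.
  · intro η
    have hi := integrable_inner_outerNormal hE η
    have h1 := integral_add_compl hS.measurableSet hi
    rw [hE.integral_outerNormal hp, h0 η, zero_add] at h1
    rw [hsplit _ hi, h0 η, h1]
    ring
  · intro hae
    have h1 : surfMeasure F Set.univ = 0 := by
      have h2 : ∀ᵐ x ∂(surfMeasure F), False := by
        filter_upwards [hae] with x hx
        by_cases hxS : x ∈ S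
        · simp only [hφ, hxS, if_true, Pi.zero_apply] at hx; exact hbpos.ne' hx
        · simp only [hφ, hxS, if_false, Pi.zero_apply, neg_eq_zero] at hx; exact hapos.ne' hx
      simpa [ae_iff] using h2
    have h3 : surfMeasure F S = 0 := measure_mono_null (Set.subset_univ _) h1
    rw [ha, Measure.real, h3] at hapos
    simp at hapos

/-! ### Small normal deformations -/

theorem norm_le_sum_abs (v : E3) : ‖v‖ ≤ ∑ i, |v i| := by
  rw [EuclideanSpace.norm_eq]
  refine Real.sqrt_le_iff.2 ⟨Finset.sum_nonneg fun i _ => abs_nonneg _, ?_⟩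
  simp only [Fin.sum_univ_three, Real.norm_eq_abs]
  nlinarith [abs_nonneg (v 0), abs_nonneg (v 1), abs_nonneg (v 2),
    mul_nonneg (abs_nonneg (v 0)) (abs_nonneg (v 1)),
    mul_nonneg (abs_nonneg (v 0)) (abs_nonneg (v 2)),
    mul_nonneg (abs_nonneg (v 1)) (abs_nonneg (v 2))]

theorem exists_norm_le_of_isPeriodic {E : Set E3} (hp : IsPeriodicSet E) {V : Type*}
    [NormedAddCommGroup V] {f : E3 → V} (hf : ContinuousOn f (frontier E))
    (hfp : IsPeriodicOnBdry E f) : ∃ L : ℝ, 0 < L ∧ ∀ x ∈ frontier E, ‖f x‖ ≤ L := by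
  have hc : IsCompact (frontier E ∩ {x : E3 | ∀ i, x i ∈ Set.Icc (0 : ℝ) 1}) :=
    isCompact_closedCell.inter_left isClosed_frontier
  obtain ⟨L, hL⟩ := hc.exists_bound_of_continuousOn (hf.mono Set.inter_subset_left)
  refine ⟨max L 1, by positivity, fun x hx => ?_⟩
  obtain ⟨k, hk, -⟩ := existsUnique_unitCell x
  rw [← hfp k x hx]
  exact (hL _ ⟨(hp.frontier k x).2 hx, unitCell_subset_closedCell hk⟩).trans (le_max_left _ _)

/-- The vector field `V` on `∂F` is small, in the sense that it is bounded by `t`, has tangential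
derivatives bounded by `t`, and Lipschitz constant `t` up to the scale `ρ`. -/
structure IsSmallField (F : Set E3) (V : E3 → E3) (ρ t : ℝ) : Prop where
  periodic : IsPeriodicOnBdry F V
  norm_le : ∀ x ∈ frontier F, ‖V x‖ ≤ t
  lipschitz : ∀ x ∈ frontier F, ∀ y ∈ frontier F, dist x y < ρ → ‖V x - V y‖ ≤ t * ‖x - y‖
  hasFDerivAt : ∀ {X : Type} [NormedAddCommGroup X] [NormedSpace ℝ X] (γ : X → E3)
    (γ' : X →L[ℝ] E3) (a : X), HasFDerivAt γ γ' a → (∀ᶠ b in 𝓝 a, γ b ∈ frontier F) →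
    ∃ D : X →L[ℝ] E3, HasFDerivAt (fun b => V (γ b)) D a ∧ ∀ w, ‖D w‖ ≤ t * ‖γ' w‖

section SmallField

variable {F : Set E3}

/-- The product rule gives `ψ dνᵢ + νᵢ dψ` in each coordinate; the factor `3` comes from bounding
the norm by the sum of three coordinates. -/
theorem exists_hasFDerivAt_smul_outerNormal (hF : IsSmoothSet F) {ψ : E3 → ℝ}
    (hψ : IsLocallySmooth F ψ) {A B L : ℝ} {X : Type} [NormedAddCommGroup X] [NormedSpace ℝ X]
    {γ : X → E3} {γ' : X →L[ℝ] E3} {a : X} (hγ : HasFDerivAt γ γ' a)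
    (hm : ∀ᶠ b in 𝓝 a, γ b ∈ frontier F) (hA : |ψ (γ a)| ≤ A) (hB : ‖tangGrad F ψ (γ a)‖ ≤ B)
    (hL : ∀ i, ‖tangGrad F (fun y => outerNormal F y i) (γ a)‖ ≤ L) :
    ∃ D : X →L[ℝ] E3, HasFDerivAt (fun b => ψ (γ b) • outerNormal F (γ b)) D a ∧
      ∀ w, ‖D w‖ ≤ 3 * (A * L + B) * ‖γ' w‖ := by
  have hx := hm.self_of_nhds
  have h1 := hψ.hasFDerivAt_comp hF hγ hm
  have h2 := fun i => h1.mul ((hF.isLocallySmooth_outerNormal i).hasFDerivAt_comp hF hγ hm)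
  have hd : DifferentiableAt ℝ (fun b => ψ (γ b) • outerNormal F (γ b)) a :=
    (differentiableAt_euclidean).2 fun i => (h2 i).differentiableAt
  refine ⟨_, hd.hasFDerivAt, fun w => ?_⟩
  have h3 : ∀ i, (EuclideanSpace.proj (𝕜 := ℝ) i).comp
      (fderiv ℝ (fun b => ψ (γ b) • outerNormal F (γ b)) a) = _ := fun i =>
    ((EuclideanSpace.proj (𝕜 := ℝ) i).hasFDerivAt.comp a hd.hasFDerivAt).unique
      (show HasFDerivAt (fun b => (EuclideanSpace.proj (𝕜 := ℝ) i)
        (ψ (γ b) • outerNormal F (γ b))) _ a from h2 i)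
  have hA0 : 0 ≤ A := (abs_nonneg _).trans hA
  have hcomp : ∀ i, |fderiv ℝ (fun b => ψ (γ b) • outerNormal F (γ b)) a w i| ≤
      (A * L + B) * ‖γ' w‖ := by
    intro i
    have h4 := DFunLike.congr_fun (h3 i) w
    have h5 : fderiv ℝ (fun b => ψ (γ b) • outerNormal F (γ b)) a w i =
        ψ (γ a) * inner ℝ (tangGrad F (fun y => outerNormal F y i) (γ a)) (γ' w) +
          outerNormal F (γ a) i * inner ℝ (tangGrad F ψ (γ a)) (γ' w) := by
      simpa using h4
    rw [h5]
    refine (abs_add_le _ _).trans ?_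
    rw [abs_mul, abs_mul, add_mul, mul_assoc]
    refine add_le_add (mul_le_mul hA ?_ (abs_nonneg _) hA0) ?_
    · exact (abs_real_inner_le_norm _ _).trans (by gcongr; exact hL i)
    · have h6 : |outerNormal F (γ a) i| ≤ 1 :=
        (abs_apply_le_norm _ i).trans_eq (hF.norm_outerNormal hx)
      calc _ ≤ 1 * (‖tangGrad F ψ (γ a)‖ * ‖γ' w‖) :=
            mul_le_mul h6 (abs_real_inner_le_norm _ _) (abs_nonneg _) zero_le_one
        _ ≤ _ := by rw [one_mul]; gcongr
  refine (norm_le_sum_abs _).trans ((Finset.sum_le_sum fun i _ => hcomp i).trans_eq ?_)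
  simp only [Finset.sum_const, Finset.card_univ, Fintype.card_fin, nsmul_eq_mul]
  push_cast
  ring

/-- Smallness in `C¹` from smallness in `W^{2,p}`, `p > 2`. -/
theorem Atlas.exists_c1_bound (𝒜 : Atlas F) (hF : IsSmoothSet F) (hp : IsPeriodicSet F) {p : ℝ}
    (h2 : 2 < p) : ∃ M : ℝ, 0 < M ∧ ∀ ψ : E3 → ℝ, IsSmoothOnBdry F ψ → ∀ δ : ℝ, 0 < δ →
      sobolevNorm2 F p ψ ≤ ENNReal.ofReal δ → ∀ x ∈ frontier F,
        |ψ x| ≤ M * δ ∧ ‖tangGrad F ψ x‖ ≤ M * δ := by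
  obtain ⟨M, hM, h⟩ := 𝒜.exists_enorm_le hF hp h2
  have hp0 : 0 < p := by linarith
  have hLp : ∀ {V : Type} [NormedAddCommGroup V] (f : E3 → V),
      eLpNorm f (ENNReal.ofReal p) (surfMeasure F) =
        (∫⁻ y, ‖f y‖ₑ ^ p ∂(surfMeasure F)) ^ (1 / p) := fun f => by
    rw [eLpNorm_eq_lintegral_rpow_enorm_toReal (by simpa using hp0) ENNReal.ofReal_ne_top,
      ENNReal.toReal_ofReal hp0.le]
  -- The factor `3` accounts for the three components of the gradient, and `1` is added for
  -- positivity.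
  refine ⟨3 * M.toReal + 1, by positivity, fun ψ hψ δ hδ hsob x hx => ?_⟩
  have hψs := hF.isLocallySmooth_of_contDiffOn hψ.1
  -- Morrey's inequality is applied to `ψ` with its gradient, and to each component of the gradient
  -- with the Hessian norm as upper gradient. Each pair is part of the `W^{2,p}` norm.
  have key : ∀ (u : E3 → ℝ) (g : E3 → ℝ≥0∞), IsUpperGradient F u g →
      (∫⁻ y, ‖u y‖ₑ ^ p ∂(surfMeasure F)) ^ (1 / p) +
        (∫⁻ y, g y ^ p ∂(surfMeasure F)) ^ (1 / p) ≤ sobolevNorm2 F p ψ →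
      |u x| ≤ M.toReal * δ := by
    intro u g hug hle
    have h1 : ‖u x‖ₑ ≤ M * ENNReal.ofReal δ := by
      refine (h u g hug x hx).trans ?_
      gcongr
      exact hle.trans hsob
    have h2 := ENNReal.toReal_mono (by finiteness) h1
    rwa [toReal_enorm, ENNReal.toReal_mul, ENNReal.toReal_ofReal hδ.le] at h2
  have hu0 := key ψ _ (hψs.isUpperGradient hF hp hψ.2) (by
    rw [sobolevNorm2, hLp, hLp]
    exact le_self_add)
  have hu1 : ∀ j, |tangGrad F ψ x j| ≤ M.toReal * δ := by
    intro j
    refine key (fun y => tangGrad F ψ y j) _ ((hψs.tangGrad hF j).isUpperGradient hF hp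
      fun k y hy => by beta_reduce; rw [hψs.isPeriodic_tangGrad hF hp hψ.2 k y hy]) ?_
    rw [sobolevNorm2, hLp, hLp, hLp, add_assoc]
    refine le_add_left (add_le_add ?_ ?_)
    · gcongr with y
      rw [← ofReal_norm, ← ofReal_norm]
      exact ENNReal.ofReal_le_ofReal (abs_apply_le_norm _ j)
    · gcongr with y
      rw [← ofReal_norm, ← ofReal_norm]
      refine ENNReal.ofReal_le_ofReal ?_
      rw [tangHessNorm, Real.norm_eq_abs, abs_of_nonneg (Real.sqrt_nonneg _)]
      refine Real.le_sqrt_of_sq_le ?_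
      exact Finset.single_le_sum (f := fun j => ‖tangGrad F (fun y => tangGrad F ψ y j) y‖ ^ 2)
        (fun _ _ => sq_nonneg _) (Finset.mem_univ j)
  have hMδ : 0 ≤ M.toReal * δ := by positivity
  refine ⟨by nlinarith, (norm_le_sum_abs _).trans ((Finset.sum_le_sum fun j _ => hu1 j).trans ?_)⟩
  simp only [Finset.sum_const, Finset.card_univ, Fintype.card_fin, nsmul_eq_mul]
  push_cast
  nlinarith

/-- The derivative bound combines the `C¹` bound on `ψ` with bounds on `D_τ ν`. For the Lipschitz
bound, two points closer than the scale of the atlas lie in one translated patch. The mean value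
inequality on its convex disc applies, and distances in the disc do not exceed those in space. -/
theorem Atlas.exists_isSmallField (𝒜 : Atlas F) (hF : IsSmoothSet F) (hp : IsPeriodicSet F)
    {p : ℝ} (h2 : 2 < p) : ∃ M : ℝ, 0 < M ∧ ∀ ψ : E3 → ℝ, IsSmoothOnBdry F ψ → ∀ δ : ℝ, 0 < δ →
      sobolevNorm2 F p ψ ≤ ENNReal.ofReal δ →
        IsSmallField F (fun x => ψ x • outerNormal F x) 𝒜.scale (M * δ) := by
  obtain ⟨M, hM, h⟩ := 𝒜.exists_c1_bound hF hp h2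
  have hL : ∀ i, ∃ L : ℝ, 0 < L ∧ ∀ x ∈ frontier F,
      ‖tangGrad F (fun y => outerNormal F y i) x‖ ≤ L := fun i =>
    have hi := hF.isLocallySmooth_outerNormal i
    exists_norm_le_of_isPeriodic hp (hi.continuousOn_tangGrad hF)
      (hi.isPeriodic_tangGrad hF hp fun k y hy => by beta_reduce; rw [hF.outerNormal_add hp hy])
  choose L hL0 hL using hL
  set Λ : ℝ := ∑ i, L i with hΛ
  have hΛ0 : 0 ≤ Λ := Finset.sum_nonneg fun i _ => (hL0 i).le
  have hΛL : ∀ i, ∀ x ∈ frontier F, ‖tangGrad F (fun y => outerNormal F y i) x‖ ≤ Λ :=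
    fun i x hx => (hL i x hx).trans
      (Finset.single_le_sum (fun i _ => (hL0 i).le) (Finset.mem_univ i))
  set R : ℝ := 1 + ∑ i, |(𝒜.patch i).bound| with hR
  have hR1 : 1 ≤ R := by
    have : 0 ≤ ∑ i, |(𝒜.patch i).bound| := Finset.sum_nonneg fun i _ => abs_nonneg _
    linarith
  have hRb : ∀ i, (𝒜.patch i).bound ≤ R := fun i => by
    have := Finset.single_le_sum (f := fun i => |(𝒜.patch i).bound|)
      (fun i _ => abs_nonneg _) (Finset.mem_univ i)
    have := le_abs_self (𝒜.patch i).bound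
    simp only at *
    linarith
  set N : ℝ := 3 * (M * Λ + M) with hN
  have hN0 : M ≤ N := by nlinarith [mul_nonneg hM.le hΛ0]
  refine ⟨N * R, by nlinarith, fun ψ hψ δ hδ hsob => ?_⟩
  have hψs := hF.isLocallySmooth_of_contDiffOn hψ.1
  have hNR : N * δ ≤ N * R * δ := by
    have : N ≤ N * R := le_mul_of_one_le_right (hM.le.trans hN0) hR1
    gcongr
  have hper : IsPeriodicOnBdry F fun x => ψ x • outerNormal F x := fun k x hx => by
    beta_reduce
    rw [hψ.2 k x hx, hF.outerNormal_add hp hx]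
  have hder : ∀ {X : Type} [NormedAddCommGroup X] [NormedSpace ℝ X] (γ : X → E3)
      (γ' : X →L[ℝ] E3) (a : X), HasFDerivAt γ γ' a → (∀ᶠ b in 𝓝 a, γ b ∈ frontier F) →
      ∃ D : X →L[ℝ] E3, HasFDerivAt (fun b => ψ (γ b) • outerNormal F (γ b)) D a ∧
        ∀ w, ‖D w‖ ≤ N * δ * ‖γ' w‖ := by
    intro X _ _ γ γ' a hγ hm
    have hx := hm.self_of_nhds
    obtain ⟨h3, h4⟩ := h ψ hψ δ hδ hsob _ hx
    obtain ⟨D, hD, h5⟩ := exists_hasFDerivAt_smul_outerNormal hF hψs hγ hm h3 h4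
      fun i => hΛL i _ hx
    exact ⟨D, hD, fun w => (h5 w).trans_eq (by rw [hN]; ring)⟩
  refine ⟨hper, fun x hx => ?_, fun x hx y hy hxy => ?_, fun γ γ' a hγ hm => ?_⟩
  · rw [norm_smul, hF.norm_outerNormal hx, mul_one, Real.norm_eq_abs]
    refine ((h ψ hψ δ hδ hsob x hx).1.trans ?_).trans hNR
    gcongr
  · obtain ⟨i, k, hik⟩ := 𝒜.exists_patch y hy
    obtain ⟨a, ha, hax⟩ := hik x hx hxy
    obtain ⟨b, hb, hby⟩ := hik y hy (by simpa using 𝒜.scale_pos)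
    set P := 𝒜.patch i
    have hPd : ∀ c ∈ P.dom, ∃ D : E2 →L[ℝ] E3,
        HasFDerivAt (fun c => ψ (P.map c) • outerNormal F (P.map c)) D c ∧ ‖D‖ ≤ N * δ * R := by
      intro c hc
      obtain ⟨D, hD, h5⟩ := hder P.map _ c (P.differentiableAt_map hc).hasFDerivAt
        (P.eventually_mem_frontier hc)
      refine ⟨D, hD, D.opNorm_le_bound (by nlinarith [mul_pos hM hδ]) fun w => (h5 w).trans ?_⟩
      rw [mul_assoc (N * δ)]
      have hNδ : 0 ≤ N * δ := mul_nonneg (hM.le.trans hN0) hδ.le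
      gcongr
      refine (ContinuousLinearMap.le_opNorm _ _).trans ?_
      gcongr
      exact (P.norm_fderiv_le c hc).trans (hRb i)
    have h6 := (convex_ball (P.T.proj P.x) P.r).norm_image_sub_le_of_norm_hasFDerivWithin_le
      (f := fun c => ψ (P.map c) • outerNormal F (P.map c))
      (f' := fun c => fderiv ℝ (fun c => ψ (P.map c) • outerNormal F (P.map c)) c)
      (C := N * δ * R) (x := b) (y := a)
      (fun c hc => by
        obtain ⟨D, hD, -⟩ := hPd c hc
        exact hD.differentiableAt.hasFDerivAt.hasFDerivWithinAt)
      (fun c hc => by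
        obtain ⟨D, hD, h7⟩ := hPd c hc
        rwa [hD.fderiv]) hb ha
    rw [hax, hby, hψ.2 k x hx, hψ.2 k y hy, hF.outerNormal_add hp hx, hF.outerNormal_add hp hy]
      at h6
    rw [show N * δ * R = N * R * δ by ring] at h6
    refine h6.trans ?_
    have h8 := P.norm_sub_le a b
    rw [hax, hby, add_sub_add_right_eq_sub] at h8
    have : 0 ≤ N * R * δ := by nlinarith [mul_pos hM hδ]
    gcongr
  · obtain ⟨D, hD, h5⟩ := hder γ γ' a hγ hm
    exact ⟨D, hD, fun w => (h5 w).trans (by gcongr)⟩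

end SmallField

/-! ### The boundary of a small deformation -/

def deform (V : E3 → E3) (x : E3) : E3 := x + V x

/-- The boundary of `E` is the image of the boundary of `F` under a small deformation. -/
structure IsDeformation (F E : Set E3) (V : E3 → E3) (t : ℝ) : Prop where
  smooth : IsSmoothSet F
  periodic : IsPeriodicSet F
  smooth' : IsSmoothSet E
  periodic' : IsPeriodicSet E
  pos : 0 < t
  le_half : t ≤ 1 / 2
  small : ∃ ρ, 4 * t ≤ ρ ∧ IsSmallField F V ρ t
  image_eq : frontier E = deform V '' frontier F

namespace IsDeformation

variable {F E : Set E3} {V : E3 → E3} {t : ℝ}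

theorem deform_mem (h : IsDeformation F E V t) {x : E3} (hx : x ∈ frontier F) :
    deform V x ∈ frontier E := h.image_eq ▸ Set.mem_image_of_mem _ hx

theorem deform_add (h : IsDeformation F E V t) {x : E3} (hx : x ∈ frontier F) (k : Fin 3 → ℤ) :
    deform V (x + latticeVec k) = deform V x + latticeVec k := by
  obtain ⟨ρ, -, hs⟩ := h.small
  rw [deform, deform, hs.periodic k x hx, add_right_comm]

/-- Since `|V| ≤ t`, points whose images are closer than `2t` are themselves closer than `4t ≤ ρ`,
where the Lipschitz bound holds. Global injectivity and the local Lipschitz bound for the inverse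
follow from this. -/
theorem norm_field_sub_le (h : IsDeformation F E V t) {x y : E3} (hx : x ∈ frontier F)
    (hy : y ∈ frontier F) (hxy : ‖deform V x - deform V y‖ < 2 * t) :
    ‖V x - V y‖ ≤ t * ‖x - y‖ := by
  obtain ⟨ρ, hρ, hs⟩ := h.small
  refine hs.lipschitz x hx y hy ?_
  have h1 : x - y = (deform V x - deform V y) - (V x - V y) := by rw [deform, deform]; abel
  have h2 := norm_sub_le (V x) (V y)
  have h3 := norm_sub_le (deform V x - deform V y) (V x - V y)
  rw [← h1] at h3
  rw [dist_eq_norm]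
  linarith [hs.norm_le x hx, hs.norm_le y hy]

theorem injOn (h : IsDeformation F E V t) : Set.InjOn (deform V) (frontier F) := by
  intro x hx y hy hxy
  have h1 := h.norm_field_sub_le hx hy (by rw [hxy, sub_self, norm_zero]; linarith [h.pos])
  have h2 : x - y = -(V x - V y) := by
    have : x + V x = y + V y := hxy
    rw [neg_sub, sub_eq_sub_iff_add_eq_add, this, add_comm]
  have h3 : ‖x - y‖ ≤ 1 / 2 * ‖x - y‖ := by
    calc ‖x - y‖ = ‖V x - V y‖ := by rw [h2, norm_neg]
      _ ≤ t * ‖x - y‖ := h1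
      _ ≤ _ := by gcongr; exact h.le_half
  have h4 : ‖x - y‖ = 0 := le_antisymm (by linarith) (norm_nonneg _)
  exact sub_eq_zero.1 (norm_eq_zero.1 h4)

theorem continuousOn (h : IsDeformation F E V t) : ContinuousOn (deform V) (frontier F) := by
  obtain ⟨ρ, hρ, hs⟩ := h.small
  have hρ0 : 0 < ρ := by linarith [h.pos]
  intro x hx
  have hV : Tendsto V (𝓝[frontier F] x) (𝓝 (V x)) := by
    rw [tendsto_iff_norm_sub_tendsto_zero]
    have h1 : Tendsto (fun y => t * ‖y - x‖) (𝓝[frontier F] x) (𝓝 0) := by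
      have : ContinuousAt (fun y => t * ‖y - x‖) x := by fun_prop
      simpa [ContinuousAt] using this.tendsto.mono_left nhdsWithin_le_nhds
    refine squeeze_zero' (Eventually.of_forall fun y => norm_nonneg _) ?_ h1
    filter_upwards [self_mem_nhdsWithin,
      mem_nhdsWithin_of_mem_nhds (Metric.ball_mem_nhds x hρ0)] with y hy hyx
    exact hs.lipschitz y hy x hx hyx
  exact (tendsto_id.mono_left nhdsWithin_le_nhds).add hV

theorem aemeasurable (h : IsDeformation F E V t) : AEMeasurable (deform V) (bdryMeasure F) :=
  h.continuousOn.aemeasurable isClosed_frontier.measurableSet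

/-- The preimage on the boundary of `F`. -/
theorem image_preimage (h : IsDeformation F E V t) {A : Set E3} (hA : A ⊆ frontier E) :
    deform V '' (frontier F ∩ deform V ⁻¹' A) = A := by
  rw [Set.image_inter_preimage, ← h.image_eq, Set.inter_eq_right.2 hA]

/-- On sets with image in a ball of radius `t`, the deformation has Lipschitz constant `1 + t` and
its inverse `1 / (1 - t)`. Both are at most `1 + 2t` for `t ≤ 1/2`, and area scales by the square.
-/
theorem local_le (h : IsDeformation F E V t) {A : Set E3} {y : E3} (hA : A ⊆ frontier E)
    (hAy : A ⊆ Metric.ball y t) :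
    μHE[2] A ≤ ENNReal.ofReal (1 + 2 * t) ^ 2 * μHE[2] (frontier F ∩ deform V ⁻¹' A) ∧
      μHE[2] (frontier F ∩ deform V ⁻¹' A) ≤ ENNReal.ofReal (1 + 2 * t) ^ 2 * μHE[2] A := by
  have ht := h.pos
  set B := frontier F ∩ deform V ⁻¹' A with hB
  have hclose : ∀ a ∈ B, ∀ b ∈ B, ‖V a - V b‖ ≤ t * ‖a - b‖ := by
    intro a ha b hb
    refine h.norm_field_sub_le ha.1 hb.1 ?_
    rw [← dist_eq_norm]
    have h1 := Metric.mem_ball.1 (hAy ha.2)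
    have h2 := Metric.mem_ball.1 (hAy hb.2)
    linarith [dist_triangle_right (deform V a) (deform V b) y]
  have hsplit : ∀ a b, deform V a - deform V b = (a - b) + (V a - V b) := fun a b => by
    rw [deform, deform]; abel
  have hcoe : ((Real.toNNReal (1 + 2 * t) : NNReal) : ℝ≥0∞) = ENNReal.ofReal (1 + 2 * t) := rfl
  rw [← hcoe]
  constructor
  · have hlip : LipschitzOnWith (Real.toNNReal (1 + 2 * t)) (deform V) B := by
      refine LipschitzOnWith.of_dist_le_mul fun a ha b hb => ?_
      rw [Real.coe_toNNReal _ (by linarith), dist_eq_norm, dist_eq_norm, hsplit]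
      have h1 := norm_add_le (a - b) (V a - V b)
      have h2 := hclose a ha b hb
      nlinarith [mul_nonneg ht.le (norm_nonneg (a - b))]
    have h3 := LipschitzOnWith.euclideanHausdorffMeasure_image_le hlip
    rwa [h.image_preimage hA] at h3
  · set Ψ := Function.invFunOn (deform V) (frontier F) with hΨ
    have hleft : ∀ a ∈ frontier F, Ψ (deform V a) = a := fun a ha => h.injOn.leftInvOn_invFunOn ha
    have himg : Ψ '' A = B := by
      rw [← h.image_preimage hA, Set.image_image, ← hB]
      exact (Set.image_congr fun a ha => hleft a ha.1).trans (Set.image_id' _)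
    have hlip : LipschitzOnWith (Real.toNNReal (1 + 2 * t)) Ψ A := by
      refine LipschitzOnWith.of_dist_le_mul fun y hy z hz => ?_
      rw [← h.image_preimage hA] at hy hz
      obtain ⟨a, ha, rfl⟩ := hy
      obtain ⟨b, hb, rfl⟩ := hz
      rw [hleft a ha.1, hleft b hb.1, Real.coe_toNNReal _ (by linarith), dist_eq_norm,
        dist_eq_norm]
      have h2 := hclose a ha b hb
      have h3 : ‖a - b‖ ≤ ‖deform V a - deform V b‖ + ‖V a - V b‖ := by
        calc ‖a - b‖ = ‖(deform V a - deform V b) - (V a - V b)‖ := by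
              rw [hsplit, add_sub_cancel_right]
          _ ≤ _ := norm_sub_le _ _
      have h4 : (1 - t) * ‖a - b‖ ≤ ‖deform V a - deform V b‖ := by linarith
      have h5 : (1 + 2 * t) * ((1 - t) * ‖a - b‖) ≤ (1 + 2 * t) * ‖deform V a - deform V b‖ := by
        gcongr
      have h6 : 0 ≤ t * (1 - 2 * t) * ‖a - b‖ := by
        have := h.le_half
        have : 0 ≤ 1 - 2 * t := by linarith
        positivity
      linarith
    have h3 := LipschitzOnWith.euclideanHausdorffMeasure_image_le hlip
    rwa [himg] at h3

theorem map_apply (h : IsDeformation F E V t) {A : Set E3} (hA : MeasurableSet A) :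
    (bdryMeasure F).map (deform V) A = μHE[2] (frontier F ∩ deform V ⁻¹' A) := by
  rw [Measure.map_apply_of_aemeasurable h.aemeasurable hA, bdryMeasure,
    Measure.restrict_apply₀' isClosed_frontier.measurableSet.nullMeasurableSet, Set.inter_comm]

/-- The bounds on balls of radius `t` are glued by `measure_le_of_locally_le` without enlarging the
factor. -/
theorem bdryMeasure_le (h : IsDeformation F E V t) :
    bdryMeasure E ≤ ENNReal.ofReal (1 + 2 * t) ^ 2 • (bdryMeasure F).map (deform V) := by
  refine Measure.le_iff.2 fun B hB => ?_
  have hm := hB.inter (isClosed_frontier (s := E)).measurableSet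
  rw [bdryMeasure, Measure.restrict_apply hB, Measure.smul_apply, smul_eq_mul]
  refine (measure_le_of_locally_le (μ := μHE[2]) (ν := (bdryMeasure F).map (deform V))
    (S := frontier E) (fun y hy => ⟨_, Metric.ball_mem_nhds y h.pos, fun A hA hAm => ?_⟩)
    Set.inter_subset_right hm).trans (by gcongr; exact Set.inter_subset_left)
  rw [h.map_apply hAm]
  exact (h.local_le (hA.trans Set.inter_subset_right) (hA.trans Set.inter_subset_left)).1

theorem map_le (h : IsDeformation F E V t) :
    (bdryMeasure F).map (deform V) ≤ ENNReal.ofReal (1 + 2 * t) ^ 2 • bdryMeasure E := by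
  refine Measure.le_iff.2 fun B hB => ?_
  have hm := hB.inter (isClosed_frontier (s := E)).measurableSet
  rw [show bdryMeasure E = (μHE[2]).restrict (frontier E) from rfl, Measure.smul_apply, smul_eq_mul,
    Measure.restrict_apply hB]
  have h1 : (bdryMeasure F).map (deform V) B =
      (bdryMeasure F).map (deform V) (B ∩ frontier E) := by
    rw [h.map_apply hB, h.map_apply hm]
    congr 1
    ext x
    constructor
    · rintro ⟨hx, hxB⟩
      exact ⟨hx, hxB, h.deform_mem hx⟩
    · rintro ⟨hx, hxB, -⟩
      exact ⟨hx, hxB⟩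
  rw [h1]
  refine measure_le_of_locally_le (μ := (bdryMeasure F).map (deform V)) (ν := μHE[2])
    (S := frontier E) (fun y hy => ⟨_, Metric.ball_mem_nhds y h.pos, fun A hA hAm => ?_⟩)
    Set.inter_subset_right hm
  rw [h.map_apply hAm]
  exact (h.local_le (hA.trans Set.inter_subset_right) (hA.trans Set.inter_subset_left)).2

/-- The image of the part of `∂F` in the unit cell. -/
def domain (F : Set E3) (V : E3 → E3) : Set E3 := deform V '' (frontier F ∩ unitCell)

theorem measurableSet_image (h : IsDeformation F E V t) {A : Set E3} (hA : A ⊆ frontier F)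
    (hAm : MeasurableSet A) : MeasurableSet (deform V '' A) :=
  hAm.image_of_continuousOn_injOn (h.continuousOn.mono hA) (h.injOn.mono hA)

theorem measurableSet_domain (h : IsDeformation F E V t) : MeasurableSet (domain F V) :=
  h.measurableSet_image Set.inter_subset_left
    (isClosed_frontier.measurableSet.inter measurableSet_unitCell)

theorem deform_mem_image_iff (h : IsDeformation F E V t) {A : Set E3} (hA : A ⊆ frontier F)
    {x : E3} (hx : x ∈ frontier F) : deform V x ∈ deform V '' A ↔ x ∈ A :=
  h.injOn.mem_image_iff hA hx

theorem existsUnique_domain (h : IsDeformation F E V t) {y : E3} (hy : y ∈ frontier E) :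
    ∃! k : Fin 3 → ℤ, y + latticeVec k ∈ domain F V := by
  rw [h.image_eq] at hy
  obtain ⟨x, hx, rfl⟩ := hy
  have hiff : ∀ k, deform V x + latticeVec k ∈ domain F V ↔ x + latticeVec k ∈ unitCell := by
    intro k
    have hk := (h.periodic.frontier k x).2 hx
    rw [← h.deform_add hx, domain, h.deform_mem_image_iff Set.inter_subset_left hk]
    exact ⟨fun hh => hh.2, fun hh => ⟨hk, hh⟩⟩
  simp only [hiff]
  exact existsUnique_unitCell x

/-- The surface measure of `E`, on the image of the unit cell. -/
def measure (F E : Set E3) (V : E3 → E3) : Measure E3 := (bdryMeasure E).restrict (domain F V)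

/-- A deformation commutes with lattice translations, so the image of the unit cell is a fundamental
domain for `∂E`. Integrals over it can be compared directly with the push-forward of `surfMeasure
F`. -/
theorem lintegral_measure (h : IsDeformation F E V t) {f : E3 → ℝ≥0∞}
    (hf : IsPeriodicOnBdry E f) :
    ∫⁻ x, f x ∂(measure F E V) = ∫⁻ x, f x ∂(surfMeasure E) :=
  setLIntegral_domain h.periodic' h.measurableSet_domain (fun _ hx => h.existsUnique_domain hx) hf

theorem integral_measure (h : IsDeformation F E V t) {f : E3 → ℝ}
    (hf : IsPeriodicOnBdry E f) :
    ∫ x, f x ∂(measure F E V) = ∫ x, f x ∂(surfMeasure E) :=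
  setIntegral_domain h.periodic' h.measurableSet_domain (fun _ hx => h.existsUnique_domain hx) hf

theorem aemeasurable_surf (h : IsDeformation F E V t) :
    AEMeasurable (deform V) (surfMeasure F) := by
  rw [surfMeasure_eq]
  exact h.aemeasurable.restrict

theorem map_surfMeasure (h : IsDeformation F E V t) :
    (surfMeasure F).map (deform V) =
      ((bdryMeasure F).map (deform V)).restrict (domain F V) := by
  rw [Measure.restrict_map_of_aemeasurable h.aemeasurable h.measurableSet_domain, surfMeasure_eq]
  congr 1
  rw [bdryMeasure, Measure.restrict_restrict' isClosed_frontier.measurableSet,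
    Measure.restrict_restrict' isClosed_frontier.measurableSet]
  congr 1
  ext x
  constructor
  · rintro ⟨hx, hxF⟩
    exact ⟨⟨x, ⟨hxF, hx⟩, rfl⟩, hxF⟩
  · rintro ⟨hx, hxF⟩
    exact ⟨((h.deform_mem_image_iff Set.inter_subset_left hxF).1 hx).2, hxF⟩

theorem measure_le (h : IsDeformation F E V t) :
    measure F E V ≤ ENNReal.ofReal (1 + 2 * t) ^ 2 • (surfMeasure F).map (deform V) := by
  rw [h.map_surfMeasure, ← Measure.restrict_smul]
  exact Measure.restrict_mono_measure h.bdryMeasure_le _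

theorem le_measure (h : IsDeformation F E V t) :
    (surfMeasure F).map (deform V) ≤ ENNReal.ofReal (1 + 2 * t) ^ 2 • measure F E V := by
  rw [h.map_surfMeasure, measure, ← Measure.restrict_smul]
  exact Measure.restrict_mono_measure h.map_le _

theorem hasFDerivAt_deform (h : IsDeformation F E V t) {X : Type} [NormedAddCommGroup X]
    [NormedSpace ℝ X] {γ : X → E3} {γ' : X →L[ℝ] E3} {a : X} (hγ : HasFDerivAt γ γ' a)
    (hm : ∀ᶠ b in 𝓝 a, γ b ∈ frontier F) :
    ∃ D : X →L[ℝ] E3, HasFDerivAt (fun b => deform V (γ b)) (γ' + D) a ∧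
      ∀ w, ‖D w‖ ≤ t * ‖γ' w‖ := by
  obtain ⟨ρ, -, hs⟩ := h.small
  obtain ⟨D, hD, hle⟩ := hs.hasFDerivAt γ γ' a hγ hm
  exact ⟨D, hγ.add hD, hle⟩

/-- A deformation lengthens velocities by a factor at most `1 + t ≤ 2`. -/
theorem isUpperGradient (h : IsDeformation F E V t) {u : E3 → ℝ} {g : E3 → ℝ≥0∞}
    (hu : IsUpperGradient E u g) :
    IsUpperGradient F (fun x => u (deform V x)) (fun x => 2 * g (deform V x)) where
  periodic k x hx := by
    beta_reduce
    rw [h.deform_add hx, hu.periodic k _ (h.deform_mem hx)]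
  periodic_grad k x hx := by
    beta_reduce
    rw [h.deform_add hx, hu.periodic_grad k _ (h.deform_mem hx)]
  differentiableAt γ a hγ hm := by
    obtain ⟨D, hD, -⟩ := h.hasFDerivAt_deform hγ.hasFDerivAt hm
    exact hu.differentiableAt _ a hD.differentiableAt (hm.mono fun b hb => h.deform_mem hb)
  enorm_fderiv_le γ a hγ hm := by
    obtain ⟨D, hD, hle⟩ := h.hasFDerivAt_deform hγ.hasFDerivAt hm
    refine (hu.enorm_fderiv_le _ a hD.differentiableAt
      (hm.mono fun b hb => h.deform_mem hb)).trans ?_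
    rw [hD.fderiv, mul_comm (2 : ℝ≥0∞), mul_assoc]
    gcongr
    have h1 : ‖fderiv ℝ γ a + D‖ ≤ 2 * ‖fderiv ℝ γ a‖ := by
      have h2 : ‖D‖ ≤ t * ‖fderiv ℝ γ a‖ :=
        D.opNorm_le_bound (mul_nonneg h.pos.le (norm_nonneg _)) fun w => (hle w).trans (by
          rw [mul_assoc]
          exact mul_le_mul_of_nonneg_left (ContinuousLinearMap.le_opNorm _ _) h.pos.le)
      have h3 := norm_add_le (fderiv ℝ γ a) D
      nlinarith [h.le_half, norm_nonneg (fderiv ℝ γ a)]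
    rw [← ofReal_norm, ← ofReal_norm]
    refine (ENNReal.ofReal_le_ofReal h1).trans_eq ?_
    rw [ENNReal.ofReal_mul zero_le_two, ENNReal.ofReal_ofNat]

/-- The cosine of the angle between the normals of `E` and `F`. -/
def cosine (F E : Set E3) (V : E3 → E3) (x : E3) : ℝ :=
  inner ℝ (outerNormal E (deform V x)) (outerNormal F x)

/-- The orientation of the deformation. -/
def orientation (F E : Set E3) (V : E3 → E3) (x : E3) : ℝ := if 0 < cosine F E V x then 1 else -1

/-- Let `τ` be the part of `ν_E` tangential to `∂F`. A curve in `∂F` with velocity `τ` is deformed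
into one with velocity `τ + D`, orthogonal to `ν_E`. Hence `|τ|² = ⟨ν_E, τ⟩ = -⟨ν_E, D⟩ ≤ t |τ|`. -/
theorem norm_tangPart_outerNormal_le (h : IsDeformation F E V t) {x : E3}
    (hx : x ∈ frontier F) :
    ‖tangPart (outerNormal F x) (outerNormal E (deform V x))‖ ≤ t := by
  set n := outerNormal E (deform V x)
  set N := outerNormal F x
  set τ := tangPart N n with hτ
  have hN : ‖N‖ = 1 := h.smooth.norm_outerNormal hx
  have hn : ‖n‖ = 1 := h.smooth'.norm_outerNormal (h.deform_mem hx)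
  have hNτ : inner ℝ N τ = 0 := inner_tangPart_self hN
  obtain ⟨γ, hγ, hγ0, hm⟩ := h.smooth.exists_curve hx hNτ
  obtain ⟨D, hD, hle⟩ := h.hasFDerivAt_deform hγ.hasFDerivAt hm
  have h1 := h.smooth'.inner_outerNormal_fderiv hD (hm.mono fun b hb => h.deform_mem hb) 1
  have h2 := hle 1
  rw [hγ0] at h1
  simp only [add_apply, ContinuousLinearMap.toSpanSingleton_apply, one_smul,
    inner_add_right] at h1 h2
  have h3 : inner ℝ τ τ = inner ℝ n τ := inner_tangPart_of_orthogonal hNτ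
  rw [real_inner_self_eq_norm_sq] at h3
  have h4 := abs_real_inner_le_norm n (D 1)
  rw [hn, one_mul] at h4
  have h5 : inner ℝ n τ = -inner ℝ n (D 1) := by linarith
  have h6 := neg_abs_le (inner ℝ n (D 1))
  have h7 : ‖τ‖ ^ 2 ≤ t * ‖τ‖ := by linarith
  by_contra! hc
  nlinarith [h.pos]

theorem cosine_sq (h : IsDeformation F E V t) {x : E3} (hx : x ∈ frontier F) :
    1 - t ^ 2 ≤ cosine F E V x ^ 2 ∧ |cosine F E V x| ≤ 1 := by
  have h1 := h.norm_tangPart_outerNormal_le hx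
  have hN := h.smooth.norm_outerNormal hx
  have hn := h.smooth'.norm_outerNormal (h.deform_mem hx)
  have h2 : ‖tangPart (outerNormal F x) (outerNormal E (deform V x))‖ ^ 2 =
      1 - cosine F E V x ^ 2 := by
    rw [tangPart, norm_sub_sq_real, real_inner_smul_right, norm_smul, hN, hn, Real.norm_eq_abs,
      mul_one, sq_abs, cosine]
    ring
  refine ⟨?_, ?_⟩
  · nlinarith [norm_nonneg (tangPart (outerNormal F x) (outerNormal E (deform V x))), h.pos]
  · rw [abs_le_one_iff_mul_self_le_one]
    nlinarith [sq_nonneg ‖tangPart (outerNormal F x) (outerNormal E (deform V x))‖]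

theorem cosine_ne_zero (h : IsDeformation F E V t) {x : E3} (hx : x ∈ frontier F) :
    cosine F E V x ≠ 0 := by
  intro h0
  have h1 := (h.cosine_sq hx).1
  rw [h0] at h1
  nlinarith [h.pos, h.le_half]

/-- With this sign the squared distance is `2 - 2 |cos|`, and `|cos| ≥ cos² ≥ 1 - t²`. The sign
cannot be dropped, since nothing prescribes on which side of a component `E` lies. -/
theorem norm_outerNormal_sub_le (h : IsDeformation F E V t) {x : E3} (hx : x ∈ frontier F) :
    ‖outerNormal E (deform V x) - orientation F E V x • outerNormal F x‖ ≤ 2 * t := by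
  have hN := h.smooth.norm_outerNormal hx
  have hn := h.smooth'.norm_outerNormal (h.deform_mem hx)
  obtain ⟨h1, h2⟩ := h.cosine_sq hx
  have hs : orientation F E V x ^ 2 = 1 ∧ orientation F E V x * cosine F E V x =
      |cosine F E V x| := by
    by_cases hc : 0 < cosine F E V x
    · simp only [orientation, hc, if_true, abs_of_pos hc]; norm_num
    · simp only [orientation, hc, if_false, abs_of_nonpos (not_lt.1 hc)]; norm_num
  have h3 : ‖outerNormal E (deform V x) - orientation F E V x • outerNormal F x‖ ^ 2 =
      2 - 2 * |cosine F E V x| := by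
    rw [norm_sub_sq_real, real_inner_smul_right, norm_smul, hN, hn, Real.norm_eq_abs,
      mul_one, sq_abs, hs.1, ← cosine, hs.2]
    ring
  have h4 : cosine F E V x ^ 2 ≤ |cosine F E V x| := by
    rw [← sq_abs]
    nlinarith [abs_nonneg (cosine F E V x)]
  refine abs_le_of_sq_le_sq' ?_ (by linarith [h.pos]) |>.2
  rw [h3]
  nlinarith [sq_nonneg t]

/-- The cosine is continuous on the boundary and never zero. -/
theorem isLocallyConst_orientation (h : IsDeformation F E V t) :
    IsLocallyConstOnBdry F (orientation F E V) := by
  have hc : ContinuousOn (cosine F E V) (frontier F) :=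
    (h.smooth'.continuousOn_outerNormal.comp h.continuousOn fun x hx => h.deform_mem hx).inner
      h.smooth.continuousOn_outerNormal
  intro x hx
  rcases lt_or_gt_of_ne (h.cosine_ne_zero hx) with h0 | h0
  · filter_upwards [(hc x hx).eventually (gt_mem_nhds h0)] with y hy
    simp only [orientation, not_lt.2 hy.le, not_lt.2 h0.le]
  · filter_upwards [(hc x hx).eventually (lt_mem_nhds h0)] with y hy
    simp only [orientation, hy, h0]

theorem isPeriodic_orientation (h : IsDeformation F E V t) :
    IsPeriodicOnBdry F (orientation F E V) := fun k x hx => by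
  have : cosine F E V (x + latticeVec k) = cosine F E V x := by
    rw [cosine, cosine, h.deform_add hx, h.smooth.outerNormal_add h.periodic hx,
      h.smooth'.outerNormal_add h.periodic' (h.deform_mem hx)]
  rw [orientation, orientation, this]

end IsDeformation

theorem sq_lintegral_le {X : Type*} [MeasurableSpace X] {μ : Measure X} {f : X → ℝ≥0∞}
    (hf : AEMeasurable f μ) : (∫⁻ x, f x ∂μ) ^ 2 ≤ μ Set.univ * ∫⁻ x, f x ^ 2 ∂μ := by
  have h3 := ENNReal.lintegral_mul_le_Lp_mul_Lq μ Real.HolderConjugate.two_two hf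
    (aemeasurable_const (b := (1 : ℝ≥0∞)))
  simp only [Pi.mul_apply, mul_one, lintegral_const, ENNReal.rpow_ofNat, one_pow, one_mul] at h3
  calc _ ≤ ((∫⁻ x, f x ^ 2 ∂μ) ^ (1 / (2 : ℝ)) * μ Set.univ ^ (1 / (2 : ℝ))) ^ 2 := by gcongr
    _ = _ := by
        rw [mul_pow, ← ENNReal.rpow_natCast, ← ENNReal.rpow_natCast, ← ENNReal.rpow_mul,
          ← ENNReal.rpow_mul, mul_comm]
        norm_num

/-! ### Transfer of integrals and components between the two boundaries -/

namespace IsDeformation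

variable {F E : Set E3} {V : E3 → E3} {t : ℝ}

theorem factor_le (h : IsDeformation F E V t) : ENNReal.ofReal (1 + 2 * t) ^ 2 ≤ 4 := by
  have h1 : ENNReal.ofReal (1 + 2 * t) ≤ 2 := by
    rw [← ENNReal.ofReal_ofNat]
    exact ENNReal.ofReal_le_ofReal (by linarith [h.le_half])
  calc _ ≤ (2 : ℝ≥0∞) ^ 2 := by gcongr
    _ = 4 := by norm_num

theorem aemeasurable_measure {β : Type*} [MeasurableSpace β] {f : E3 → β}
    (hf : AEMeasurable f (bdryMeasure E)) : AEMeasurable f (measure F E V) := hf.restrict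

theorem aemeasurable_map (h : IsDeformation F E V t) {β : Type*} [MeasurableSpace β] {f : E3 → β}
    (hf : AEMeasurable f (bdryMeasure E)) :
    AEMeasurable f ((surfMeasure F).map (deform V)) :=
  ((aemeasurable_measure hf).smul_measure _).mono_measure h.le_measure

theorem restrict_map (h : IsDeformation F E V t) {S : Set E3} (hS : S ⊆ frontier F)
    (hSm : MeasurableSet S) : ((surfMeasure F).map (deform V)).restrict (deform V '' S) =
      ((surfMeasure F).restrict S).map (deform V) := by
  rw [Measure.restrict_map_of_aemeasurable h.aemeasurable_surf (h.measurableSet_image hS hSm)]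
  congr 1
  refine Measure.restrict_congr_set ?_
  filter_upwards [ae_mem_frontier F] with x hx
  exact propext (h.deform_mem_image_iff hS hx)

theorem setLIntegral_map (h : IsDeformation F E V t) {S : Set E3} (hS : S ⊆ frontier F)
    (hSm : MeasurableSet S) {f : E3 → ℝ≥0∞} (hf : AEMeasurable f (bdryMeasure E)) :
    ∫⁻ y in deform V '' S, f y ∂((surfMeasure F).map (deform V)) =
      ∫⁻ x in S, f (deform V x) ∂(surfMeasure F) := by
  have h1 := (h.aemeasurable_map hf).restrict (s := deform V '' S)
  rw [h.restrict_map hS hSm] at h1 ⊢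
  exact lintegral_map' h1 h.aemeasurable_surf.restrict

theorem setLIntegral_image_le (h : IsDeformation F E V t) {S : Set E3} (hS : S ⊆ frontier F)
    (hSm : MeasurableSet S) {f : E3 → ℝ≥0∞} (hf : AEMeasurable f (bdryMeasure E)) :
    ∫⁻ y in deform V '' S, f y ∂(measure F E V) ≤
      ENNReal.ofReal (1 + 2 * t) ^ 2 * ∫⁻ x in S, f (deform V x) ∂(surfMeasure F) := by
  rw [← h.setLIntegral_map hS hSm hf, ← smul_eq_mul, ← lintegral_smul_measure, ← Measure.restrict_smul]
  exact lintegral_mono' (Measure.restrict_mono_measure h.measure_le _) le_rfl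

theorem lintegral_measure_le (h : IsDeformation F E V t) {f : E3 → ℝ≥0∞}
    (hf : AEMeasurable f (bdryMeasure E)) :
    ∫⁻ y, f y ∂(measure F E V) ≤ 4 * ∫⁻ x, f (deform V x) ∂(surfMeasure F) := by
  rw [← lintegral_map' (h.aemeasurable_map hf) h.aemeasurable_surf]
  refine (lintegral_mono' h.measure_le le_rfl).trans ?_
  rw [lintegral_smul_measure, smul_eq_mul]
  gcongr
  exact h.factor_le

theorem lintegral_deform_le (h : IsDeformation F E V t) {f : E3 → ℝ≥0∞}
    (hf : AEMeasurable f (bdryMeasure E)) :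
    ∫⁻ x, f (deform V x) ∂(surfMeasure F) ≤ 4 * ∫⁻ y, f y ∂(measure F E V) := by
  rw [← lintegral_map' (h.aemeasurable_map hf) h.aemeasurable_surf]
  refine (lintegral_mono' h.le_measure le_rfl).trans ?_
  rw [lintegral_smul_measure, smul_eq_mul]
  gcongr
  exact h.factor_le

theorem measure_image_le (h : IsDeformation F E V t) {S : Set E3} (hS : S ⊆ frontier F)
    (hSm : MeasurableSet S) :
    measure F E V (deform V '' S) ≤ ENNReal.ofReal (1 + 2 * t) ^ 2 * surfMeasure F S := by
  have h1 := h.setLIntegral_image_le hS hSm (f := fun _ => 1) aemeasurable_const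
  simpa using h1

theorem isFiniteMeasure (h : IsDeformation F E V t) : IsFiniteMeasure (measure F E V) := by
  have := isFiniteMeasure_surfMeasure h.smooth
  refine ⟨?_⟩
  have h1 := h.lintegral_measure_le (f := fun _ => 1) aemeasurable_const
  simp only [lintegral_one] at h1
  exact h1.trans_lt (by finiteness)

theorem ae_measure {P : E3 → Prop} (hP : ∀ x ∈ frontier E, P x) : ∀ᵐ x ∂(measure F E V), P x :=
  ae_restrict_of_ae (ae_bdry hP)

theorem eventually_image_iff (h : IsDeformation F E V t) {S : Set E3} (hS : IsComponent F S)
    {y : E3} (hy : y ∈ frontier E) :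
    ∀ᶠ z in 𝓝[frontier E] y, (z ∈ deform V '' S ↔ y ∈ deform V '' S) := by
  rw [h.image_eq] at hy
  obtain ⟨x, hx, rfl⟩ := hy
  obtain ⟨ε, hε, hball⟩ := Metric.mem_nhdsWithin_iff.1 (hS.eventually_mem_iff x hx)
  -- The bound `2t` makes the Lipschitz estimate available; since `1 - t ≥ 1/2`, images closer than
  -- `ε / 2` then come from points closer than `ε`.
  have hr : 0 < min (2 * t) (ε / 2) := lt_min (by linarith [h.pos]) (by linarith)
  filter_upwards [self_mem_nhdsWithin,
    mem_nhdsWithin_of_mem_nhds (Metric.ball_mem_nhds (deform V x) hr)] with z hz hzx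
  rw [h.image_eq] at hz
  obtain ⟨x', hx', rfl⟩ := hz
  rw [Metric.mem_ball, dist_eq_norm, lt_min_iff] at hzx
  rw [h.deform_mem_image_iff hS.subset hx', h.deform_mem_image_iff hS.subset hx]
  refine hball ⟨?_, hx'⟩
  rw [Metric.mem_ball, dist_eq_norm]
  have h1 := h.norm_field_sub_le hx' hx hzx.1
  have h2 : x' - x = (deform V x' - deform V x) - (V x' - V x) := by rw [deform, deform]; abel
  have h3 := norm_sub_le (deform V x' - deform V x) (V x' - V x)
  rw [← h2] at h3
  nlinarith [h.le_half, norm_nonneg (x' - x)]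

theorem image_add_mem_iff (h : IsDeformation F E V t) {S : Set E3} (hS : IsComponent F S)
    (k : Fin 3 → ℤ) {y : E3} (hy : y ∈ frontier E) :
    y + latticeVec k ∈ deform V '' S ↔ y ∈ deform V '' S := by
  rw [h.image_eq] at hy
  obtain ⟨x, hx, rfl⟩ := hy
  rw [← h.deform_add hx, h.deform_mem_image_iff hS.subset hx,
    h.deform_mem_image_iff hS.subset ((h.periodic.frontier k x).2 hx), hS.periodic k x]

theorem exists_meanCurv_le (h : IsDeformation F E V t) :
    ∃ L : ℝ, 0 < L ∧ ∀ x ∈ frontier E, ‖meanCurv E x‖ ≤ L :=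
  exists_norm_le_of_isPeriodic h.periodic' h.smooth'.isLocallySmooth_meanCurv.continuousOn
    (h.smooth'.isPeriodic_meanCurv h.periodic')

theorem integrable_of_bound (h : IsDeformation F E V t) {f : E3 → ℝ}
    (hf : ContinuousOn f (frontier E)) {L : ℝ} (hL : ∀ x ∈ frontier E, ‖f x‖ ≤ L) :
    Integrable f (measure F E V) := by
  have := h.isFiniteMeasure
  exact Integrable.of_bound (aestronglyMeasurable_bdry hf).restrict L (ae_measure hL)

/-- The weighted average of the normal vanishes on each component of the boundary. -/
theorem setIntegral_meanCurv_inner (h : IsDeformation F E V t) {S : Set E3}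
    (hS : IsComponent F S) (η : E3) :
    ∫ y in deform V '' S, meanCurv E y * inner ℝ η (outerNormal E y) ∂(measure F E V) = 0 := by
  classical
  set S' := deform V '' S with hS'
  have hm : MeasurableSet S' := h.measurableSet_image hS.subset hS.measurableSet
  -- The image of a component is relatively open and closed in `∂E`, so its indicator is an
  -- admissible locally constant weight.
  set χ : E3 → ℝ := S'.indicator fun _ => 1 with hχ
  have hχc : IsLocallyConstOnBdry E χ := fun y hy => by
    filter_upwards [h.eventually_image_iff hS hy] with z hz
    have hz' : z ∈ S' ↔ y ∈ S' := hz
    simp only [hχ, Set.indicator_apply, hz']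
  have hχp : IsPeriodicOnBdry E χ := fun k y hy => by
    simp only [hχ, Set.indicator_apply, hS', h.image_add_mem_iff hS k hy]
  obtain ⟨L, hL0, hL⟩ := h.exists_meanCurv_le
  have hν : ∀ i, ContinuousOn (fun y => outerNormal E y i) (frontier E) := fun i =>
    (h.smooth'.isLocallySmooth_outerNormal i).continuousOn
  have hint : ∀ i, Integrable (fun y => meanCurv E y * outerNormal E y i) (measure F E V) :=
    fun i => h.integrable_of_bound (h.smooth'.isLocallySmooth_meanCurv.continuousOn.mul (hν i))
      (L := L * 1) fun y hy => by
        rw [norm_mul]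
        have h1 := abs_apply_le_norm (outerNormal E y) i
        rw [h.smooth'.norm_outerNormal hy] at h1
        exact mul_le_mul (hL y hy) h1 (norm_nonneg _) hL0.le
  have hi : ∀ i, ∫ y in S', meanCurv E y * outerNormal E y i ∂(measure F E V) = 0 := by
    intro i
    have h1 := h.smooth'.integral_meanCurv_outerNormal h.periodic' hχc hχp i
    rw [← h.integral_measure (fun k y hy => by
      rw [hχp k y hy, h.smooth'.isPeriodic_meanCurv h.periodic' k y hy,
        h.smooth'.outerNormal_add h.periodic' hy])] at h1
    rw [← integral_indicator hm, ← h1]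
    refine integral_congr_ae (Eventually.of_forall fun y => ?_)
    by_cases hy : y ∈ S' <;> simp [hχ, hy]
  calc _ = ∫ y in S', ∑ i, η i * (meanCurv E y * outerNormal E y i) ∂(measure F E V) := by
        refine integral_congr_ae (Eventually.of_forall fun y => ?_)
        simp only [PiLp.inner_apply, RCLike.inner_apply, conj_trivial, Finset.mul_sum]
        exact Finset.sum_congr rfl fun i _ => by ring
    _ = ∑ i, η i * ∫ y in S', meanCurv E y * outerNormal E y i ∂(measure F E V) := by
        rw [integral_finsetSum _ fun i _ => ((hint i).integrableOn).const_mul _]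
        exact Finset.sum_congr rfl fun i _ => integral_const_mul _ _
    _ = 0 := by simp [hi]

/-- On each component, the orientation is constant almost everywhere. -/
theorem exists_orientation (h : IsDeformation F E V t) {S : Set E3} (hS : IsComponent F S) :
    ∃ σ : ℝ, σ ^ 2 = 1 ∧ ∀ᵐ x ∂((surfMeasure F).restrict S), orientation F E V x = σ := by
  have hc := h.isLocallyConst_orientation
  have hsm := h.smooth.isLocallySmooth_of_contDiffOn (hc.isSmoothOnBdry h.isPeriodic_orientation).1
  -- The orientation has zero gradient, so the Poincaré inequality forces it to equal a constant
  -- almost everywhere on `S`. As `S` has positive area, that constant is an attained value, hence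
  -- `1` or `-1`.
  obtain ⟨C, hC, hpoin⟩ := hS.poincare
  obtain ⟨c, hc1⟩ := hpoin _ _ (hsm.isUpperGradient h.smooth h.periodic h.isPeriodic_orientation)
  have h0 : ∫⁻ y, ‖tangGrad F (orientation F E V) y‖ₑ ^ 2 ∂(surfMeasure F) = 0 := by
    rw [lintegral_congr_ae (ae_surf (P := fun y =>
      ‖tangGrad F (orientation F E V) y‖ₑ ^ 2 = (fun _ => 0) y) fun y hy => by
        simp [tangGrad_eq_zero h.smooth hc hy])]
    simp
  rw [h0, mul_zero, nonpos_iff_eq_zero] at hc1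
  have hmeas : AEMeasurable (fun x => ‖orientation F E V x - c‖ₑ ^ 2)
      ((surfMeasure F).restrict S) := by
    have h1 := (hc.memLp h.smooth (M := 1) (fun x => by
      by_cases hx : 0 < cosine F E V x <;> simp [orientation, hx]) 1).1
    exact ((h1.sub aestronglyMeasurable_const).enorm.pow_const 2).restrict
  rw [lintegral_eq_zero_iff' hmeas] at hc1
  have hae : ∀ᵐ x ∂((surfMeasure F).restrict S), orientation F E V x = c := by
    filter_upwards [hc1] with x hx
    simpa [sub_eq_zero] using hx
  refine ⟨c, ?_, hae⟩
  have hne : NeZero ((surfMeasure F).restrict S) := by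
    obtain ⟨y, hy⟩ := hS.nonempty
    have h1 := surfMeasure_pos h.smooth h.periodic (hS.subset hy) hS.measurableSet hS.periodic
      ((hS.eventually_mem_iff y (hS.subset hy)).mono fun z hz => hz.2 hy)
    exact ⟨fun h2 => h1.ne' (Measure.restrict_eq_zero.1 h2)⟩
  obtain ⟨x, hx⟩ := hae.exists
  rw [← hx]
  by_cases hx : 0 < cosine F E V x <;> simp [orientation, hx]

end IsDeformation

/-! ### Flux of the normal through a component, and control of the mean curvature -/

namespace IsDeformation

variable {F E : Set E3} {V : E3 → E3} {t : ℝ}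

theorem continuousOn_inner_outerNormal (h : IsDeformation F E V t) (η : E3) :
    ContinuousOn (fun y => inner ℝ η (outerNormal E y)) (frontier E) :=
  continuousOn_const.inner h.smooth'.continuousOn_outerNormal

theorem abs_inner_outerNormal_le {E : Set E3} (hE : IsSmoothSet E) (η : E3) {y : E3}
    (hy : y ∈ frontier E) : ‖inner ℝ η (outerNormal E y)‖ ≤ ‖η‖ := by
  refine (norm_inner_le_norm _ _).trans ?_
  rw [hE.norm_outerNormal hy, mul_one]

/-- The flux through a component changes little under a small deformation. -/
theorem flux_lower_bound (h : IsDeformation F E V t) {S : Set E3} (hS : IsComponent F S) (η : E3) :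
    (∫ x in S, inner ℝ η (outerNormal F x) ∂(surfMeasure F)) -
        32 * t * (‖η‖ * (surfMeasure F).real S) ≤
      4 * |∫ y in deform V '' S, inner ℝ η (outerNormal E y) ∂(measure F E V)| := by
  have hfinF := isFiniteMeasure_surfMeasure h.smooth
  have hfinE := h.isFiniteMeasure
  have ht := h.pos
  have ht2 := h.le_half
  obtain ⟨σ, hσ, hσae⟩ := h.exists_orientation hS
  set S' := deform V '' S with hS'
  have hS'm : MeasurableSet S' := h.measurableSet_image hS.subset hS.measurableSet
  set n := ∫ x in S, inner ℝ η (outerNormal F x) ∂(surfMeasure F) with hn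
  set b := ∫ y in S', inner ℝ η (outerNormal E y) ∂(measure F E V) with hb
  set a := (surfMeasure F).real S with ha
  have ha0 : 0 ≤ a := measureReal_nonneg
  -- Adding `‖η‖` makes the integrand nonnegative, so that inequalities between measures can be
  -- integrated.
  set f : E3 → ℝ := fun y => σ * inner ℝ η (outerNormal E y) + ‖η‖ with hf
  set k : ℝ := (1 + 2 * t) ^ 2 with hk
  have hkK : ENNReal.ofReal (1 + 2 * t) ^ 2 = ENNReal.ofReal k :=
    (ENNReal.ofReal_pow (by linarith) 2).symm
  have hk0 : 0 ≤ k := sq_nonneg _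
  have hk1 : 1 ≤ k := by nlinarith
  have hk4 : k ≤ 4 := by nlinarith
  -- For `t ≤ 1/2` one has `k ≤ 1 + 6t`. The error `30t` here and `2t` from the normals make up the
  -- `32t` of the statement.
  have hkk : k ^ 2 ≤ 1 + 30 * t := by
    have h1 : k ≤ 1 + 6 * t := by nlinarith
    nlinarith
  have hσ1 : |σ| = 1 := by rwa [← sq_eq_sq₀ (abs_nonneg _) zero_le_one, sq_abs, one_pow]
  have hσb : σ * b ≤ |b| := (le_abs_self _).trans_eq (by rw [abs_mul, hσ1, one_mul])
  have hfc : ContinuousOn f (frontier E) :=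
    (continuousOn_const.mul (h.continuousOn_inner_outerNormal η)).add continuousOn_const
  have hfb : ∀ y ∈ frontier E, |σ * inner ℝ η (outerNormal E y)| ≤ ‖η‖ := fun y hy => by
    rw [abs_mul, hσ1, one_mul]
    exact abs_inner_outerNormal_le h.smooth' η hy
  have hf0 : ∀ y ∈ frontier E, 0 ≤ f y := fun y hy => by
    have := (abs_le.1 (hfb y hy)).1
    simp only [hf]
    linarith
  have hfi : Integrable f (measure F E V) :=
    h.integrable_of_bound hfc (L := ‖η‖ + ‖η‖) fun y hy => by
      refine (norm_add_le _ _).trans ?_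
      rw [norm_norm]
      gcongr
      exact hfb y hy
  have hgi : Integrable (fun y => inner ℝ η (outerNormal E y)) (measure F E V) :=
    h.integrable_of_bound (h.continuousOn_inner_outerNormal η) fun y hy =>
      abs_inner_outerNormal_le h.smooth' η hy
  have hν : (measure F E V).real S' ≤ k * a := by
    have h1 := h.measure_image_le hS.subset hS.measurableSet
    rw [hkK] at h1
    have h2 := ENNReal.toReal_mono (by finiteness) h1
    rwa [ENNReal.toReal_mul, ENNReal.toReal_ofReal hk0] at h2
  have hfν : ∫ y in S', f y ∂(measure F E V) ≤ σ * b + ‖η‖ * (k * a) := by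
    rw [hf, integral_add (hgi.const_mul σ).integrableOn (integrable_const _), integral_const_mul,
      integral_const, measureReal_restrict_apply_univ, smul_eq_mul, mul_comm _ ‖η‖]
    gcongr
  have hmap : ∫ y in S', f y ∂((surfMeasure F).map (deform V)) ≤
      k * ∫ y in S', f y ∂(measure F E V) := by
    have hle : ((surfMeasure F).map (deform V)).restrict S' ≤
        ENNReal.ofReal k • (measure F E V).restrict S' := by
      rw [← Measure.restrict_smul, ← hkK]
      exact Measure.restrict_mono_measure h.le_measure _
    have h1 := integral_mono_measure hle
      (Measure.ae_smul_measure (ae_restrict_of_ae (ae_measure hf0)) _)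
      (hfi.integrableOn.smul_measure ENNReal.ofReal_ne_top)
    rwa [integral_smul_measure, ENNReal.toReal_ofReal hk0, smul_eq_mul] at h1
  have hpull : ∫ y in S', f y ∂((surfMeasure F).map (deform V)) =
      ∫ x in S, f (deform V x) ∂(surfMeasure F) := by
    have h1 : AEStronglyMeasurable f
        ((((surfMeasure F).map (deform V))).restrict S') :=
      (h.aemeasurable_map (aestronglyMeasurable_bdry hfc).aemeasurable).aestronglyMeasurable.restrict
    rw [h.restrict_map hS.subset hS.measurableSet] at h1 ⊢
    exact integral_map h.aemeasurable_surf.restrict h1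
  have hlow : n - 2 * t * ‖η‖ * a + ‖η‖ * a ≤ ∫ x in S, f (deform V x) ∂(surfMeasure F) := by
    have hi := (integrable_inner_outerNormal h.smooth η).integrableOn (s := S)
    have h1 : ∫ x in S, (inner ℝ η (outerNormal F x) + (‖η‖ - 2 * t * ‖η‖)) ∂(surfMeasure F) =
        n - 2 * t * ‖η‖ * a + ‖η‖ * a := by
      rw [integral_add hi (integrable_const _), integral_const, measureReal_restrict_apply_univ,
        smul_eq_mul]
      ring
    rw [← h1]
    refine integral_mono_ae (hi.add (integrable_const _)) ?_ ?_
    · have hfiF : Integrable (fun x => f (deform V x)) (surfMeasure F) := by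
        refine Integrable.of_bound (C := ‖η‖ + ‖η‖) ?_ (ae_surf fun x hx => ?_)
        · rw [surfMeasure_eq]
          exact (aestronglyMeasurable_bdry
            (hfc.comp h.continuousOn fun x hx => h.deform_mem hx)).restrict
        · refine (norm_add_le _ _).trans ?_
          rw [norm_norm]
          gcongr
          exact hfb _ (h.deform_mem hx)
      exact hfiF.integrableOn
    · filter_upwards [hσae, ae_restrict_of_ae (ae_mem_frontier F)] with x hx hxF
      have h2 := h.norm_outerNormal_sub_le hxF
      rw [hx] at h2
      have h3 : σ * inner ℝ η (outerNormal E (deform V x)) = inner ℝ η (outerNormal F x) +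
          σ * inner ℝ η (outerNormal E (deform V x) - σ • outerNormal F x) := by
        rw [inner_sub_right, real_inner_smul_right]
        linear_combination inner ℝ η (outerNormal F x) * hσ
      have h4 : |σ * inner ℝ η (outerNormal E (deform V x) - σ • outerNormal F x)| ≤
          ‖η‖ * (2 * t) := by
        rw [abs_mul, hσ1, one_mul]
        exact (abs_real_inner_le_norm _ _).trans (by gcongr)
      have h5 := (abs_le.1 h4).1
      simp only [hf]
      rw [h3]
      linarith
  have hea : 0 ≤ ‖η‖ * a := by positivity
  -- The added terms `‖η‖ a` cancel up to the factor `k²`, since the area of the piece is itself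
  -- comparable on both boundaries.
  have h6 : n - 2 * t * ‖η‖ * a + ‖η‖ * a ≤ k * (σ * b + ‖η‖ * (k * a)) :=
    hlow.trans (hpull ▸ hmap.trans (by gcongr))
  have h7 : k * (σ * b) ≤ 4 * |b| := by
    calc k * (σ * b) ≤ k * |b| := by gcongr
      _ ≤ _ := by gcongr
  have h8 : k ^ 2 * (‖η‖ * a) ≤ (1 + 30 * t) * (‖η‖ * a) := by gcongr
  linarith

/-- As `H ν` has zero integral over the piece, `c` times the flux is `-∫ (H - c) ⟨η, ν⟩`, to which
Cauchy–Schwarz applies. The factor `16` comes from moving the area and the integral to `∂F`, each at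
cost `4`. -/
theorem enorm_mul_flux_le (h : IsDeformation F E V t) {S : Set E3} (hS : IsComponent F S) (η : E3)
    (c : ℝ) :
    ‖c * ∫ y in deform V '' S, inner ℝ η (outerNormal E y) ∂(measure F E V)‖ₑ ^ 2 ≤
      ‖η‖ₑ ^ 2 * (16 * surfMeasure F S *
        ∫⁻ x in S, ‖meanCurv E (deform V x) - c‖ₑ ^ 2 ∂(surfMeasure F)) := by
  have hfinE := h.isFiniteMeasure
  obtain ⟨L, hL0, hL⟩ := h.exists_meanCurv_le
  set S' := deform V '' S with hS'
  have hHc : ContinuousOn (meanCurv E) (frontier E) := h.smooth'.isLocallySmooth_meanCurv.continuousOn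
  have hνc := h.continuousOn_inner_outerNormal η
  have hνb := fun y (hy : y ∈ frontier E) => abs_inner_outerNormal_le h.smooth' η hy
  have hgi : Integrable (fun y => inner ℝ η (outerNormal E y)) (measure F E V) :=
    h.integrable_of_bound hνc hνb
  have hHi : Integrable (fun y => meanCurv E y * inner ℝ η (outerNormal E y)) (measure F E V) :=
    h.integrable_of_bound (hHc.mul hνc) (L := L * ‖η‖) fun y hy => by
      rw [norm_mul]
      exact mul_le_mul (hL y hy) (hνb y hy) (norm_nonneg _) hL0.le
  have e1 : c * ∫ y in S', inner ℝ η (outerNormal E y) ∂(measure F E V) =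
      -∫ y in S', (meanCurv E y - c) * inner ℝ η (outerNormal E y) ∂(measure F E V) := by
    have h1 := h.setIntegral_meanCurv_inner hS η
    simp only [sub_mul]
    rw [integral_sub hHi.integrableOn (hgi.const_mul c).integrableOn, integral_const_mul, h1,
      zero_sub, neg_neg]
  have hmeas : AEMeasurable (fun y => ‖meanCurv E y - c‖ₑ) (bdryMeasure E) :=
    ((aestronglyMeasurable_bdry (hHc.sub continuousOn_const)).enorm)
  have e2 : ‖∫ y in S', (meanCurv E y - c) * inner ℝ η (outerNormal E y) ∂(measure F E V)‖ₑ ≤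
      ‖η‖ₑ * ∫⁻ y in S', ‖meanCurv E y - c‖ₑ ∂(measure F E V) := by
    refine (enorm_integral_le_lintegral_enorm _).trans ?_
    rw [← lintegral_const_mul' _ _ (by finiteness)]
    refine lintegral_mono_ae ?_
    filter_upwards [ae_restrict_of_ae (ae_measure hνb)] with y hy
    rw [enorm_mul, mul_comm]
    gcongr
    rw [← ofReal_norm, ← ofReal_norm]
    exact ENNReal.ofReal_le_ofReal hy
  have e3 := sq_lintegral_le ((aemeasurable_measure (F := F) (V := V) hmeas).restrict (s := S'))
  rw [Measure.restrict_apply_univ] at e3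
  have e4 := h.setLIntegral_image_le hS.subset hS.measurableSet (hmeas.pow_const 2)
  have e5 := h.measure_image_le hS.subset hS.measurableSet
  rw [e1, enorm_neg]
  calc _ ≤ (‖η‖ₑ * ∫⁻ y in S', ‖meanCurv E y - c‖ₑ ∂(measure F E V)) ^ 2 := by gcongr
    _ = ‖η‖ₑ ^ 2 * (∫⁻ y in S', ‖meanCurv E y - c‖ₑ ∂(measure F E V)) ^ 2 := mul_pow _ _ _
    _ ≤ ‖η‖ₑ ^ 2 * ((4 * surfMeasure F S) *
        (4 * ∫⁻ x in S, ‖meanCurv E (deform V x) - c‖ₑ ^ 2 ∂(surfMeasure F))) := by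
        gcongr
        refine e3.trans ?_
        gcongr
        · exact e5.trans (by gcongr; exact h.factor_le)
        · exact e4.trans (by gcongr; exact h.factor_le)
    _ = _ := by ring

theorem lintegral_grad_sq (g : E3 → ℝ≥0∞) :
    ∫⁻ x, (2 * g (deform V x)) ^ 2 ∂(surfMeasure F) =
      4 * ∫⁻ x, g (deform V x) ^ 2 ∂(surfMeasure F) := by
  rw [← lintegral_const_mul' _ _ (by finiteness)]
  refine lintegral_congr fun x => ?_
  rw [mul_pow]
  norm_num

theorem isUpperGradient_meanCurv (h : IsDeformation F E V t) :
    IsUpperGradient F (fun x => meanCurv E (deform V x))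
      (fun x => 2 * ‖tangGrad E (meanCurv E) (deform V x)‖ₑ) :=
  h.isUpperGradient (h.smooth'.isLocallySmooth_meanCurv.isUpperGradient h.smooth' h.periodic'
    (h.smooth'.isPeriodic_meanCurv h.periodic'))

end IsDeformation

/-- If the average of the normal over a component does not vanish, then the mean curvature of small
deformations is controlled by its gradient. -/
theorem IsComponent.exists_lintegral_meanCurv_le {F S : Set E3} (hS : IsComponent F S)
    (hF : IsSmoothSet F) {η : E3}
    (hη : 0 < ∫ x in S, inner ℝ η (outerNormal F x) ∂(surfMeasure F)) :
    ∃ t₀ : ℝ, 0 < t₀ ∧ ∃ C : ℝ≥0∞, C ≠ ⊤ ∧ ∀ E V t, IsDeformation F E V t → t ≤ t₀ →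
      ∫⁻ x in S, ‖meanCurv E (deform V x)‖ₑ ^ 2 ∂(surfMeasure F) ≤
        C * ∫⁻ x, ‖tangGrad E (meanCurv E) (deform V x)‖ₑ ^ 2 ∂(surfMeasure F) := by
  have hfin := isFiniteMeasure_surfMeasure hF
  obtain ⟨C, hC, hpoin⟩ := hS.poincare
  set n := ∫ x in S, inner ℝ η (outerNormal F x) ∂(surfMeasure F) with hn
  set a := (surfMeasure F).real S with ha
  set A := surfMeasure F S with hA
  have hAtop : A ≠ ⊤ := measure_ne_top _ _
  set m := ENNReal.ofReal (n / 8) ^ 2 with hm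
  have hm0 : m ≠ 0 := by
    have : 0 < ENNReal.ofReal (n / 8) := by simpa using hη
    positivity
  have hmtop : m ≠ ⊤ := by finiteness
  -- This bound on `t` makes the error `32 t ‖η‖ a` at most `n / 2`, so the flux through the
  -- deformed piece is at least `n / 8` in absolute value.
  refine ⟨n / (64 * (‖η‖ * a + 1)), by positivity,
    (4 + 4 * (m⁻¹ * (‖η‖ₑ ^ 2 * (16 * A))) * A) * (C * 4), by finiteness, fun E V t h ht => ?_⟩
  obtain ⟨c, hc⟩ := hpoin _ _ h.isUpperGradient_meanCurv
  rw [IsDeformation.lintegral_grad_sq fun y => ‖tangGrad E (meanCurv E) y‖ₑ] at hc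
  set G := ∫⁻ x, ‖tangGrad E (meanCurv E) (deform V x)‖ₑ ^ 2 ∂(surfMeasure F)
  set X := ∫⁻ x in S, ‖meanCurv E (deform V x) - c‖ₑ ^ 2 ∂(surfMeasure F)
  set b := ∫ y in deform V '' S, inner ℝ η (outerNormal E y) ∂(IsDeformation.measure F E V)
  have hb : n / 8 ≤ |b| := by
    have h1 := h.flux_lower_bound hS η
    have h2 : 32 * t * (‖η‖ * a) ≤ n / 2 := by
      have h3 : t * (64 * (‖η‖ * a + 1)) ≤ n := (le_div_iff₀ (by positivity)).1 ht
      have h4 : 0 < t := h.pos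
      linarith
    linarith
  have hcb := h.enorm_mul_flux_le hS η c
  -- A nonzero flux turns the bound on `c` times the flux into a bound on the Poincaré constant `c`
  -- itself.
  have hc2 : ‖c‖ₑ ^ 2 ≤ m⁻¹ * (‖η‖ₑ ^ 2 * (16 * A)) * X := by
    have h1 : m * ‖c‖ₑ ^ 2 ≤ ‖η‖ₑ ^ 2 * (16 * A * X) := by
      refine le_trans ?_ hcb
      rw [enorm_mul, mul_pow, mul_comm, hm]
      gcongr
      rw [← ofReal_norm]
      exact ENNReal.ofReal_le_ofReal hb
    calc ‖c‖ₑ ^ 2 = m⁻¹ * (m * ‖c‖ₑ ^ 2) := by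
          rw [← mul_assoc, ENNReal.inv_mul_cancel hm0 hmtop, one_mul]
      _ ≤ m⁻¹ * (‖η‖ₑ ^ 2 * (16 * A * X)) := by gcongr
      _ = _ := by ring
  calc _ ≤ ∫⁻ x in S, (4 * ‖meanCurv E (deform V x) - c‖ₑ ^ 2 + 4 * ‖c‖ₑ ^ 2) ∂(surfMeasure F) := by
        refine lintegral_mono fun x => ?_
        have := enorm_add_sq_le (meanCurv E (deform V x) - c) c
        rwa [sub_add_cancel] at this
    _ = 4 * X + 4 * ‖c‖ₑ ^ 2 * A := by
        rw [lintegral_add_right _ measurable_const, lintegral_const_mul' _ _ (by finiteness),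
          setLIntegral_const]
    _ ≤ 4 * X + 4 * (m⁻¹ * (‖η‖ₑ ^ 2 * (16 * A)) * X) * A := by gcongr
    _ = (4 + 4 * (m⁻¹ * (‖η‖ₑ ^ 2 * (16 * A))) * A) * X := by ring
    _ ≤ (4 + 4 * (m⁻¹ * (‖η‖ₑ ^ 2 * (16 * A))) * A) * (C * (4 * G)) := by gcongr
    _ = _ := by ring

/-- The mean curvature of small deformations of a strictly stable critical set is controlled by its
gradient, up to a constant. -/
theorem IsStrictlyStable.exists_lintegral_meanCurv_sub_le {F : Set E3} (hF : IsStrictlyStable F)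
    (𝒜 : Atlas F) :
    ∃ t₀ : ℝ, 0 < t₀ ∧ ∃ C : ℝ≥0∞, C ≠ ⊤ ∧ ∀ E V t, IsDeformation F E V t → t ≤ t₀ → ∃ c : ℝ,
      ∫⁻ x, ‖meanCurv E (deform V x) - c‖ₑ ^ 2 ∂(surfMeasure F) ≤
        C * ∫⁻ x, ‖tangGrad E (meanCurv E) (deform V x)‖ₑ ^ 2 ∂(surfMeasure F) := by
  choose S hS hsub using fun i => 𝒜.exists_isComponent hF.smooth hF.periodic i
  -- Stability is used only when some component has a vanishing integral of the normal; it is then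
  -- the whole boundary, and one Poincaré constant suffices.
  by_cases hall : ∃ i, ∀ η : E3, ∫ x in S i, inner ℝ η (outerNormal F x) ∂(surfMeasure F) = 0
  · obtain ⟨i, hi⟩ := hall
    have hcover := hF.frontier_subset (hS i) hi
    obtain ⟨C, hC, hpoin⟩ := (hS i).poincare
    refine ⟨1, one_pos, C * 4, by finiteness, fun E V t h _ => ?_⟩
    obtain ⟨c, hc⟩ := hpoin _ _ h.isUpperGradient_meanCurv
    rw [IsDeformation.lintegral_grad_sq fun y => ‖tangGrad E (meanCurv E) y‖ₑ,
      Measure.restrict_eq_self_of_ae_mem ((ae_mem_frontier F).mono fun x hx => hcover hx)] at hc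
    exact ⟨c, hc.trans_eq (mul_assoc _ _ _).symm⟩
  · push Not at hall
    have hpos : ∀ i, ∃ η : E3, 0 < ∫ x in S i, inner ℝ η (outerNormal F x) ∂(surfMeasure F) := by
      intro i
      obtain ⟨η, hη⟩ := hall i
      rcases lt_or_gt_of_ne hη with h | h
      · refine ⟨-η, ?_⟩
        simp only [inner_neg_left, integral_neg]
        linarith
      · exact ⟨η, h⟩
    choose η hη using hpos
    choose T hT C hC h using fun i => (hS i).exists_lintegral_meanCurv_le hF.smooth (hη i)
    have hsmall : ∀ᶠ t in 𝓝[>] (0 : ℝ), ∀ i, t ≤ T i := eventually_all.2 fun i =>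
      ((gt_mem_nhds (hT i)).filter_mono nhdsWithin_le_nhds).mono fun t ht => ht.le
    obtain ⟨t₀, ht₀, ht₀pos⟩ := (hsmall.and self_mem_nhdsWithin).exists
    -- On every component the mean curvature itself is bounded by its gradient, so the common
    -- constant `0` works and the finitely many bounds add up.
    refine ⟨t₀, ht₀pos, ∑ i, C i, by simp [ENNReal.sum_eq_top, hC],
      fun E V t hd ht => ⟨0, ?_⟩⟩
    simp only [sub_zero]
    have hcover : ∀ᵐ x ∂(surfMeasure F), x ∈ ⋃ i, S i := by
      filter_upwards [ae_mem_frontier F] with x hx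
      obtain ⟨i, k, hik⟩ := 𝒜.exists_patch x hx
      exact Set.mem_iUnion.2 ⟨i, ((hS i).periodic k x).1
        (hsub i (hik x hx (by simpa using 𝒜.scale_pos)))⟩
    rw [← Measure.restrict_eq_self_of_ae_mem hcover, Finset.sum_mul]
    refine (lintegral_iUnion_le _ _).trans ?_
    rw [tsum_fintype, Measure.restrict_eq_self_of_ae_mem hcover]
    exact Finset.sum_le_sum fun i _ => h i E V t hd (ht.trans (ht₀ i))

/-- Each of the two integrals is moved between the boundaries at the cost of a factor `4`. -/
theorem IsDeformation.lintegral_meanCurv_sub_le {F E : Set E3} {V : E3 → E3} {t : ℝ}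
    (h : IsDeformation F E V t) {C : ℝ≥0∞} {c : ℝ}
    (hc : ∫⁻ x, ‖meanCurv E (deform V x) - c‖ₑ ^ 2 ∂(surfMeasure F) ≤
      C * ∫⁻ x, ‖tangGrad E (meanCurv E) (deform V x)‖ₑ ^ 2 ∂(surfMeasure F)) :
    ∫⁻ x, ‖meanCurv E x - c‖ₑ ^ 2 ∂(surfMeasure E) ≤
      16 * C * ∫⁻ x, ‖tangGrad E (meanCurv E) x‖ₑ ^ 2 ∂(surfMeasure E) := by
  have hHs := h.smooth'.isLocallySmooth_meanCurv
  have hHp := h.smooth'.isPeriodic_meanCurv h.periodic'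
  have hm1 : AEMeasurable (fun x => ‖meanCurv E x - c‖ₑ ^ 2) (bdryMeasure E) :=
    (aestronglyMeasurable_bdry (hHs.continuousOn.sub continuousOn_const)).enorm.pow_const 2
  have hm2 : AEMeasurable (fun x => ‖tangGrad E (meanCurv E) x‖ₑ ^ 2) (bdryMeasure E) :=
    (aestronglyMeasurable_bdry (hHs.continuousOn_tangGrad h.smooth')).enorm.pow_const 2
  rw [← h.lintegral_measure (f := fun x => ‖meanCurv E x - c‖ₑ ^ 2)
      (fun k x hx => by beta_reduce; rw [hHp k x hx]),
    ← h.lintegral_measure (f := fun x => ‖tangGrad E (meanCurv E) x‖ₑ ^ 2)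
      (fun k x hx => by
        beta_reduce
        rw [hHs.isPeriodic_tangGrad h.smooth' h.periodic' hHp k x hx])]
  calc _ ≤ 4 * (C * (4 * ∫⁻ x, ‖tangGrad E (meanCurv E) x‖ₑ ^ 2 ∂(IsDeformation.measure F E V))) := by
        refine (h.lintegral_measure_le hm1).trans ?_
        gcongr
        refine hc.trans ?_
        gcongr
        exact h.lintegral_deform_le hm2
    _ = _ := by ring

/-! ### Passage to real integrals and to the average -/

theorem enorm_sq_eq_ofReal {V : Type*} [NormedAddCommGroup V] (v : V) :
    ‖v‖ₑ ^ 2 = ENNReal.ofReal (‖v‖ ^ 2) := by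
  rw [← ofReal_norm, ENNReal.ofReal_pow (norm_nonneg _)]

/-- The average is the constant closest to a function in `L²`. -/
theorem integral_sub_average_sq_le {X : Type*} [MeasurableSpace X] {μ : Measure X}
    [IsFiniteMeasure μ] {f : X → ℝ} (hf : MemLp f 2 μ) (c : ℝ) :
    ∫ x, |f x - ⨍ y, f y ∂μ| ^ 2 ∂μ ≤ ∫ x, |f x - c| ^ 2 ∂μ := by
  set m := ⨍ y, f y ∂μ with hm
  have hi : Integrable f μ := hf.integrable one_le_two
  have h1 : Integrable (fun x => |f x - m| ^ 2) μ := by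
    simpa using (hf.sub (memLp_const m)).integrable_norm_pow two_ne_zero
  have h0 : Integrable (fun x => 2 * (m - c) * (f x - m)) μ :=
    (hi.sub (integrable_const m)).const_mul _
  have h2 : Integrable (fun x => 2 * (m - c) * (f x - m) + (m - c) ^ 2) μ :=
    h0.add (integrable_const _)
  have h3 : ∫ x, (2 * (m - c) * (f x - m) + (m - c) ^ 2) ∂μ = μ.real Set.univ * (m - c) ^ 2 := by
    rw [integral_add h0 (integrable_const _),
      integral_const_mul, hm, integral_sub_average, mul_zero, zero_add, integral_const, smul_eq_mul]
  -- The cross term vanishes because `f - m` has zero integral.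
  have h4 : ∫ x, |f x - c| ^ 2 ∂μ = ∫ x, |f x - m| ^ 2 ∂μ + μ.real Set.univ * (m - c) ^ 2 := by
    rw [← h3, ← integral_add h1 h2]
    refine integral_congr_ae (Eventually.of_forall fun x => ?_)
    simp only [sq_abs]
    ring
  rw [h4]
  have : 0 ≤ μ.real Set.univ * (m - c) ^ 2 := by positivity
  linarith

theorem IsDeformation.integral_meanCurv_sub_average_le {F E : Set E3} {V : E3 → E3} {t : ℝ}
    (h : IsDeformation F E V t) {C : ℝ≥0∞} (hC : C ≠ ⊤) {c : ℝ}
    (hc : ∫⁻ x, ‖meanCurv E (deform V x) - c‖ₑ ^ 2 ∂(surfMeasure F) ≤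
      C * ∫⁻ x, ‖tangGrad E (meanCurv E) (deform V x)‖ₑ ^ 2 ∂(surfMeasure F)) :
    ∫ x, |meanCurv E x - ⨍ y, meanCurv E y ∂(surfMeasure E)| ^ 2 ∂(surfMeasure E) ≤
      (16 * C).toReal * ∫ x, ‖tangGrad E (meanCurv E) x‖ ^ 2 ∂(surfMeasure E) := by
  have hfin := isFiniteMeasure_surfMeasure h.smooth'
  have hHs := h.smooth'.isLocallySmooth_meanCurv
  have hHp := h.smooth'.isPeriodic_meanCurv h.periodic'
  have hmeas : ∀ {W : Type} [NormedAddCommGroup W] [SecondCountableTopology W] {f : E3 → W},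
      ContinuousOn f (frontier E) → AEStronglyMeasurable f (surfMeasure E) := fun hf => by
    rw [surfMeasure_eq]
    exact (aestronglyMeasurable_bdry hf).restrict
  obtain ⟨L, hL0, hL⟩ := h.exists_meanCurv_le
  have hD := hHs.continuousOn_tangGrad h.smooth'
  obtain ⟨M, hM0, hM⟩ := exists_norm_le_of_isPeriodic h.periodic' hD
    (hHs.isPeriodic_tangGrad h.smooth' h.periodic' hHp)
  -- Continuity and periodicity bound `H` and `D_τ H` on the boundary. The real integrals are
  -- therefore genuine, not the default value of a non-integrable function.
  have hH2 : MemLp (meanCurv E) 2 (surfMeasure E) :=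
    MemLp.of_bound (hmeas hHs.continuousOn) L (ae_surf hL)
  have hD2 : MemLp (tangGrad E (meanCurv E)) 2 (surfMeasure E) :=
    MemLp.of_bound (hmeas hD) M (ae_surf hM)
  refine (integral_sub_average_sq_le hH2 c).trans ?_
  have h1 := h.lintegral_meanCurv_sub_le hc
  simp only [enorm_sq_eq_ofReal] at h1
  have hint : Integrable (fun x => ‖meanCurv E x - c‖ ^ 2) (surfMeasure E) :=
    (hH2.sub (memLp_const c)).integrable_norm_pow two_ne_zero
  rw [← ofReal_integral_eq_lintegral_ofReal hint
      (Eventually.of_forall fun x => sq_nonneg _),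
    ← ofReal_integral_eq_lintegral_ofReal (hD2.integrable_norm_pow two_ne_zero)
      (Eventually.of_forall fun x => sq_nonneg _)] at h1
  have h2 := ENNReal.toReal_mono (by finiteness) h1
  rw [ENNReal.toReal_mul, ENNReal.toReal_ofReal (integral_nonneg fun x => sq_nonneg _),
    ENNReal.toReal_ofReal (integral_nonneg fun x => sq_nonneg _)] at h2
  exact h2

end TorusSurface

end

theorem lemma4p7 (p : ℝ) (hp : 2 < p) (F : Set E3) (hF : IsStrictlyStable F) :
    ∃ δ₁ : ℝ, 0 < δ₁ ∧ ∃ C : ℝ, 0 < C ∧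
      ∀ E : Set E3, IsPeriodicSet E → IsSmoothSet E → IsSobolevClose F p δ₁ E →
        ∫ x, |meanCurv E x - ⨍ y, meanCurv E y ∂(surfMeasure E)| ^ 2 ∂(surfMeasure E) ≤
          C * ∫ x, ‖tangGrad E (meanCurv E) x‖ ^ 2 ∂(surfMeasure E) := by
  obtain ⟨𝒜⟩ := hF.smooth.nonempty_atlas hF.periodic
  obtain ⟨t₀, ht₀, C, hC, hmain⟩ := hF.exists_lintegral_meanCurv_sub_le 𝒜
  obtain ⟨M, hM, hfield⟩ := 𝒜.exists_isSmallField hF.smooth hF.periodic hp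
  -- The three bounds ensure the main estimate, the bi-Lipschitz estimates, and that distances up to
  -- `4t` stay within the scale of the atlas.
  set t := min t₀ (min (1 / 2) (𝒜.scale / 4)) with ht
  have htpos : 0 < t := lt_min ht₀ (lt_min one_half_pos (by linarith [𝒜.scale_pos]))
  have ht1 : t ≤ 1 / 2 := (min_le_right _ _).trans (min_le_left _ _)
  have ht2 : t ≤ 𝒜.scale / 4 := (min_le_right _ _).trans (min_le_right _ _)
  -- A `W^{2,p}` norm at most `t / M` makes the displacement `t`-small in `C¹`; adding `1` to the
  -- constant guarantees positivity.
  refine ⟨t / M, by positivity, (16 * C).toReal + 1, by positivity, ?_⟩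
  rintro E hEp hE ⟨ψ, hψ, hsob, himg⟩
  have hV := hfield ψ hψ (t / M) (by positivity) hsob
  rw [mul_div_cancel₀ _ hM.ne'] at hV
  have hdef : IsDeformation F E (fun x => ψ x • outerNormal F x) t :=
    ⟨hF.smooth, hF.periodic, hE, hEp, htpos, ht1, ⟨𝒜.scale, by linarith, hV⟩, himg⟩
  obtain ⟨c, hc⟩ := hmain E _ t hdef (min_le_left _ _)
  refine (hdef.integral_meanCurv_sub_average_le hC hc).trans ?_
  have : 0 ≤ ∫ x, ‖tangGrad E (meanCurv E) x‖ ^ 2 ∂(surfMeasure E) :=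
    integral_nonneg fun x => sq_nonneg _
  nlinarith
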